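/- Conventions. All ground sets $V$ are finite, and products of maps are read from left to right ($gf$ applies $g$ first). $\operatorname{Label}(V)$ is the set of bijections $V\to\{1,\dots,|V|\}$. A group coset over $V$ is a set $Gf=\{gf\mid g\in G\}$ with $G\le\operatorname{Sym}(V)$, $f\in\operatorname{Sym}(V)$; a labeling coset of $V$ is a set $\Delta\rho=\{\delta\rho\mid\delta\in\Delta\}$ with $\Delta\le\operatorname{Sym}(V)$, $\rho\in\operatorname{Label}(V)$. For a set $X\subseteq\operatorname{Sym}(V)$ put $\operatorname{Norm}_\Delta(X)=\{\delta\in\Delta\mid\delta^{-1}X\delta=X\}$. Consider the instances $(Gf,\Delta\rho)$, where $Gf$ is a group coset over a finite set $V$ and $\Delta\rho$ is a labeling coset of $V$ such that $\Delta=\operatorname{Norm}_\Delta(G)$, i.e. $\Delta$ normalizes $G$. **Lemma.** There is a function $\operatorname{CL}$ that assigns to each such instance a labeling coset $\operatorname{CL}(Gf,\Delta\rho)$ of $V$ with 1. (CL1) $\operatorname{CL}(Gf,\Delta\rho)=\phi\,\operatorname{CL}(\phi^{-1}Gf\phi,\ \phi^{-1}\Delta\rho)$ for every bijection $\phi:V\to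 V'$, 2. (CL2) $\operatorname{CL}(Gf,\Delta\rho)=\operatorname{Norm}_\Delta(Gf)\,\pi$ for some (and thus for all) $\pi\in\operatorname{CL}(Gf,\Delta\rho)$, and that can be computed in time $2^{O(k)}|V|^{O(1)}$, where $k$ is the size of the largest $\Delta$-orbit on $V$. Here the elements of $V$ are given to the algorithm under arbitrary names $0,\dots,|V|-1$, the cosets $Gf$ and $\Delta\rho$ are given by generating sets $S$ of $G$ and $T$ of $\Delta$ together with representatives $f$ and $\rho$, and the output is a generating set of $\operatorname{Norm}_\Delta(Gf)$ together with a representative $\pi$. As usual, the bound is meant for generating sets of size polynomial in $|V|$; for arbitrary lists $S$ and $T$ of generators the time is at most $C\cdot 2^{Ck}\,(|V|+|S|+|T|+1)^{C}$ with an absolute constant $C$. -/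

import Mathlib

universe u

namespace PermCanon

open Equiv

/-! ### Group cosets, labeling cosets and canonical labelings

Products of maps are read from left to right in the informal notation (`g f` applies `g` first),
whereas `*` on `Equiv.Perm V` and `∘` apply the right factor first. -/

/-- The group coset `G f = {g f | g ∈ G}`, where `g f` applies `g` first and `f` second. -/
def groupCoset {V : Type u} (G : Subgroup (Perm V)) (f : Perm V) : Set (Perm V) :=
  {x | ∃ g ∈ G, x = f * g}

/-- `ρ` is a bijection from `V` to `{1, …, |V|}`. -/
def IsLabeling {V : Type u} (ρ : V → ℕ) : Prop :=
  Set.BijOn ρ Set.univ (Set.Icc 1 (Nat.card V))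

/-- The labeling coset `Δ ρ = {δ ρ | δ ∈ Δ}`, where `δ ρ` applies `δ` first and `ρ` second. -/
def labelingCoset {V : Type u} (Δ : Subgroup (Perm V)) (ρ : V → ℕ) : Set (V → ℕ) :=
  {l | ∃ δ ∈ Δ, l = ρ ∘ δ}

/-- `Norm_Δ(X) = {δ ∈ Δ | δ⁻¹ X δ = X}` for a set `X` of permutations
(`δ⁻¹ x δ`, read from left to right, is `δ * x * δ⁻¹` in Mathlib's order). -/
def normIn {V : Type u} (Δ : Subgroup (Perm V)) (X : Set (Perm V)) : Subgroup (Perm V) :=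
  Δ ⊓ Subgroup.normalizer X

/-- The image `φ⁻¹ X φ` of a set of permutations of `V` under a bijection `φ : V → V'`. -/
def mapPerms {V V' : Type u} (φ : V ≃ V') (X : Set (Perm V)) : Set (Perm V') :=
  (fun x => φ.permCongr x) '' X

/-- The image `φ⁻¹ Y` of a set of labelings of `V` under a bijection `φ : V → V'`. -/
def mapLabelings {V V' : Type u} (φ : V ≃ V') (Y : Set (V → ℕ)) : Set (V' → ℕ) :=
  (fun l => l ∘ φ.symm) '' Y

/-- The set `φ Y` for a set of labelings of `V'` and a bijection `φ : V → V'`. -/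
def pullLabelings {V V' : Type u} (φ : V ≃ V') (Y : Set (V' → ℕ)) : Set (V → ℕ) :=
  (fun l => l ∘ φ) '' Y

/-- Functions that assign to pairs (set of permutations, set of labelings) over a finite ground
set a set of labelings. As the arguments are sets, the value on `(G f, Δ ρ)` cannot
depend on the chosen representatives `f`, `ρ` or on generating sets. -/
abbrev LabelingFunction : Type (u + 1) :=
  ∀ (V : Type u) [Finite V], Set (Perm V) → Set (V → ℕ) → Set (V → ℕ)

/-- `CL` is a canonical labeling function on the pairs `(G f, Δ ρ)` with `Δ = Norm_Δ(G)`. -/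
def SolvesShift (CL : LabelingFunction.{u}) : Prop :=
  ∀ (V : Type u) [Finite V] (G Δ : Subgroup (Perm V)) (f : Perm V) (ρ : V → ℕ),
    IsLabeling ρ → Δ = normIn Δ (G : Set (Perm V)) →
      (∀ (V' : Type u) [Finite V'] (φ : V ≃ V'),
        CL V (groupCoset G f) (labelingCoset Δ ρ) =
          pullLabelings φ
            (CL V' (mapPerms φ (groupCoset G f)) (mapLabelings φ (labelingCoset Δ ρ)))) ∧
      ∃ π : V → ℕ, IsLabeling π ∧
        CL V (groupCoset G f) (labelingCoset Δ ρ) =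
          labelingCoset (normIn Δ (groupCoset G f)) π

/-- The size of the largest `Δ`-orbit on a finite set `V` (`0` if `V` is empty). -/
noncomputable def maxOrbit {V : Type u} (Δ : Subgroup (Perm V)) : ℕ :=
  ⨆ v : V, (MulAction.orbit Δ v).ncard

/-! ### A machine model with a step count

Data are pointer structures: numbers and pairs. Programs are finite lists of mutually recursive
first-order functions of one argument, evaluated call-by-value. Every elementary
operation (reading a variable, a constant, successor, predecessor, comparison of two numbers,
forming or taking apart a pair, a test, a local definition, a call) costs one step. -/

/-- Binary trees with numbers at the leaves. -/
inductive Data : Type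
  | num (n : ℕ) : Data
  | pair (a b : Data) : Data

namespace Data

/-- The number stored in a leaf; `0` for a pair. -/
def toNat : Data → ℕ
  | num n => n
  | pair _ _ => 0

/-- First component of a pair; `0` for a leaf. -/
def fst : Data → Data
  | num _ => num 0
  | pair a _ => a

/-- Second component of a pair; `0` for a leaf. -/
def snd : Data → Data
  | num _ => num 0
  | pair _ b => b

/-- `1` for a pair and `0` for a leaf. -/
def isPair : Data → Data
  | num _ => num 0
  | pair _ _ => num 1

/-- The size of a tree, numbers being counted in unary. -/
def size : Data → ℕ
  | num n => n + 1
  | pair a b => a.size + b.size + 1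

/-- Lists as right-nested pairs, ended by the leaf `0`. -/
def ofList : List Data → Data
  | [] => num 0
  | a :: l => pair a (ofList l)

end Data

/-- Expressions. Variables are de Bruijn indices: `bind a b` evaluates `a` and then `b` with the
value of `a` as variable `0`. -/
inductive Code : Type
  | var (i : ℕ) : Code
  | num (n : ℕ) : Code
  | succ (a : Code) : Code
  | pred (a : Code) : Code
  | less (a b : Code) : Code
  | pair (a b : Code) : Code
  | fst (a : Code) : Code
  | snd (a : Code) : Code
  | isPair (a : Code) : Code
  | cond (c a b : Code) : Code
  | bind (a b : Code) : Code
  | call (i : ℕ) (a : Code) : Code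

/-- A program: the list of the bodies of its functions. In a body, variable `0` is the argument. -/
abbrev Program : Type := List Code

/-- `Runs p env c v t`: in the program `p`, with the variables bound to the entries of `env`, the
expression `c` evaluates to `v` in exactly `t` steps. -/
inductive Runs (p : Program) : List Data → Code → Data → ℕ → Prop
  | var (env : List Data) (i : ℕ) :
      Runs p env (Code.var i) (env.getD i (Data.num 0)) 1
  | num (env : List Data) (n : ℕ) :
      Runs p env (Code.num n) (Data.num n) 1
  | succ {env : List Data} {a : Code} {x : Data} {s : ℕ} :
      Runs p env a x s → Runs p env (Code.succ a) (Data.num (x.toNat + 1)) (s + 1)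
  | pred {env : List Data} {a : Code} {x : Data} {s : ℕ} :
      Runs p env a x s → Runs p env (Code.pred a) (Data.num (x.toNat - 1)) (s + 1)
  | less {env : List Data} {a b : Code} {x y : Data} {s t : ℕ} :
      Runs p env a x s → Runs p env b y t →
      Runs p env (Code.less a b) (Data.num (if x.toNat < y.toNat then 1 else 0)) (s + t + 1)
  | pair {env : List Data} {a b : Code} {x y : Data} {s t : ℕ} :
      Runs p env a x s → Runs p env b y t →
      Runs p env (Code.pair a b) (Data.pair x y) (s + t + 1)
  | fst {env : List Data} {a : Code} {x : Data} {s : ℕ} :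
      Runs p env a x s → Runs p env (Code.fst a) x.fst (s + 1)
  | snd {env : List Data} {a : Code} {x : Data} {s : ℕ} :
      Runs p env a x s → Runs p env (Code.snd a) x.snd (s + 1)
  | isPair {env : List Data} {a : Code} {x : Data} {s : ℕ} :
      Runs p env a x s → Runs p env (Code.isPair a) x.isPair (s + 1)
  | condTrue {env : List Data} {c a b : Code} {x y : Data} {s t : ℕ} :
      Runs p env c x s → x.toNat ≠ 0 → Runs p env a y t →
      Runs p env (Code.cond c a b) y (s + t + 1)
  | condFalse {env : List Data} {c a b : Code} {x y : Data} {s t : ℕ} :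
      Runs p env c x s → x.toNat = 0 → Runs p env b y t →
      Runs p env (Code.cond c a b) y (s + t + 1)
  | bind {env : List Data} {a b : Code} {x y : Data} {s t : ℕ} :
      Runs p env a x s → Runs p (x :: env) b y t →
      Runs p env (Code.bind a b) y (s + t + 1)
  | call {env : List Data} {i : ℕ} {a body : Code} {x y : Data} {s t : ℕ} :
      Runs p env a x s → p[i]? = some body → Runs p [x] body y t →
      Runs p env (Code.call i a) y (s + t + 1)

/-- Function `0` of the program `p` turns the input `x` into the output `y` within time `T`. Besides
the steps of the evaluation, the time includes the writing of the output, because the value of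
a run may share subtrees. -/
def ComputesIn (p : Program) (x y : Data) (T : ℕ) : Prop :=
  ∃ t : ℕ, Runs p [x] (Code.call 0 (Code.var 0)) y t ∧ t + y.size ≤ T

/-! ### Inputs and outputs

A bijection `e` names the elements of `V` by `0, …, |V| - 1`. It is arbitrary, and the machine sees
`V` only through these names. -/

/-- A map `l : V → ℕ` as the list of its values, in the order of the names. -/
noncomputable def encodeMap {V : Type u} (e : V ≃ Fin (Nat.card V)) (l : V → ℕ) : Data :=
  Data.ofList (List.ofFn fun i : Fin (Nat.card V) => Data.num (l (e.symm i)))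

/-- A permutation as the list of the names of its values, in the order of the names. -/
noncomputable def encodePerm {V : Type u} (e : V ≃ Fin (Nat.card V)) (g : Perm V) : Data :=
  encodeMap e fun v => (e (g v)).val

/-- A list of permutations. -/
noncomputable def encodePerms {V : Type u} (e : V ≃ Fin (Nat.card V)) (S : List (Perm V)) : Data :=
  Data.ofList (S.map (encodePerm e))

/-- The group generated by a list of permutations. -/
def gen {V : Type u} (S : List (Perm V)) : Subgroup (Perm V) :=
  Subgroup.closure {g | g ∈ S}

/-- The input `(⟨S⟩ f, ⟨T⟩ ρ)`, given by the number `|V|`, the generators `S`, the representative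
`f`, the generators `T` and the representative `ρ`. -/
noncomputable def encodeInput {V : Type u} (e : V ≃ Fin (Nat.card V)) (S : List (Perm V))
    (f : Perm V) (T : List (Perm V)) (ρ : V → ℕ) : Data :=
  Data.ofList
    [Data.num (Nat.card V), encodePerms e S, encodePerm e f, encodePerms e T, encodeMap e ρ]

/-- `y` represents the set `L` of labelings: it consists of generators of a group `Θ` and of
a labeling `π` such that `L = Θ π`. -/
def Represents {V : Type u} (e : V ≃ Fin (Nat.card V)) (y : Data) (L : Set (V → ℕ)) : Prop :=
  ∃ (R : List (Perm V)) (π : V → ℕ), IsLabeling π ∧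
    y = Data.pair (encodePerms e R) (encodeMap e π) ∧ L = labelingCoset (gen R) π

end PermCanon

/-!
# Canonical labelings of group cosets under a normalizing labeling coset

Let `Δ` normalize `G`. The value `canon` of the canonical labeling function consists of those
labelings `l` in `Δ ρ` under which the inverse of some element `x` of `G f`, read as a permutation
of the labels, becomes lexicographically smallest. The positions are compared in the order given by
`positions`, in which the orbits of `Δ` are contiguous; this order depends on the labeling coset
only. Hence `canon` is equivariant, and as an element of `Δ` that conjugates one element of `G f`
to another one normalizes `G f`, the minimizing labelings form a coset of the normalizer
(`solvesShift_canon`).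

To compute `canon`, labeling and permutation are treated together. On two copies of `V` the pairs
`(b, a)` with `b ∈ Δ` and `a ∈ b G` form a group (`mem_gen_embGens`), and conjugating the map `f⁻¹`
from the first to the second copy by `(b, a)` gives `a⁻¹ f⁻¹ b`. So the task is to minimize, over a
permutation group, the word of values of `σ⁻¹ W σ` for a fixed map `W` on a list of points, and the
minimizing elements form a coset again (`Solves`, `canon_eq`).

The word is minimized on one orbit `A` of points at a time (`call_blockFold`), which is possible by
`Solves.append`, and on an orbit by divide and conquer (`call_mini`): with `H` the setwise
stabilizer of the first half of `A`, the coset `σ Γ` splits into at most `2 ^ |A|` cosets of `H`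
(`length_le_two_pow`), on each of them both halves are invariant and are treated in turn, and the
results are compared and those with the same word are joined (`Joined`). For a single point, which
is then fixed by the group, one needs the orbit and the stabilizer of another single point
(`call_point`). If `T a` is the time for `a` points, then `T a ≤ 2 ^ a * 2 * T (a / 2)` up to terms
of lower order, so that `T a = 2 ^ O(a)` times a polynomial (`mini_time`). Setwise stabilizers come
from the orbit algorithm with Schreier generators (`call_stab`), whose number is reduced to a
quadratic one by a sifting filter that keeps at most one permutation for each first moved point and
image of it (`call_filter`).

The program is written out for the machine model (`prog`). Its functions are verified by a weakest
precondition calculus (`wp_sound`) with rules for the two kinds of loops (`CallLe.map`,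
`CallLe.fold`). A specification `CallLe prog i x y T` bounds the time by a power of a number `M`
that dominates the size of the input and `2 ^ k`, apart from the factor `4096 ^ a` in the
recursion.
-/

namespace PermCanon

open Equiv

/-! ### A program logic for the machine -/

/-- Function `i` of the program `p` maps `x` to some value in some number of steps which
satisfy `Q`. -/
def Called (p : Program) (i : ℕ) (x : Data) (Q : Data → ℕ → Prop) : Prop :=
  ∃ y t, (∃ body, p[i]? = some body ∧ Runs p [x] body y t) ∧ Q y t

/-- The value is `y` and the number of steps at most `T`. -/
def Post (y : Data) (T : ℕ) (z : Data) (t : ℕ) : Prop := z = y ∧ t ≤ T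

/-- Weakest precondition: `wp p c env Q` says that the expression `c` evaluates to some value in
some number of steps which satisfy `Q`. -/
def wp (p : Program) : Code → List Data → (Data → ℕ → Prop) → Prop
  | .var i, env, Q => Q (env.getD i (.num 0)) 1
  | .num n, _, Q => Q (.num n) 1
  | .succ a, env, Q => wp p a env fun x s => Q (.num (x.toNat + 1)) (s + 1)
  | .pred a, env, Q => wp p a env fun x s => Q (.num (x.toNat - 1)) (s + 1)
  | .less a b, env, Q => wp p a env fun x s => wp p b env fun y t =>
      Q (.num (if x.toNat < y.toNat then 1 else 0)) (s + t + 1)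
  | .pair a b, env, Q => wp p a env fun x s => wp p b env fun y t => Q (.pair x y) (s + t + 1)
  | .fst a, env, Q => wp p a env fun x s => Q x.fst (s + 1)
  | .snd a, env, Q => wp p a env fun x s => Q x.snd (s + 1)
  | .isPair a, env, Q => wp p a env fun x s => Q x.isPair (s + 1)
  | .cond c a b, env, Q => wp p c env fun x s =>
      if x.toNat = 0 then wp p b env fun y t => Q y (s + t + 1)
      else wp p a env fun y t => Q y (s + t + 1)
  | .bind a b, env, Q => wp p a env fun x s => wp p b (x :: env) fun y t => Q y (s + t + 1)
  | .call i a, env, Q => wp p a env fun x s =>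
      Called p i x fun y t => Q y (s + t + 1)

theorem wp_sound {p : Program} (c : Code) :
    ∀ {env : List Data} {Q : Data → ℕ → Prop}, wp p c env Q → ∃ y t, Runs p env c y t ∧ Q y t := by
  induction c with
  | var i => intro env Q h; exact ⟨_, _, .var _ _, h⟩
  | num n => intro env Q h; exact ⟨_, _, .num _ _, h⟩
  | succ a ih => intro env Q h; obtain ⟨x, s, hr, h⟩ := ih h; exact ⟨_, _, .succ hr, h⟩
  | pred a ih => intro env Q h; obtain ⟨x, s, hr, h⟩ := ih h; exact ⟨_, _, .pred hr, h⟩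
  | less a b iha ihb =>
    intro env Q h
    obtain ⟨x, s, hr, h⟩ := iha h
    obtain ⟨y, t, hr', h⟩ := ihb h
    exact ⟨_, _, .less hr hr', h⟩
  | pair a b iha ihb =>
    intro env Q h
    obtain ⟨x, s, hr, h⟩ := iha h
    obtain ⟨y, t, hr', h⟩ := ihb h
    exact ⟨_, _, .pair hr hr', h⟩
  | fst a ih => intro env Q h; obtain ⟨x, s, hr, h⟩ := ih h; exact ⟨_, _, .fst hr, h⟩
  | snd a ih => intro env Q h; obtain ⟨x, s, hr, h⟩ := ih h; exact ⟨_, _, .snd hr, h⟩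
  | isPair a ih => intro env Q h; obtain ⟨x, s, hr, h⟩ := ih h; exact ⟨_, _, .isPair hr, h⟩
  | cond c a b ihc iha ihb =>
    intro env Q h
    obtain ⟨x, s, hr, h⟩ := ihc h
    split_ifs at h with hx
    · obtain ⟨y, t, hr', h⟩ := ihb h
      exact ⟨_, _, .condFalse hr hx hr', h⟩
    · obtain ⟨y, t, hr', h⟩ := iha h
      exact ⟨_, _, .condTrue hr hx hr', h⟩
  | bind a b iha ihb =>
    intro env Q h
    obtain ⟨x, s, hr, h⟩ := iha h
    obtain ⟨y, t, hr', h⟩ := ihb h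
    exact ⟨_, _, .bind hr hr', h⟩
  | call i a ih =>
    intro env Q h
    obtain ⟨x, s, hr, y, t, ⟨body, hb, hr'⟩, h⟩ := ih h
    exact ⟨_, _, .call hr hb hr', h⟩

/-- Function `i` of the program `p` maps `x` to `y` within `T` steps. -/
def CallLe (p : Program) (i : ℕ) (x y : Data) (T : ℕ) : Prop :=
  ∃ t ≤ T, ∃ body, p[i]? = some body ∧ Runs p [x] body y t

theorem CallLe.mono {p : Program} {i : ℕ} {x y : Data} {T T' : ℕ} (h : CallLe p i x y T)
    (hT : T ≤ T') : CallLe p i x y T' :=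
  let ⟨t, ht, hr⟩ := h; ⟨t, ht.trans hT, hr⟩

theorem CallLe.of_wp {p : Program} {i : ℕ} {body : Code} {x y : Data} {T : ℕ}
    (hb : p[i]? = some body) (h : wp p body [x] (Post y T)) : CallLe p i x y T := by
  obtain ⟨z, t, hr, rfl, ht⟩ := wp_sound body h
  exact ⟨t, ht, body, hb, hr⟩

/-- A known call inside a weakest precondition: only the bound on its running time is kept. -/
theorem CallLe.wp_call {p : Program} {i : ℕ} {x y : Data} {T : ℕ} (h : CallLe p i x y T)
    {Q : Data → ℕ → Prop} (hQ : ∀ t ≤ T, Q y t) :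
    Called p i x Q :=
  let ⟨t, ht, hr⟩ := h; ⟨y, t, hr, hQ t ht⟩

@[simp] theorem Data.toNat_num (n : ℕ) : (Data.num n).toNat = n := rfl
@[simp] theorem Data.fst_pair (a b : Data) : (Data.pair a b).fst = a := rfl
@[simp] theorem Data.snd_pair (a b : Data) : (Data.pair a b).snd = b := rfl
@[simp] theorem Data.fst_num (n : ℕ) : (Data.num n).fst = .num 0 := rfl
@[simp] theorem Data.snd_num (n : ℕ) : (Data.num n).snd = .num 0 := rfl
@[simp] theorem Data.isPair_pair (a b : Data) : (Data.pair a b).isPair = .num 1 := rfl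
@[simp] theorem Data.isPair_num (n : ℕ) : (Data.num n).isPair = .num 0 := rfl

/-- The body of a function `self` that maps `(ctx, (l, tl))` to the list of the values of
function `c` at `(ctx, b)`, for `b` in `l`, followed by the list `tl`. -/
def mapCode (self c : ℕ) : Code :=
  let x := Code.var 0
  .cond x.snd.fst.isPair
    (.pair (.call c (.pair x.fst x.snd.fst.fst))
      (.call self (.pair x.fst (.pair x.snd.fst.snd x.snd.snd))))
    x.snd.snd

/-- The body of a function `self` that maps `(ctx, (l, acc))` to the left fold over `l`, started
at `acc`, of the map sending `acc` and `b` to the value of function `c` at `(ctx, (b, acc))`. -/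
def foldCode (self c : ℕ) : Code :=
  let x := Code.var 0
  .cond x.snd.fst.isPair
    (.call self (.pair x.fst (.pair x.snd.fst.snd
      (.call c (.pair x.fst (.pair x.snd.fst.fst x.snd.snd))))))
    x.snd.snd

theorem CallLe.map {p : Program} {self c : ℕ} (hb : p[self]? = some (mapCode self c))
    {ctx : Data} {K : ℕ} {β : Type*} (E F : β → Data) (l : List β) (tl : List Data)
    (h : ∀ b ∈ l, CallLe p c (.pair ctx (E b)) (F b) K) :
    CallLe p self (.pair ctx (.pair (.ofList (l.map E)) (.ofList tl))) (.ofList (l.map F ++ tl))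
      ((K + 40) * (l.length + 1)) := by
  induction l with
  | nil =>
    refine .of_wp hb ?_
    simp [mapCode, wp, Data.ofList, Post]
  | cons b l ih =>
    have ih := ih fun b hb => h b (List.mem_cons_of_mem _ hb)
    refine .of_wp hb ?_
    simp only [mapCode, wp, Data.ofList, List.map_cons, List.getD_cons_zero, Data.fst_pair,
      Data.snd_pair, Data.isPair_pair, Data.toNat_num, if_neg one_ne_zero]
    refine (h b List.mem_cons_self).wp_call fun t ht => ih.wp_call fun t' ht' => ⟨rfl, ?_⟩
    simp only [List.length_cons, add_mul, mul_add] at *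
    omega

/-- The rule for `foldCode`: `Inv done acc` is an invariant for the state `acc` reached after the
elements of `done` have been processed. -/
theorem CallLe.fold {p : Program} {self c : ℕ} (hb : p[self]? = some (foldCode self c))
    {ctx : Data} {K : ℕ} {β : Type*} (E : β → Data) (Inv : List β → Data → Prop) (l : List β)
    (h : ∀ done b rest, l = done ++ b :: rest → ∀ acc, Inv done acc →
      ∃ acc', CallLe p c (.pair ctx (.pair (E b) acc)) acc' K ∧ Inv (done ++ [b]) acc')
    {acc : Data} (h0 : Inv [] acc) :
    ∃ acc', CallLe p self (.pair ctx (.pair (.ofList (l.map E)) acc)) acc'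
      ((K + 40) * (l.length + 1)) ∧ Inv l acc' := by
  suffices H : ∀ rest done acc, l = done ++ rest → Inv done acc →
      ∃ acc', CallLe p self (.pair ctx (.pair (.ofList (rest.map E)) acc)) acc'
        ((K + 40) * (rest.length + 1)) ∧ Inv l acc' from H l [] acc rfl h0
  intro rest
  induction rest with
  | nil =>
    intro done acc hl hi
    refine ⟨acc, .of_wp hb ?_, by simpa [hl] using hi⟩
    simp [foldCode, wp, Data.ofList, Post]
  | cons b rest ih =>
    intro done acc hl hi
    obtain ⟨acc', hc, hi'⟩ := h done b rest hl acc hi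
    obtain ⟨acc'', hc', hi''⟩ := ih (done ++ [b]) acc' (by simpa using hl) hi'
    refine ⟨acc'', .of_wp hb ?_, hi''⟩
    simp only [foldCode, wp, Data.ofList, List.map_cons, List.getD_cons_zero, Data.fst_pair,
      Data.snd_pair, Data.isPair_pair, Data.toNat_num, if_neg one_ne_zero]
    refine hc.wp_call fun t ht => hc'.wp_call fun t' ht' => ⟨rfl, ?_⟩
    simp only [List.length_cons, add_mul, mul_add] at *
    omega

/-! ### The program -/

/-- Pairs of expressions. -/
infixr:60 " ⋆ " => Code.pair
/-- Pairs of data. -/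
infixr:60 " ⊹ " => Data.pair

-- The positions of the functions in the program. A name that ends in `Map` or `Fold`, and also
-- `iComp`, `iFilter` and `iFind`, belongs to an instance of `mapCode` or `foldCode`. Such functions
-- take `(ctx, (l, acc))` as argument, which is why many calls below pass an additional empty list
-- `.num 0`.
abbrev iMain : ℕ := 0
abbrev iNth : ℕ := 1
abbrev iComp : ℕ := 2
abbrev iRange : ℕ := 3
abbrev iIndex : ℕ := 4
abbrev iPos : ℕ := 5
abbrev iPosMap : ℕ := 6
abbrev iInv : ℕ := 7
abbrev iCmp : ℕ := 8
abbrev iLead : ℕ := 9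
abbrev iInsert : ℕ := 10
abbrev iSift : ℕ := 11
abbrev iFilter : ℕ := 12
abbrev iMatch : ℕ := 13
abbrev iFind : ℕ := 14
abbrev iMul : ℕ := 15
abbrev iMulMap : ℕ := 16
abbrev iOrbit : ℕ := 17
abbrev iMem : ℕ := 18
abbrev iMemFold : ℕ := 19
abbrev iInd : ℕ := 20
abbrev iIndMap : ℕ := 21
abbrev iWord : ℕ := 22
abbrev iHalf : ℕ := 23
abbrev iStab : ℕ := 24
abbrev iBest : ℕ := 25
abbrev iBestFold : ℕ := 26
abbrev iPoint : ℕ := 27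
abbrev iJoin : ℕ := 28
abbrev iJoinFold : ℕ := 29
abbrev iSplit : ℕ := 30
abbrev iMini : ℕ := 31
abbrev iHit : ℕ := 32
abbrev iHitFold : ℕ := 33
abbrev iWin : ℕ := 34
abbrev iWinFold : ℕ := 35
abbrev iBlock : ℕ := 36
abbrev iBlockFold : ℕ := 37
abbrev iEmbG : ℕ := 38
abbrev iEmbGMap : ℕ := 39
abbrev iEmbD : ℕ := 40
abbrev iEmbDMap : ℕ := 41
abbrev iOut : ℕ := 42
abbrev iOutMap : ℕ := 43

/-- `(l, i)` to the entry of `l` at position `i`. -/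
def nthCode : Code :=
  let x := Code.var 0
  .cond x.snd (.call iNth (x.fst.snd ⋆ .pred x.snd)) x.fst.fst

/-- `(a, l)` to the list `a, a + 1, …` of the length of `l`. -/
def rangeCode : Code :=
  let x := Code.var 0
  .cond x.snd.isPair (x.fst ⋆ .call iRange (.succ x.fst ⋆ x.snd.snd)) (.num 0)

/-- `(l, (v, i))` to `i` plus the position of `v` in `l`. -/
def indexCode : Code :=
  let x := Code.var 0
  let next := Code.call iIndex (x.fst.snd ⋆ x.snd.fst ⋆ .succ x.snd.snd)
  .cond x.fst.isPair
    (.cond (.less x.fst.fst x.snd.fst) next (.cond (.less x.snd.fst x.fst.fst) next x.snd.snd))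
    x.snd.snd

/-- `(l, v)` to the position of `v` in `l`. -/
def posCode : Code :=
  let x := Code.var 0
  .call iIndex (x.fst ⋆ x.snd ⋆ .num 0)

/-- The inverse of a permutation. -/
def invCode : Code :=
  let x := Code.var 0
  .call iPosMap (x ⋆ .call iRange (.num 0 ⋆ x) ⋆ .num 0)

/-- `(l, l')` to `0` if `l = l'`, `1` if `l` is lexicographically smaller, `2` if it is larger. -/
def cmpCode : Code :=
  let x := Code.var 0
  .cond x.fst.isPair
    (.cond x.snd.isPair
      (.cond (.less x.fst.fst x.snd.fst) (.num 1)
        (.cond (.less x.snd.fst x.fst.fst) (.num 2) (.call iCmp (x.fst.snd ⋆ x.snd.snd))))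
      (.num 2))
    (.cond x.snd.isPair (.num 1) (.num 0))

/-- `(g, (h, 0))` to `1` if the permutations `g` and `h` have the same first moved point and the
same image of it, and to `0` otherwise. -/
def leadCode : Code :=
  let x := Code.var 0
  let a := x.fst.fst
  let b := x.snd.fst.fst
  let i := x.snd.snd
  .cond x.fst.isPair
    (.cond (.less a b) (.num 0) (.cond (.less b a) (.num 0)
      (.cond (.less a i) (.num 1) (.cond (.less i a) (.num 1)
        (.call iLead (x.fst.snd ⋆ x.snd.fst.snd ⋆ .succ i))))))
    (.num 0)

/-- `(g, h)` to the composition of `h` followed by `g`. -/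
def mulCode : Code :=
  let x := Code.var 0
  .call iComp (x.fst ⋆ x.snd ⋆ .num 0)

/-- `(g, (l, L))` inserts the permutation `g` into the table `L`, where `l` is the part of `L` that
`g` still has to be compared with. -/
def insertCode : Code :=
  let x := Code.var 0
  let g := x.fst
  let t := x.snd.fst.fst
  let full := x.snd.snd
  .cond x.snd.fst.isPair
    (.cond (.call iLead (g ⋆ t ⋆ .num 0))
      (.call iInsert (.call iMul (.call iInv t ⋆ g) ⋆ full ⋆ full))
      (.call iInsert (g ⋆ x.snd.fst.snd ⋆ full)))
    (.cond (.call iLead (g ⋆ g ⋆ .num 0)) (g ⋆ full) full)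

/-- `(ctx, (g, L))` inserts the permutation `g` into the table `L`. -/
def siftCode : Code :=
  let x := Code.var 0
  .call iInsert (x.snd.fst ⋆ x.snd.snd ⋆ x.snd.snd)

/-- `((B, w), (r, acc))` puts `r` in front of `acc` if `B ∘ r = w`. -/
def matchCode : Code :=
  let x := Code.var 0
  .cond (.call iCmp (.call iMul (x.fst.fst ⋆ x.snd.fst) ⋆ x.fst.snd)) x.snd.snd
    (x.snd.fst ⋆ x.snd.snd)

/-- `((B, gens), (todo, (R, H)))` extends the list `R` of representatives of the orbit of `B` and
the list `H` of Schreier generators of its stabilizer by means of the candidates in `todo`. -/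
def orbitCode : Code :=
  let x := Code.var 0
  let c := x.snd.fst.fst
  .cond x.snd.fst.isPair
    (.bind (.call iFind ((x.fst.fst ⋆ .call iMul (x.fst.fst ⋆ c)) ⋆ x.snd.snd.fst ⋆ .num 0))
      (let found := Code.var 0
       let x := Code.var 1
       let c := x.snd.fst.fst
       let rest := x.snd.fst.snd
       let R := x.snd.snd.fst
       let H := x.snd.snd.snd
       .cond found.isPair
        (.call iOrbit (x.fst ⋆ rest ⋆ R ⋆ .call iMul (c ⋆ .call iInv found.fst) ⋆ H))
        (.call iOrbit (x.fst ⋆ .call iMulMap (c ⋆ x.fst.snd ⋆ rest) ⋆ (c ⋆ R) ⋆ H))))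
    x.snd.snd

/-- `(v, (a, acc))` to `1` if `a = v`, and to `acc` otherwise. -/
def memCode : Code :=
  let x := Code.var 0
  .cond (.less x.fst x.snd.fst) x.snd.snd (.cond (.less x.snd.fst x.fst) x.snd.snd (.num 1))

/-- `(A, v)` to `1` if `v` is in the list `A`, and to `0` otherwise. -/
def indCode : Code :=
  let x := Code.var 0
  .call iMemFold (x.snd ⋆ x.fst ⋆ .num 0)

/-- `((W, val), (σ, A))` to the list of the numbers `val (σ⁻¹ (W (σ v)))`, for `v` in `A`. -/
def wordCode : Code :=
  let x := Code.var 0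
  .call iMul (.call iMul (x.fst.snd ⋆ .call iMul (.call iInv x.snd.fst ⋆
    .call iMul (x.fst.fst ⋆ x.snd.fst))) ⋆ x.snd.snd)

/-- `(l, l)` to the two halves of `l`. -/
def halfCode : Code :=
  let x := Code.var 0
  .cond x.snd.snd.isPair
    (.bind (.call iHalf (x.fst.snd ⋆ x.snd.snd.snd))
      (((Code.var 1).fst.fst ⋆ (Code.var 0).fst) ⋆ (Code.var 0).snd))
    (.num 0 ⋆ x.fst)

/-- `(gens, (A, g))` to representatives of the orbit of the set `A` and generators of its
stabilizer, where `g` is any list of the length of the permutations. -/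
def stabCode : Code :=
  let x := Code.var 0
  .bind (.call iRange (.num 0 ⋆ x.snd.snd))
    (let one := Code.var 0
     let x := Code.var 1
     .bind (.call iOrbit ((.call iIndMap (x.snd.fst ⋆ one ⋆ .num 0) ⋆ x.fst) ⋆
        (one ⋆ .num 0) ⋆ .num 0 ⋆ .num 0))
      ((Code.var 0).fst ⋆ .call iFilter (.num 0 ⋆ (Code.var 0).snd ⋆ .num 0)))

/-- `((G, (σ, A)), (r, acc))` to the one of `σ r` and `acc` that has the smaller word on `A`. -/
def bestCode : Code :=
  let x := Code.var 0
  .bind (.call iMul (x.fst.snd.fst ⋆ x.snd.fst))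
    (let c := Code.var 0
     let x := Code.var 1
     .cond (.pred (.call iCmp (.call iWord (x.fst.fst ⋆ x.snd.snd ⋆ x.fst.snd.snd) ⋆
        .call iWord (x.fst.fst ⋆ c ⋆ x.fst.snd.snd)))) c x.snd.snd)

/-- `iMini` for a list `A` with a single point `v`. With `q = σ⁻¹ (W (σ v))`, it runs through the
representatives `r` of the orbit of `q` for the `σ r` with the smallest word, and then computes
the stabilizer of `(σ r)⁻¹ (W (σ r v))`. -/
def pointCode : Code :=
  let x := Code.var 0
  let σ := x.snd.snd.fst
  let A := x.snd.snd.snd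
  .bind (.call iStab (x.snd.fst ⋆ .call iMul (.call iInv σ ⋆
      .call iMul (x.fst.fst ⋆ .call iMul (σ ⋆ A))) ⋆ σ))
    (let x := Code.var 1
     let σ := x.snd.snd.fst
     .bind (.call iBestFold ((x.fst ⋆ σ ⋆ x.snd.snd.snd) ⋆ (Code.var 0).fst ⋆ σ))
      (let σ := Code.var 0
       let x := Code.var 2
       let A := x.snd.snd.snd
       .snd (.call iStab (x.snd.fst ⋆ .call iMul (.call iInv σ ⋆
          .call iMul (x.fst.fst ⋆ .call iMul (σ ⋆ A))) ⋆ σ)) ⋆ σ))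

/-- `((G, (H, (σ, (A, (A₁, A₂))))), (r, acc))` solves the problem for the coset `σ r⁻¹ H` and
joins the solution with `acc`, the solution for earlier cosets. -/
def joinCode : Code :=
  let x := Code.var 0
  let G := x.fst.fst
  let H := x.fst.snd.fst
  let σ := x.fst.snd.snd.fst
  let A1 := x.fst.snd.snd.snd.snd.fst
  .bind (.call iMini (G ⋆ H ⋆ .call iMul (σ ⋆ .call iInv x.snd.fst) ⋆ A1))
    (let x := Code.var 1
     let G := x.fst.fst
     let A2 := x.fst.snd.snd.snd.snd.snd
     .bind (.call iMini (G ⋆ (Code.var 0).fst ⋆ (Code.var 0).snd ⋆ A2))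
      (let m := Code.var 0
       let x := Code.var 2
       let G := x.fst.fst
       let A := x.fst.snd.snd.snd.fst
       let acc := x.snd.snd
       .cond acc.isPair
        (.bind (.call iCmp (.call iWord (G ⋆ acc.snd ⋆ A) ⋆ .call iWord (G ⋆ m.snd ⋆ A)))
          (let m := Code.var 1
           let acc := (Code.var 3).snd.snd
           .cond (Code.var 0)
            (.cond (.pred (Code.var 0)) m acc)
            ((.call iMul (.call iInv acc.snd ⋆ m.snd) ⋆ acc.fst) ⋆ acc.snd)))
        m))

/-- `iMini` for a list `A` with at least two points. It minimizes over each coset of the stabilizer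
of the first half of `A` separately, where the two halves can be treated one after the other. -/
def splitCode : Code :=
  let x := Code.var 0
  .bind (.call iHalf (x.snd.snd.snd ⋆ x.snd.snd.snd))
    (let x := Code.var 1
     .bind (.call iStab (x.snd.fst ⋆ (Code.var 0).fst ⋆ x.snd.snd.fst))
      (let orb := Code.var 0
       let halves := Code.var 1
       let x := Code.var 2
       .bind (.call iJoinFold ((x.fst ⋆ orb.snd ⋆ x.snd.snd.fst ⋆ x.snd.snd.snd ⋆ halves) ⋆
          orb.fst ⋆ .num 0))
        (.call iFilter (.num 0 ⋆ (Code.var 0).fst ⋆ .num 0) ⋆ (Code.var 0).snd)))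

/-- `(G, (gens, (σ, A)))` to generators `gens'` and a representative `σ'` of the set of those
elements of the coset `σ ⟨gens⟩` whose word on `A` is lexicographically smallest. -/
def miniCode : Code :=
  let x := Code.var 0
  .cond x.snd.snd.snd.snd.isPair (.call iSplit x) (.call iPoint x)

/-- `((u, v), (r, acc))` to `1` if `r` maps `u` to `v`, and to `acc` otherwise. -/
def hitCode : Code :=
  let x := Code.var 0
  .call iMem (x.fst.snd ⋆ .call iNth (x.snd.fst ⋆ x.fst.fst) ⋆ x.snd.snd)

/-- `((R, v), (u, acc))` puts `u` in front of `acc` if some element of `R` maps `u` to `v`. -/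
def winCode : Code :=
  let x := Code.var 0
  .cond (.call iHitFold ((x.snd.fst ⋆ x.fst.snd) ⋆ x.fst.fst ⋆ .num 0)) (x.snd.fst ⋆ x.snd.snd)
    x.snd.snd

/-- `((G, (gens, points)), (v, acc))` minimizes the word on the orbit of `v`. -/
def blockCode : Code :=
  let x := Code.var 0
  .call iMini (x.fst.fst ⋆ x.snd.snd.fst ⋆ x.snd.snd.snd ⋆
    .call iWinFold ((.fst (.call iStab (x.fst.snd.fst ⋆ (x.snd.fst ⋆ .num 0) ⋆ x.snd.snd.snd)) ⋆
      x.snd.fst) ⋆ x.fst.snd.snd ⋆ .num 0))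

/-- `((one, shift), g)` to the permutation acting as the identity on the first copy and as `g` on
the second. -/
def embGCode : Code :=
  let x := Code.var 0
  .call iComp (x.fst.fst ⋆ x.fst.fst ⋆ .call iMul (x.fst.snd ⋆ x.snd))

/-- `((one, shift), g)` to the permutation acting as `g` on both copies. -/
def embDCode : Code :=
  let x := Code.var 0
  .call iComp (x.snd ⋆ x.fst.fst ⋆ .call iMul (x.fst.snd ⋆ x.snd))

/-- `((σ, one), h)` to the restriction of `σ h σ⁻¹` to the first copy. -/
def outCode : Code :=
  let x := Code.var 0
  .call iMul (.call iMul (x.fst.fst ⋆ .call iMul (x.snd ⋆ .call iInv x.fst.fst)) ⋆ x.fst.snd)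

/-- The input `(n, (S, (f, (T, (ρ, 0)))))` to generators of the group and a representative of the
canonical labeling coset. The local definitions are the identity of `V`, the inclusion of the second
copy of `V`, the values of the points, reduced generators of the group on the two copies, and the
coset of the minimizers. -/
def mainCode : Code :=
  let x := Code.var 0
  let ρ := x.snd.snd.snd.snd.fst
  .bind (.call iRange (.num 0 ⋆ ρ))
  (.bind (let x := Code.var 1
          .call iRange (x.fst ⋆ x.snd.snd.snd.snd.fst))
  (.bind (let x := Code.var 2
          .call iComp (.call iRange (x.fst ⋆ .num 0 ⋆ x.snd.snd.snd.snd.fst) ⋆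
            x.snd.snd.snd.snd.fst ⋆ x.snd.snd.snd.snd.fst))
  (.bind (let one := Code.var 2
          let shift := Code.var 1
          let x := Code.var 3
          .call iFilter (.num 0 ⋆ .call iEmbGMap ((one ⋆ shift) ⋆ x.snd.fst ⋆
            .call iEmbDMap ((one ⋆ shift) ⋆ x.snd.snd.snd.fst ⋆ .num 0)) ⋆ .num 0))
  (.bind (let gens := Code.var 0
          let val := Code.var 1
          let shift := Code.var 2
          let x := Code.var 4
          let ρ := x.snd.snd.snd.snd.fst
          let points := Code.call iPosMap (ρ ⋆ .call iRange (.num 1 ⋆ ρ) ⋆ .num 0)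
          let W := Code.call iComp (shift ⋆ .call iInv x.snd.snd.fst ⋆ shift)
          .call iBlockFold (((W ⋆ val) ⋆ gens ⋆ points) ⋆ points ⋆
            (gens ⋆ .call iRange (.num 0 ⋆ val))))
  (let res := Code.var 0
   let one := Code.var 4
   let ρ := (Code.var 5).snd.snd.snd.snd.fst
   .call iOutMap ((res.snd ⋆ one) ⋆ res.fst ⋆ .num 0) ⋆
    .call iMul (ρ ⋆ .call iMul (.call iInv res.snd ⋆ one)))))))

/-- The program; function `iMain` solves the problem. -/
def prog : Program :=
  [mainCode, nthCode, mapCode iComp iNth, rangeCode, indexCode, posCode, mapCode iPosMap iPos,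
    invCode, cmpCode, leadCode, insertCode, siftCode, foldCode iFilter iSift, matchCode,
    foldCode iFind iMatch, mulCode, mapCode iMulMap iMul, orbitCode, memCode,
    foldCode iMemFold iMem, indCode, mapCode iIndMap iInd, wordCode, halfCode, stabCode, bestCode,
    foldCode iBestFold iBest, pointCode, joinCode, foldCode iJoinFold iJoin, splitCode, miniCode,
    hitCode, foldCode iHitFold iHit, winCode, foldCode iWinFold iWin, blockCode,
    foldCode iBlockFold iBlock, embGCode, mapCode iEmbGMap iEmbG, embDCode,
    mapCode iEmbDMap iEmbD, outCode, mapCode iOutMap iOut]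

/-! ### Lists of numbers on the machine -/

/-- The code of a list of numbers. -/
def encN (l : List ℕ) : Data := .ofList (l.map .num)

theorem le_pow_succ {M : ℕ} (hM : 1000 ≤ M) (c : ℕ) : 1000 * M ^ c ≤ M ^ (c + 1) := by
  rw [pow_succ, mul_comm]
  exact Nat.mul_le_mul_left _ hM

/-- The growth of the powers of `M`, in a form that `omega` can use. All running times are bounded
by powers of a number `M ≥ 1000`; passing to the next power absorbs constants and finitely many
terms of lower order. -/
theorem pow_facts {M : ℕ} (hM : 1000 ≤ M) : M = M ^ 1 ∧
    1000 * M ^ 1 ≤ M ^ 2 ∧ 1000 * M ^ 2 ≤ M ^ 3 ∧ 1000 * M ^ 3 ≤ M ^ 4 ∧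
    1000 * M ^ 4 ≤ M ^ 5 ∧ 1000 * M ^ 5 ≤ M ^ 6 ∧ 1000 * M ^ 6 ≤ M ^ 7 ∧
    1000 * M ^ 7 ≤ M ^ 8 ∧ 1000 * M ^ 8 ≤ M ^ 9 ∧ 1000 * M ^ 9 ≤ M ^ 10 ∧
    1000 * M ^ 10 ≤ M ^ 11 ∧ 1000 * M ^ 11 ≤ M ^ 12 ∧ 1000 * M ^ 12 ≤ M ^ 13 ∧
    1000 * M ^ 13 ≤ M ^ 14 ∧ 1000 * M ^ 14 ≤ M ^ 15 ∧ 1000 * M ^ 15 ≤ M ^ 16 ∧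
    1000 * M ^ 16 ≤ M ^ 17 ∧ 1000 * M ^ 17 ≤ M ^ 18 ∧ 1000 * M ^ 18 ≤ M ^ 19 ∧
    1000 * M ^ 19 ≤ M ^ 20 ∧ 1000 * M ^ 20 ≤ M ^ 21 ∧ 1000 * M ^ 21 ≤ M ^ 22 ∧
    1000 * M ^ 22 ≤ M ^ 23 ∧ 1000 * M ^ 23 ≤ M ^ 24 ∧ 1000 * M ^ 24 ≤ M ^ 25 ∧
    1000 * M ^ 25 ≤ M ^ 26 ∧ 1000 * M ^ 26 ≤ M ^ 27 ∧ 1000 * M ^ 27 ≤ M ^ 28 ∧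
    1000 * M ^ 28 ≤ M ^ 29 ∧ 1000 * M ^ 29 ≤ M ^ 30 ∧ 1000 * M ^ 30 ≤ M ^ 31 ∧
    1000 * M ^ 31 ≤ M ^ 32 ∧ 1000 * M ^ 32 ≤ M ^ 33 ∧ 1000 * M ^ 33 ≤ M ^ 34 ∧
    1000 * M ^ 34 ≤ M ^ 35 ∧ 1000 * M ^ 35 ≤ M ^ 36 := by
  refine ⟨(pow_one M).symm, ?_⟩
  refine ⟨?_, ?_, ?_, ?_, ?_, ?_, ?_, ?_, ?_, ?_, ?_, ?_, ?_, ?_, ?_, ?_, ?_, ?_, ?_, ?_, ?_, ?_,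
    ?_, ?_, ?_, ?_, ?_, ?_, ?_, ?_, ?_, ?_, ?_, ?_, ?_⟩ <;> exact le_pow_succ hM _

/-- The time of a loop over a list of length `len`, with at most `K` steps for each entry, in the
form given by `CallLe.map` and `CallLe.fold`. -/
theorem loop_le {M : ℕ} (hM : 1000 ≤ M) {a b K len : ℕ} (hK : K ≤ M ^ (a + 1))
    (hl : len ≤ M ^ (b + 1)) : (K + 40) * (len + 1) ≤ M ^ (a + b + 3) := by
  have h1 : 1 ≤ M ^ a := Nat.one_le_pow _ _ (by omega)
  have h2 : 1 ≤ M ^ b := Nat.one_le_pow _ _ (by omega)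
  have h3 := le_pow_succ hM a
  have h4 := le_pow_succ hM b
  calc (K + 40) * (len + 1) ≤ (2 * M ^ (a + 1)) * (2 * M ^ (b + 1)) :=
        Nat.mul_le_mul (by omega) (by omega)
    _ = 4 * M ^ (a + b + 2) := by ring
    _ ≤ M ^ (a + b + 3) := (Nat.mul_le_mul_right _ (by norm_num)).trans (le_pow_succ hM _)

section
variable {M : ℕ} (hM : 1000 ≤ M)

theorem call_nth_data (l : List Data) (i : ℕ) :
    CallLe prog iNth (.ofList l ⊹ .num i) (l.getD i (.num 0)) (20 * (i + 1)) := by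
  induction i generalizing l with
  | zero =>
    refine .of_wp (body := nthCode) rfl ?_
    cases l <;> simp [nthCode, wp, Data.ofList, Post]
  | succ i ih =>
    refine .of_wp (body := nthCode) rfl ?_
    cases l with
    | nil =>
      simp [nthCode, wp, Data.ofList]
      exact (ih []).wp_call fun t ht => ⟨rfl, by omega⟩
    | cons a l =>
      simp [nthCode, wp, Data.ofList]
      exact (ih l).wp_call fun t ht => ⟨by simp, by omega⟩

include hM

theorem call_nth (l : List ℕ) {i : ℕ} (hi : i ≤ M) :
    CallLe prog iNth (encN l ⊹ .num i) (.num (l.getD i 0)) (M ^ 2) := by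
  have h := call_nth_data (l.map .num) i
  rw [List.getD_map] at h
  refine h.mono ?_
  nlinarith

theorem call_comp (l idx tl : List ℕ) (hi : ∀ i ∈ idx, i ≤ M) (hl : idx.length ≤ M) :
    CallLe prog iComp (encN l ⊹ encN idx ⊹ encN tl) (encN (idx.map (l.getD · 0) ++ tl))
      (M ^ 4) := by
  have h := CallLe.map (p := prog) (self := iComp) (c := iNth) (ctx := encN l) rfl .num
    (fun i => .num (l.getD i 0)) idx (tl.map .num) fun b hb => call_nth hM l (hi b hb)
  simp only [encN, List.map_append, List.map_map] at h ⊢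
  exact h.mono (loop_le hM (a := 1) (b := 0) le_rfl (by simpa using hl))

theorem call_mul_list (l idx : List ℕ) (hi : ∀ i ∈ idx, i ≤ M) (hl : idx.length ≤ M) :
    CallLe prog iMul (encN l ⊹ encN idx) (encN (idx.map (l.getD · 0))) (M ^ 5) := by
  refine .of_wp (body := mulCode) rfl ?_
  simp [mulCode, wp]
  refine (call_comp hM l idx [] hi hl).wp_call fun t ht => ⟨by simp, ?_⟩
  have := pow_facts hM
  omega

theorem call_range {α : Type*} (E : α → Data) (l : List α) (hl : l.length ≤ M) (a : ℕ) :
    CallLe prog iRange (.num a ⊹ .ofList (l.map E)) (encN (List.range' a l.length)) (M ^ 2) := by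
  have h : CallLe prog iRange (.num a ⊹ .ofList (l.map E)) (encN (List.range' a l.length))
      (20 * (l.length + 1)) := by
    clear hl
    induction l generalizing a with
    | nil =>
      refine .of_wp (body := rangeCode) rfl ?_
      simp [rangeCode, wp, Data.ofList, Post, encN]
    | cons b l ih =>
      refine .of_wp (body := rangeCode) rfl ?_
      simp [rangeCode, wp, Data.ofList]
      exact (ih (a + 1)).wp_call fun t ht => ⟨rfl, by omega⟩
  exact h.mono (by nlinarith)

theorem call_pos (l : List ℕ) (v : ℕ) (hl : l.length ≤ M) :
    CallLe prog iPos (encN l ⊹ .num v) (.num (l.idxOf v)) (M ^ 3) := by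
  have h : ∀ (l : List ℕ) (i : ℕ), CallLe prog iIndex (encN l ⊹ .num v ⊹ .num i)
      (.num (i + l.idxOf v)) (50 * (l.length + 1)) := by
    intro l
    induction l with
    | nil =>
      intro i
      refine .of_wp (body := indexCode) rfl ?_
      simp [indexCode, wp, Data.ofList, Post, encN]
    | cons b l ih =>
      intro i
      refine .of_wp (body := indexCode) rfl ?_
      rcases lt_trichotomy b v with hb | rfl | hb
      · simp [indexCode, wp, Data.ofList, encN, hb, List.idxOf_cons_ne _ hb.ne]
        exact (ih (i + 1)).wp_call fun t ht => ⟨by congr 1; omega, by omega⟩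
      · simp [indexCode, wp, Data.ofList, encN, Post]
        omega
      · simp [indexCode, wp, Data.ofList, encN, hb, hb.not_gt, List.idxOf_cons_ne _ hb.ne']
        exact (ih (i + 1)).wp_call fun t ht => ⟨by congr 1; omega, by omega⟩
  refine .of_wp (body := posCode) rfl ?_
  simp [posCode, wp]
  refine (h l 0).wp_call fun t ht => ⟨by simp, ?_⟩
  have := le_pow_succ hM 2
  nlinarith

theorem call_posMap (l idx : List ℕ) (hl : l.length ≤ M) (hi : idx.length ≤ M) :
    CallLe prog iPosMap (encN l ⊹ encN idx ⊹ .num 0) (encN (idx.map (l.idxOf ·)))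
      (M ^ 5) := by
  have h := CallLe.map (p := prog) (self := iPosMap) (c := iPos) (ctx := encN l) rfl .num
    (fun i => .num (l.idxOf i)) idx [] fun b hb => call_pos hM l b hl
  simp only [encN, List.map_map, List.append_nil] at h ⊢
  exact h.mono (loop_le hM (a := 2) (b := 0) le_rfl (by simpa using hi))

theorem call_inv_list (l : List ℕ) (hl : l.length ≤ M) :
    CallLe prog iInv (encN l) (encN ((List.range l.length).map (l.idxOf ·))) (M ^ 6) := by
  refine .of_wp (body := invCode) rfl ?_
  simp [invCode, wp]
  refine (call_range hM .num l hl 0).wp_call fun t ht => ?_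
  refine (call_posMap hM l _ hl (by simpa using hl)).wp_call fun t' ht' =>
    ⟨by simp [List.range_eq_range'], ?_⟩
  have := pow_facts hM
  omega

/-- The outcome of a lexicographic comparison, as a number: `0` for `=`, `1` for `<`, `2` for `>`.
-/
def cmpVal (l l' : List ℕ) : ℕ := if l = l' then 0 else if l < l' then 1 else 2

theorem call_cmp (l l' : List ℕ) (hl : l.length ≤ M) :
    CallLe prog iCmp (encN l ⊹ encN l') (.num (cmpVal l l')) (M ^ 2) := by
  have h : CallLe prog iCmp (encN l ⊹ encN l') (.num (cmpVal l l')) (50 * (l.length + 1)) := by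
    clear hl
    induction l generalizing l' with
    | nil =>
      refine .of_wp (body := cmpCode) rfl ?_
      cases l' <;> simp [cmpCode, wp, Data.ofList, Post, encN, cmpVal]
    | cons b l ih =>
      refine .of_wp (body := cmpCode) rfl ?_
      cases l' with
      | nil => simp [cmpCode, wp, Data.ofList, Post, encN, cmpVal]; omega
      | cons b' l' =>
      rcases lt_trichotomy b b' with hb | rfl | hb
      · simp [cmpCode, wp, Data.ofList, encN, hb, hb.ne, Post, cmpVal, List.cons_lt_cons_iff]
        omega
      · simp [cmpCode, wp, Data.ofList, encN]
        exact (ih l').wp_call fun t ht => ⟨by simp [cmpVal], by omega⟩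
      · simp [cmpCode, wp, Data.ofList, encN, hb, hb.ne', hb.not_gt, Post, cmpVal,
          List.cons_lt_cons_iff]
        omega
  exact h.mono (by nlinarith)

end

/-! ### Permutations on the machine -/

/-- The code of a function on `Fin N`. -/
def encF {N : ℕ} (l : Fin N → ℕ) : Data := encN (List.ofFn l)

/-- The code of a map between two sets `Fin m` and `Fin N`. -/
def encP {m N : ℕ} (g : Fin m → Fin N) : Data := encF fun i => (g i : ℕ)

/-- The code of a list of elements of `Fin N`. -/
def encA {N : ℕ} (A : List (Fin N)) : Data := encN (A.map Fin.val)

/-- The code of a list of permutations of `Fin N`. -/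
def encL {N : ℕ} (L : List (Perm (Fin N))) : Data :=
  .ofList (L.map fun g : Perm (Fin N) => encP g)

theorem encL_cons {N : ℕ} (g : Perm (Fin N)) (L : List (Perm (Fin N))) :
    encP g ⊹ encL L = encL (g :: L) := rfl

theorem encA_cons {N : ℕ} (g : Fin N) (L : List (Fin N)) :
    .num g ⊹ encA L = encA (g :: L) := rfl

/-- `g` and `h` have the same first moved point, and the same image of it. -/
def SameLead {N : ℕ} (g h : Perm (Fin N)) : Prop :=
  ∃ i, g i ≠ i ∧ g i = h i ∧ ∀ j < i, g j = j ∧ h j = j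

theorem SameLead.symm {N : ℕ} {g h : Perm (Fin N)} : SameLead g h → SameLead h g :=
  fun ⟨i, hi, he, hj⟩ => ⟨i, he ▸ hi, he.symm, fun j h => (hj j h).symm⟩

theorem exists_first_moved {N : ℕ} {g : Perm (Fin N)} (hg : g ≠ 1) :
    ∃ i, g i ≠ i ∧ ∀ j < i, g j = j := by
  have hne : {i | g i ≠ i}.Nonempty := by
    by_contra h
    rw [Set.not_nonempty_iff_eq_empty, Set.eq_empty_iff_forall_notMem] at h
    exact hg (Equiv.ext fun i => by simpa using h i)
  obtain ⟨i, hi, hmin⟩ := WellFounded.has_min (r := (· < ·)) wellFounded_lt _ hne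
  exact ⟨i, hi, fun j hj => by_contra fun h => hmin j h hj⟩

theorem sameLead_self {N : ℕ} {g : Perm (Fin N)} : SameLead g g ↔ g ≠ 1 := by
  constructor
  · rintro ⟨i, hi, -⟩ rfl
    exact hi rfl
  · intro h
    obtain ⟨i, hi, hj⟩ := exists_first_moved h
    exact ⟨i, hi, rfl, fun j hj' => ⟨hj j hj', hj j hj'⟩⟩

theorem map_getD_ofFn {m N : ℕ} (l : Fin N → ℕ) (g : Fin m → Fin N) :
    (List.ofFn fun i => (g i : ℕ)).map ((List.ofFn l).getD · 0) = List.ofFn (l ∘ g) := by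
  rw [List.map_ofFn]
  congr 1
  ext i
  simp

section
variable {M : ℕ} (hM : 1000 ≤ M) {N : ℕ}

/-- `SameLead` for the lists of the values of two permutations, after removal of the first `i`
values, which are fixed points. -/
def LeadFrom (l l' : List ℕ) (i : ℕ) : Prop :=
  ∃ j a, l[j]? = some a ∧ l'[j]? = some a ∧ a ≠ i + j ∧
    ∀ k < j, l[k]? = some (i + k) ∧ l'[k]? = some (i + k)

theorem leadFrom_cons {a b i : ℕ} {l l' : List ℕ} :
    LeadFrom (a :: l) (b :: l') i ↔ a = b ∧ (a ≠ i ∨ a = i ∧ LeadFrom l l' (i + 1)) := by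
  constructor
  · rintro ⟨j, c, h1, h2, h3, h4⟩
    cases j with
    | zero => simp at h1 h2 h3; exact ⟨h1.trans h2.symm, .inl (h1 ▸ h3)⟩
    | succ j =>
      have := h4 0 (Nat.succ_pos j)
      simp at this h1 h2
      refine ⟨this.1.trans this.2.symm, .inr ⟨this.1, j, c, h1, h2, by omega, fun k hk => ?_⟩⟩
      have := h4 (k + 1) (by omega)
      simp at this
      rw [this.1, this.2]; simp; omega
  · rintro ⟨rfl, h | ⟨rfl, j, c, h1, h2, h3, h4⟩⟩
    · exact ⟨0, a, rfl, rfl, h, by simp⟩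
    · refine ⟨j + 1, c, by simpa, by simpa, by omega, fun k hk => ?_⟩
      cases k with
      | zero => simp
      | succ k =>
        have := h4 k (by omega)
        simp
        rw [this.1, this.2]; simp; omega

theorem leadFrom_zero_iff (g h : Perm (Fin N)) :
    LeadFrom (List.ofFn fun i => (g i : ℕ)) (List.ofFn fun i => (h i : ℕ)) 0 ↔ SameLead g h := by
  constructor
  · rintro ⟨j, a, h1, h2, h3, h4⟩
    simp only [List.getElem?_ofFn, Option.dite_none_right_eq_some, Option.some.injEq] at h1 h2 h4
    obtain ⟨hj, h1⟩ := h1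
    obtain ⟨_, h2⟩ := h2
    refine ⟨⟨j, hj⟩, ?_, ?_, fun k hk => ?_⟩
    · intro h0
      have h0 : (g ⟨j, hj⟩ : ℕ) = j := congrArg Fin.val h0
      omega
    · rw [Fin.ext_iff]; omega
    · obtain ⟨⟨_, h5⟩, ⟨_, h6⟩⟩ := h4 k hk
      constructor
      · rw [Fin.ext_iff]; simpa using h5
      · rw [Fin.ext_iff]; simpa using h6
  · rintro ⟨i, h1, h2, h3⟩
    refine ⟨i, g i, by simp, by simp [h2], ?_, fun k hk => ?_⟩
    · rw [Ne, Fin.ext_iff] at h1; simpa using h1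
    · have := h3 ⟨k, by omega⟩ hk
      simp [this.1, this.2]
      omega

open Classical in
theorem call_lead_list (l l' : List ℕ) (hl : l.length = l'.length) (i : ℕ) :
    CallLe prog iLead (encN l ⊹ encN l' ⊹ .num i) (.num (if LeadFrom l l' i then 1 else 0))
      (100 * (l.length + 1)) := by
  induction l generalizing l' i with
  | nil =>
    refine .of_wp (body := leadCode) rfl ?_
    simp [leadCode, wp, Data.ofList, Post, encN, LeadFrom]
  | cons a l ih =>
    cases l' with
    | nil => simp at hl
    | cons b l' =>
    refine .of_wp (body := leadCode) rfl ?_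
    rw [leadFrom_cons]
    rcases lt_trichotomy a b with h | rfl | h
    · simp [leadCode, wp, Data.ofList, encN, h, h.ne, Post]
      omega
    · rcases lt_trichotomy a i with h | rfl | h
      · simp [leadCode, wp, Data.ofList, encN, h, h.ne, Post]
        omega
      · simp [leadCode, wp, Data.ofList, encN]
        exact (ih l' (by simpa using hl) (a + 1)).wp_call fun t ht => ⟨rfl, by omega⟩
      · simp [leadCode, wp, Data.ofList, encN, h, h.ne', h.not_gt, Post]
        omega
    · simp [leadCode, wp, Data.ofList, encN, h, h.ne', h.not_gt, Post]
      omega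

variable (hN : N ≤ M)
include hM hN

open Classical in
theorem call_lead (g h : Perm (Fin N)) :
    CallLe prog iLead (encP g ⊹ encP h ⊹ .num 0) (.num (if SameLead g h then 1 else 0))
      (M ^ 2) := by
  have := call_lead_list (List.ofFn fun i => (g i : ℕ)) (List.ofFn fun i => (h i : ℕ))
    (by simp) 0
  simp only [leadFrom_zero_iff] at this
  exact this.mono (by simp; nlinarith)

theorem call_mulF {m : ℕ} (hm : m ≤ M) (l : Fin N → ℕ) (g : Fin m → Fin N) :
    CallLe prog iMul (encF l ⊹ encP g) (encF (l ∘ g)) (M ^ 5) := by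
  have := call_mul_list hM (List.ofFn l) (List.ofFn fun i => (g i : ℕ))
    (by simp [List.mem_ofFn]; intro i; omega) (by simpa)
  rwa [map_getD_ofFn] at this

theorem call_mul (g h : Perm (Fin N)) :
    CallLe prog iMul (encP g ⊹ encP h) (encP (g * h : Perm (Fin N))) (M ^ 5) :=
  call_mulF hM hN hN _ h

theorem call_mulA (l : Fin N → ℕ) {A : List (Fin N)} (hA : A.length ≤ M) :
    CallLe prog iMul (encF l ⊹ encA A) (encN (A.map l)) (M ^ 5) := by
  have := call_mul_list hM (List.ofFn l) (A.map Fin.val)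
    (by simp; intro i hi; omega) (by simpa)
  have e : (A.map Fin.val).map ((List.ofFn l).getD · 0) = A.map l := by
    rw [List.map_map]
    congr 1
    ext i
    simp
  rwa [e] at this

theorem call_mulPA (l : Fin N → Fin N) {A : List (Fin N)} (hA : A.length ≤ M) :
    CallLe prog iMul (encP l ⊹ encA A) (encA (A.map l)) (M ^ 5) := by
  simpa [encA, encP, Function.comp_def] using call_mulA hM hN (fun i => (l i : ℕ)) hA

theorem call_inv (g : Perm (Fin N)) :
    CallLe prog iInv (encP g) (encP (g⁻¹ : Perm (Fin N))) (M ^ 6) := by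
  have := call_inv_list hM (List.ofFn fun i => (g i : ℕ)) (by simpa)
  have e : (List.range (List.ofFn fun i => (g i : ℕ)).length).map
      ((List.ofFn fun i => (g i : ℕ)).idxOf ·) =
        List.ofFn fun i => ((g⁻¹ : Perm (Fin N)) i : ℕ) := by
    apply List.ext_getElem (by simp)
    intro i h1 h2
    simp at h1 h2 ⊢
    have hnd : (List.ofFn fun i => (g i : ℕ)).Nodup :=
      List.nodup_ofFn.2 fun a b hab => g.injective (Fin.ext hab)
    have := hnd.idxOf_getElem ((g⁻¹ : Perm (Fin N)) ⟨i, h2⟩) (by simp)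
    simpa using this
  rwa [e] at this

end

/-! ### Reduction of generating sets -/

theorem mem_gen {V : Type u} {S : List (Perm V)} {g : Perm V} (h : g ∈ S) : g ∈ gen S :=
  Subgroup.subset_closure h

theorem gen_le {V : Type u} {S : List (Perm V)} {H : Subgroup (Perm V)} :
    gen S ≤ H ↔ ∀ g ∈ S, g ∈ H :=
  Subgroup.closure_le H

theorem gen_mono {V : Type u} {S S' : List (Perm V)} (h : S ⊆ S') : gen S ≤ gen S' :=
  gen_le.2 fun _ hg => mem_gen (h hg)

theorem gen_cons_le {V : Type u} {S : List (Perm V)} {g : Perm V} {H : Subgroup (Perm V)} :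
    gen (g :: S) ≤ H ↔ g ∈ H ∧ gen S ≤ H := by
  simp [gen_le]

/-- The number of points at or beyond the first point moved by `g`. -/
def unfixed {N : ℕ} (g : Perm (Fin N)) : ℕ :=
  (Finset.univ.filter fun i => ∃ j ≤ i, g j ≠ j).card

theorem unfixed_le {N : ℕ} (g : Perm (Fin N)) : unfixed g ≤ N :=
  (Finset.card_le_univ _).trans (by simp)

/-- Division by an entry with the same lead moves the first moved point up. -/
theorem unfixed_lt {N : ℕ} {g t : Perm (Fin N)} (h : SameLead g t) :
    unfixed (t⁻¹ * g) < unfixed g := by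
  obtain ⟨i, hi, he, hj⟩ := h
  have key : ∀ j ≤ i, (t⁻¹ * g) j = j := by
    intro j hji
    rw [Perm.mul_apply, Perm.inv_eq_iff_eq]
    rcases hji.lt_or_eq with h | rfl
    · rw [(hj j h).1, (hj j h).2]
    · exact he
  refine Finset.card_lt_card ⟨fun k hk => ?_, fun hsub => ?_⟩
  · simp only [Finset.mem_filter, Finset.mem_univ, true_and] at hk ⊢
    obtain ⟨j, hjk, hne⟩ := hk
    refine ⟨i, le_of_lt (lt_of_lt_of_le ?_ hjk), hi⟩
    by_contra hle
    exact hne (key j (not_lt.1 hle))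
  · have hmem : i ∈ Finset.univ.filter fun i => ∃ j ≤ i, g j ≠ j := by
      simpa using ⟨i, le_rfl, hi⟩
    have := hsub hmem
    simp only [Finset.mem_filter, Finset.mem_univ, true_and] at this
    obtain ⟨j, hji, hne⟩ := this
    exact hne (key j hji)

/-- A reduced list of permutations: there is no identity in it, and no two entries agree on
their first moved points. -/
def Reduced {N : ℕ} (L : List (Perm (Fin N))) : Prop :=
  L.Pairwise (fun g h => ¬ SameLead g h) ∧ ∀ t ∈ L, t ≠ 1

open Classical in
/-- The entries are determined by their first moved points and the images of these. -/
theorem Reduced.length_le {N : ℕ} {L : List (Perm (Fin N))} (h : Reduced L) :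
    L.length ≤ N * N + 1 := by
  let key : Perm (Fin N) → Option (Fin N × Fin N) := fun g =>
    if hg : g ≠ 1 then
      some ((exists_first_moved hg).choose, g (exists_first_moved hg).choose) else none
  have hnd : (L.map key).Nodup := by
    rw [List.nodup_iff_pairwise_ne, List.pairwise_map]
    refine h.1.imp_of_mem fun {a b} ha hb hab he => hab ?_
    have ha := h.2 a ha
    have hb := h.2 b hb
    simp only [key, dif_pos ha, dif_pos hb, Option.some.injEq, Prod.mk.injEq] at he
    have hsa := (exists_first_moved ha).choose_spec
    have hsb := (exists_first_moved hb).choose_spec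
    exact ⟨_, hsa.1, by rw [he.2, he.1], fun j hj => ⟨hsa.2 j hj, hsb.2 j (he.1 ▸ hj)⟩⟩
  simpa using hnd.length_le_card

section
variable {M : ℕ} (hM : 1000 ≤ M) {N : ℕ} (hN : N ≤ M)
include hM hN

/-- Insertion either advances in the table or replaces `g` by `t⁻¹ g`, which decreases `unfixed g`,
and starts again. Hence the lexicographically ordered pair of `unfixed g` and the length of the rest
of the table decreases; `n` bounds a number that encodes this pair. -/
theorem call_insert (n : ℕ) (g : Perm (Fin N)) (l₀ l full : List (Perm (Fin N)))
    (hf : Reduced full) (hl : full = l₀ ++ l) (hl₀ : ∀ t ∈ l₀, ¬ SameLead t g)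
    (hn : unfixed g * (full.length + 1) + l.length ≤ n) :
    ∃ L, CallLe prog iInsert (encP g ⊹ encL l ⊹ encL full) (encL L) (M ^ 7 * (n + 1)) ∧
      Reduced L ∧ gen L = gen (g :: full) := by
  have hpow := pow_facts hM
  induction n generalizing g l₀ l with
  | zero =>
    have hl' : l = [] := List.length_eq_zero_iff.1 (by omega)
    have hg : g = 1 := by
      by_contra h
      have := unfixed_lt (sameLead_self.2 h)
      have := Nat.mul_le_mul_right (full.length + 1) (show 1 ≤ unfixed g by omega)
      omega
    subst hl'
    refine ⟨full, .of_wp (body := insertCode) rfl ?_, hf, le_antisymm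
      (gen_mono (List.subset_cons_self _ _)) (gen_cons_le.2 ⟨hg ▸ one_mem _, le_rfl⟩)⟩
    simp [insertCode, wp, encL, Data.ofList]
    refine (call_lead hM hN g g).wp_call fun t ht => ?_
    simp [sameLead_self, hg, Post]
    omega
  | succ n ih =>
  cases l with
  | nil =>
    by_cases hg : g = 1
    · refine ⟨full, .of_wp (body := insertCode) rfl ?_, hf, le_antisymm
        (gen_mono (List.subset_cons_self _ _)) (gen_cons_le.2 ⟨hg ▸ one_mem _, le_rfl⟩)⟩
      simp [insertCode, wp, encL, Data.ofList]
      refine (call_lead hM hN g g).wp_call fun t ht => ?_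
      simp [sameLead_self, hg, Post, mul_add]
      omega
    · refine ⟨g :: full, .of_wp (body := insertCode) rfl ?_, ⟨?_, ?_⟩, rfl⟩
      · simp [insertCode, wp, encL, Data.ofList]
        refine (call_lead hM hN g g).wp_call fun t ht => ?_
        simp [sameLead_self, hg, Post, mul_add]
        omega
      · simp only [List.append_nil] at hl
        exact List.pairwise_cons.2 ⟨fun t ht h => hl₀ t (hl ▸ ht) h.symm, hf.1⟩
      · simpa [hg] using hf.2
  | cons t l =>
    by_cases ht : SameLead g t
    · have hlt := unfixed_lt ht
      have hle := Nat.mul_le_mul_right (full.length + 1) (Nat.succ_le_of_lt hlt)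
      obtain ⟨L, hc, hL, hgen⟩ := ih (t⁻¹ * g) [] full rfl (by simp) (by
        rw [Nat.succ_mul] at hle
        simp at hn
        omega)
      refine ⟨L, .of_wp (body := insertCode) rfl ?_, hL, hgen.trans (le_antisymm ?_ ?_)⟩
      · simp [insertCode, wp, encL, Data.ofList]
        refine (call_lead hM hN g t).wp_call fun t1 ht1 => ?_
        simp [ht]
        refine (call_inv hM hN t).wp_call fun t2 ht2 => ?_
        refine (call_mul hM hN _ _).wp_call fun t3 ht3 => ?_
        refine hc.wp_call fun t4 ht4 => ⟨rfl, ?_⟩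
        rw [mul_add]
        omega
      · have htf : t ∈ gen (g :: full) := mem_gen (by simp [hl])
        exact gen_cons_le.2 ⟨mul_mem (inv_mem htf) (mem_gen List.mem_cons_self),
          gen_mono (List.subset_cons_self _ _)⟩
      · have htf : t ∈ gen (t⁻¹ * g :: full) := mem_gen (by simp [hl])
        have := mul_mem htf (mem_gen (S := t⁻¹ * g :: full) List.mem_cons_self)
        rw [mul_inv_cancel_left] at this
        exact gen_cons_le.2 ⟨this, gen_mono (List.subset_cons_self _ _)⟩
    · obtain ⟨L, hc, hL⟩ := ih g (l₀ ++ [t]) l (by simpa using hl) (by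
        intro s hs
        rw [List.mem_append, List.mem_singleton] at hs
        rcases hs with hs | rfl
        · exact hl₀ s hs
        · exact fun h => ht h.symm) (by simp at hn; omega)
      refine ⟨L, .of_wp (body := insertCode) rfl ?_, hL⟩
      simp [insertCode, wp, encL, Data.ofList]
      refine (call_lead hM hN g t).wp_call fun t1 ht1 => ?_
      simp [ht]
      refine hc.wp_call fun t4 ht4 => ⟨rfl, ?_⟩
      rw [mul_add]
      omega

theorem call_sift (ctx : Data) (g : Perm (Fin N)) (full : List (Perm (Fin N)))
    (hf : Reduced full) :
    ∃ L, CallLe prog iSift (ctx ⊹ encP g ⊹ encL full) (encL L) (M ^ 13) ∧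
      Reduced L ∧ gen L = gen (g :: full) := by
  have hpow := pow_facts hM
  obtain ⟨L, hc, hL⟩ := call_insert hM hN _ g [] full full hf rfl (by simp) le_rfl
  refine ⟨L, .of_wp (body := siftCode) rfl ?_, hL⟩
  simp [siftCode, wp]
  refine hc.wp_call fun t ht => ⟨rfl, ?_⟩
  have h1 : full.length ≤ M ^ 2 + 1 := hf.length_le.trans (by nlinarith)
  have h2 : unfixed g * (full.length + 1) + full.length + 1 ≤ M ^ 4 := by
    calc _ ≤ M * (M ^ 2 + 2) + (M ^ 2 + 2) := by
          have := Nat.mul_le_mul ((unfixed_le g).trans hN)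
            (show full.length + 1 ≤ M ^ 2 + 2 by omega)
          omega
      _ = M ^ 3 + 2 * M + M ^ 2 + 2 := by ring
      _ ≤ M ^ 4 := by omega
  have h3 := Nat.mul_le_mul_left (M ^ 7) h2
  rw [← pow_add] at h3
  norm_num at h3
  omega

/-- Sifting a list of generators leaves at most `N * N + 1` of them (`Reduced.length_le`). -/
theorem call_filter (l : List (Perm (Fin N))) (hl : l.length ≤ M ^ 3) :
    ∃ L, CallLe prog iFilter (.num 0 ⊹ encL l ⊹ .num 0) (encL L) (M ^ 17) ∧
      Reduced L ∧ gen L = gen l := by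
  obtain ⟨acc, hc, L, rfl, hL, hgen⟩ := CallLe.fold (p := prog) (self := iFilter) (c := iSift) rfl
    (ctx := .num 0) (K := M ^ 13) (acc := .num 0) (fun g : Perm (Fin N) => encP g)
    (fun done acc => ∃ L : List (Perm (Fin N)), acc = encL L ∧ Reduced L ∧ gen L = gen done) l
    (by
      rintro done b rest - acc ⟨L, rfl, hL, hgen⟩
      obtain ⟨L', hc, hL', hgen'⟩ := call_sift hM hN (.num 0) b L hL
      refine ⟨_, hc, L', rfl, hL', hgen'.trans (le_antisymm ?_ ?_)⟩
      · refine gen_cons_le.2 ⟨mem_gen (by simp), ?_⟩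
        rw [hgen]
        exact gen_mono (by simp)
      · rw [gen_le]
        intro g hg
        rw [List.mem_append, List.mem_singleton] at hg
        rcases hg with hg | rfl
        · exact gen_mono (List.subset_cons_self _ _) (hgen ▸ mem_gen hg)
        · exact mem_gen List.mem_cons_self)
    ⟨[], rfl, ⟨List.Pairwise.nil, by simp⟩, rfl⟩
  exact ⟨L, hc.mono (loop_le hM (a := 12) (b := 2) le_rfl hl), hL, hgen⟩

end

/-! ### Orbits and stabilizers -/

/-- Schreier's lemma: if `R` contains the identity and each product `r s` of an element of `R` and
a generator lies in `⟨H⟩ R`, then so does each element of the generated group. -/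
theorem exists_mul_inv_mem_gen {V : Type u} [Finite V] {gens R H : List (Perm V)} (h1 : 1 ∈ R)
    (hR : ∀ r ∈ R, ∀ s ∈ gens, ∃ r' ∈ R, r * s * r'⁻¹ ∈ gen H) {γ : Perm V} (hγ : γ ∈ gen gens) :
    ∃ r ∈ R, γ * r⁻¹ ∈ gen H := by
  have hγ' : γ ∈ Submonoid.closure {g | g ∈ gens} := by
    rw [← Subgroup.closure_toSubmonoid_of_finite]
    exact hγ
  clear hγ
  induction hγ' using Submonoid.closure_induction_right with
  | one => exact ⟨1, h1, by simp⟩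
  | mul_right x _ s hs ih =>
    obtain ⟨r, hr, h⟩ := ih
    obtain ⟨r', hr', h'⟩ := hR r hr s hs
    exact ⟨r', hr', by simpa [mul_assoc] using mul_mem h h'⟩

section
variable {M : ℕ} (hM : 1000 ≤ M) {N : ℕ} (hN : N ≤ M)

theorem cmpVal_eq_zero {l l' : List ℕ} : cmpVal l l' = 0 ↔ l = l' := by
  unfold cmpVal
  split_ifs <;> simp_all

include hM

theorem call_mem (v u : ℕ) (b : Bool) :
    CallLe prog iMem (.num v ⊹ .num u ⊹ .num b.toNat) (.num (decide (u = v) || b).toNat) M := by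
  refine .of_wp (body := memCode) rfl ?_
  rcases lt_trichotomy v u with h | rfl | h
  · simp [memCode, wp, h, h.ne', Post]; omega
  · simp [memCode, wp, Post]; omega
  · simp [memCode, wp, h, h.ne, h.not_gt, Post]; omega

theorem call_one {m : ℕ} (hm : m ≤ M) (g : Fin m → ℕ) :
    CallLe prog iRange (.num 0 ⊹ encF g) (encP (1 : Perm (Fin m))) (M ^ 2) := by
  have := call_range hM .num (List.ofFn g) (by simpa) 0
  have e : List.range' 0 (List.ofFn g).length =
      List.ofFn fun i : Fin m => ((1 : Perm (Fin m)) i : ℕ) := by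
    rw [← List.range_eq_range']
    apply List.ext_getElem <;> simp
  rwa [e] at this

/-- The indicator function of a list of points. -/
def ind {N : ℕ} (A : List (Fin N)) (i : Fin N) : ℕ := (decide (i ∈ A)).toNat

theorem call_ind (A : List (Fin N)) (hA : A.length ≤ M) (v : Fin N) :
    CallLe prog iInd (encA A ⊹ .num v) (.num (ind A v)) (M ^ 4) := by
  obtain ⟨acc, hc, rfl⟩ := CallLe.fold (p := prog) (self := iMemFold) (c := iMem) rfl
    (ctx := .num v) (K := M) (acc := .num 0) (fun u : Fin N => .num u)
    (fun done acc => acc = .num (ind done v)) A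
    (by
      rintro done u rest - acc rfl
      refine ⟨_, call_mem hM v u _, ?_⟩
      simp only [ind, List.mem_append, List.mem_singleton, Fin.ext_iff, Bool.decide_or]
      rw [Bool.or_comm]
      simp only [eq_comm]) rfl
  have hpow := pow_facts hM
  have hc := hc.mono (loop_le hM (a := 0) (b := 0) (by simp) (by simpa using hA))
  refine .of_wp (body := indCode) rfl ?_
  simp [indCode, wp]
  refine CallLe.wp_call (T := M ^ 3) ?_ fun t ht => ⟨rfl, ?_⟩
  · simpa [encA, encN, Function.comp_def] using hc
  · omega

include hN

/-- The result lists the `r` in `R` with `B ∘ r = w`; only its first entry is used. -/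
theorem call_find (B w : Fin N → ℕ) (R : List (Perm (Fin N))) (hR : R.length ≤ M) :
    ∃ L : List (Perm (Fin N)), CallLe prog iFind ((encF B ⊹ encF w) ⊹ encL R ⊹ .num 0) (encL L)
      (M ^ 8) ∧ (∀ r ∈ L, r ∈ R ∧ B ∘ r = w) ∧ (L = [] → ∀ r ∈ R, B ∘ r ≠ w) := by
  have hpow := pow_facts hM
  obtain ⟨acc, hc, L, rfl, h1, h2⟩ := CallLe.fold (p := prog) (self := iFind) (c := iMatch) rfl
    (ctx := encF B ⊹ encF w) (K := M ^ 6) (acc := .num 0) (fun g : Perm (Fin N) => encP g)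
    (fun done acc => ∃ L : List (Perm (Fin N)), acc = encL L ∧ (∀ r ∈ L, r ∈ done ∧ B ∘ r = w) ∧
      (L = [] → ∀ r ∈ done, B ∘ r ≠ w)) R
    (by
      rintro done r rest - acc ⟨L, rfl, h1, h2⟩
      have hcmp := call_cmp hM (List.ofFn (B ∘ r)) (List.ofFn w) (by simpa)
      by_cases h : B ∘ r = w
      · refine ⟨encL (r :: L), .of_wp (body := matchCode) rfl ?_, r :: L, rfl, ?_, by simp⟩
        · simp [matchCode, wp]
          refine (call_mulF hM hN hN B r).wp_call fun t ht => hcmp.wp_call fun t' ht' => ?_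
          rw [cmpVal_eq_zero.2 (by rw [h])]
          simp [Post, encL_cons]
          omega
        · intro s hs
          rcases List.mem_cons.1 hs with rfl | hs
          · simp [h]
          · simp [h1 s hs]
      · refine ⟨encL L, .of_wp (body := matchCode) rfl ?_, L, rfl, ?_, ?_⟩
        · simp [matchCode, wp]
          refine (call_mulF hM hN hN B r).wp_call fun t ht => hcmp.wp_call fun t' ht' => ?_
          simp [Post, cmpVal_eq_zero, List.ofFn_inj, h]
          omega
        · exact fun s hs => ⟨List.mem_append_left _ (h1 s hs).1, (h1 s hs).2⟩
        · intro hL s hs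
          rw [List.mem_append, List.mem_singleton] at hs
          rcases hs with hs | rfl
          · exact h2 hL s hs
          · exact h)
    ⟨[], rfl, by simp, by simp⟩
  exact ⟨L, hc.mono (loop_le hM (a := 5) (b := 0) le_rfl (by simpa using hR)), h1, h2⟩

theorem call_mulMap (c : Perm (Fin N)) (gens rest : List (Perm (Fin N))) (hg : gens.length ≤ M) :
    CallLe prog iMulMap (encP c ⊹ encL gens ⊹ encL rest) (encL (gens.map (c * ·) ++ rest))
      (M ^ 7) := by
  have h := CallLe.map (p := prog) (self := iMulMap) (c := iMul) (ctx := encP c) rfl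
    (fun g : Perm (Fin N) => encP g) (fun g : Perm (Fin N) => encP (c * g : Perm (Fin N))) gens
    (rest.map fun g : Perm (Fin N) => encP g)
    fun b _ => call_mul hM hN c b
  have h := h.mono (loop_le hM (a := 4) (b := 0) le_rfl (by simpa using hg))
  simpa [encL, Function.comp_def] using h

/-- The orbit algorithm. The orbit is that of `B` under composition from the right; `R` represents
distinct points of it, `H` consists of Schreier generators of the stabilizer of `B`, and the
candidates in `todo` are the products `r s` that are still to be examined. Each step removes a
candidate, or adds an element to `R` and at most `gens.length` candidates, while the size of `R` is
at most that of the orbit, hence at most `M`; `n` bounds the number of the remaining steps. -/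
theorem call_orbit (B : Fin N → ℕ) (gens : List (Perm (Fin N))) (hg : gens.length ≤ M)
    (hB : ∀ R : List (Perm (Fin N)), (∀ r ∈ R, r ∈ gen gens) →
      (R.map fun r : Perm (Fin N) => B ∘ r).Nodup → R.length ≤ M)
    (n : ℕ) (todo R H : List (Perm (Fin N))) (ht : ∀ c ∈ todo, c ∈ gen gens)
    (hR : ∀ r ∈ R, r ∈ gen gens) (hnd : (R.map fun r : Perm (Fin N) => B ∘ r).Nodup)
    (hH : ∀ h ∈ H, h ∈ gen gens ∧ B ∘ h = B)
    (hJ : ∀ r ∈ R, ∀ s ∈ gens, r * s ∈ todo ∨ ∃ r' ∈ R, r * s * r'⁻¹ ∈ gen H)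
    (h1 : 1 ∈ R ∨ R = [] ∧ ∃ rest, todo = 1 :: rest)
    (hn : (M - R.length) * (gens.length + 1) + todo.length ≤ n) :
    ∃ R' H' : List (Perm (Fin N)),
      CallLe prog iOrbit ((encF B ⊹ encL gens) ⊹ encL todo ⊹ encL R ⊹ encL H)
        (encL R' ⊹ encL H') (M ^ 9 * (n + 1)) ∧
      1 ∈ R' ∧ (∀ r ∈ R', r ∈ gen gens) ∧ (R'.map fun r : Perm (Fin N) => B ∘ r).Nodup ∧
      (∀ h ∈ H', h ∈ gen gens ∧ B ∘ h = B) ∧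
      (∀ r ∈ R', ∀ s ∈ gens, ∃ r' ∈ R', r * s * r'⁻¹ ∈ gen H') ∧ H'.length ≤ H.length + n := by
  have hpow := pow_facts hM
  induction n generalizing todo R H with
  | zero =>
    have h : todo = [] := List.length_eq_zero_iff.1 (by omega)
    subst h
    refine ⟨R, H, .of_wp (body := orbitCode) rfl ?_, by simpa using h1, hR, hnd, hH,
      by simpa using hJ, by omega⟩
    simp [orbitCode, wp, encL, Data.ofList, Post]
    omega
  | succ n ih =>
  cases todo with
  | nil =>
    refine ⟨R, H, .of_wp (body := orbitCode) rfl ?_, by simpa using h1, hR, hnd, hH,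
      by simpa using hJ, by omega⟩
    simp [orbitCode, wp, encL, Data.ofList, Post]
    rw [mul_add]
    omega
  | cons c rest =>
    obtain ⟨L, hfind, hL1, hL2⟩ := call_find hM hN B (B ∘ c) R (hB R hR hnd)
    have hmul := call_mulF hM hN hN B c
    have hc := ht c List.mem_cons_self
    have hrest : ∀ c ∈ rest, c ∈ gen gens := fun c hc => ht c (List.mem_cons_of_mem _ hc)
    cases L with
    | cons r L =>
      obtain ⟨hr, hrc⟩ := hL1 r List.mem_cons_self
      obtain ⟨R', H', hcall, h⟩ := ih rest R (c * r⁻¹ :: H) hrest hR hnd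
        (by
          intro h hh
          rcases List.mem_cons.1 hh with rfl | hh
          · refine ⟨mul_mem hc (inv_mem (hR r hr)), ?_⟩
            rw [Perm.coe_mul, ← Function.comp_assoc, ← hrc, Function.comp_assoc, ← Perm.coe_mul,
              mul_inv_cancel, Perm.coe_one, Function.comp_id]
          · exact hH h hh)
        (by
          intro r₁ hr₁ s hs
          rcases hJ r₁ hr₁ s hs with h | ⟨r', hr', h⟩
          · rcases List.mem_cons.1 h with h | h
            · exact .inr ⟨r, hr, h ▸ mem_gen List.mem_cons_self⟩
            · exact .inl h
          · exact .inr ⟨r', hr', gen_mono (List.subset_cons_self _ _) h⟩)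
        (.inl (h1.resolve_right fun h => by simp [h.1] at hr))
        (by simp at hn; omega)
      refine ⟨R', H', .of_wp (body := orbitCode) rfl ?_, h.1, h.2.1, h.2.2.1, h.2.2.2.1,
        h.2.2.2.2.1, ?_⟩
      · simp [orbitCode, wp, encL, Data.ofList]
        refine hmul.wp_call fun t1 ht1 => hfind.wp_call fun t2 ht2 => ?_
        simp [encL, Data.ofList]
        refine (call_inv hM hN r).wp_call fun t3 ht3 => ?_
        refine (call_mul hM hN _ _).wp_call fun t4 ht4 => hcall.wp_call fun t5 ht5 => ⟨rfl, ?_⟩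
        rw [mul_add]
        omega
      · have := h.2.2.2.2.2
        simp at this
        omega
    | nil =>
      have hnew := hL2 rfl
      have hR' : ∀ r ∈ c :: R, r ∈ gen gens := by
        intro r hr
        rcases List.mem_cons.1 hr with rfl | hr
        exacts [hc, hR r hr]
      have hnd' : ((c :: R).map fun r : Perm (Fin N) => B ∘ r).Nodup := by
        rw [List.map_cons, List.nodup_cons]
        refine ⟨fun h => ?_, hnd⟩
        obtain ⟨r, hr, h⟩ := List.mem_map.1 h
        exact hnew r hr h
      have hlen := hB _ hR' hnd'
      obtain ⟨R', H', hcall, h⟩ := ih (gens.map (c * ·) ++ rest) (c :: R) H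
        (by
          intro d hd
          rcases List.mem_append.1 hd with hd | hd
          · obtain ⟨s, hs, rfl⟩ := List.mem_map.1 hd
            exact mul_mem hc (mem_gen hs)
          · exact hrest d hd)
        hR' hnd' hH
        (by
          intro r hr s hs
          rcases List.mem_cons.1 hr with rfl | hr
          · exact .inl (List.mem_append_left _ (List.mem_map.2 ⟨s, hs, rfl⟩))
          · rcases hJ r hr s hs with h | ⟨r', hr', h⟩
            · rcases List.mem_cons.1 h with h | h
              · exact .inr ⟨c, List.mem_cons_self, by simp [h]⟩
              · exact .inl (List.mem_append_right _ h)
            · exact .inr ⟨r', List.mem_cons_of_mem _ hr', h⟩)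
        (.inl (by
          rcases h1 with h | ⟨-, _, h⟩
          · exact List.mem_cons_of_mem _ h
          · rw [(List.cons.inj h).1]
            exact List.mem_cons_self))
        (by
          simp at hn hlen ⊢
          have : (M - R.length) * (gens.length + 1) =
              (M - (R.length + 1)) * (gens.length + 1) + (gens.length + 1) := by
            rw [← Nat.succ_mul]
            congr 1
            omega
          omega)
      refine ⟨R', H', .of_wp (body := orbitCode) rfl ?_, h.1, h.2.1, h.2.2.1, h.2.2.2.1,
        h.2.2.2.2.1, by have := h.2.2.2.2.2; omega⟩
      simp [orbitCode, wp, encL, Data.ofList]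
      refine hmul.wp_call fun t1 ht1 => hfind.wp_call fun t2 ht2 => ?_
      simp [encL, Data.ofList]
      refine (call_mulMap hM hN c gens rest hg).wp_call fun t3 ht3 => ?_
      refine hcall.wp_call fun t5 ht5 => ⟨rfl, ?_⟩
      rw [mul_add]
      omega

/-- The identity is passed as the list of all points. -/
theorem call_indMap (A : List (Fin N)) (hA : A.length ≤ M) :
    CallLe prog iIndMap (encA A ⊹ encP (1 : Perm (Fin N)) ⊹ .num 0) (encF (ind A)) (M ^ 6) := by
  have h := CallLe.map (p := prog) (self := iIndMap) (c := iInd) (ctx := encA A) rfl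
    (fun v : Fin N => .num v) (fun v : Fin N => .num (ind A v)) (List.ofFn id) []
    fun v _ => call_ind hM A hA v
  have h := h.mono (loop_le hM (a := 3) (b := 0) le_rfl (by simpa using hN))
  simpa [encP, encF, encN, List.map_ofFn, Function.comp_def, Data.ofList] using h

/-- Representatives `R` of the cosets of the setwise stabilizer of `A`, and generators `H` of this
stabilizer, provided that the orbit of `A` has at most `M` members. -/
theorem call_stab (gens : List (Perm (Fin N))) (hg : gens.length ≤ M) (A : List (Fin N))
    (hA : A.length ≤ M) (g : Perm (Fin N))
    (hB : ∀ R : List (Perm (Fin N)), (∀ r ∈ R, r ∈ gen gens) →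
      (R.map fun r : Perm (Fin N) => ind A ∘ r).Nodup → R.length ≤ M) :
    ∃ R H : List (Perm (Fin N)),
      CallLe prog iStab (encL gens ⊹ encA A ⊹ encP g) (encL R ⊹ encL H) (M ^ 18) ∧
      1 ∈ R ∧ (∀ r ∈ R, r ∈ gen gens) ∧ (R.map fun r : Perm (Fin N) => ind A ∘ r).Nodup ∧
      (∀ γ ∈ gen gens, ∃ r ∈ R, γ * r⁻¹ ∈ gen H) ∧ Reduced H ∧
      ∀ h, h ∈ gen H ↔ h ∈ gen gens ∧ ∀ i, h i ∈ A ↔ i ∈ A := by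
  have hpow := pow_facts hM
  obtain ⟨R, H, hc, h1, hR, hnd, hH, hJ, hlen⟩ := call_orbit hM hN (ind A) gens hg hB _ [1] [] []
    (by simp) (by simp) (by simp) (by simp) (by simp) (.inr ⟨rfl, [], rfl⟩) le_rfl
  have hn : (M - ([] : List (Perm (Fin N))).length) * (gens.length + 1) +
      ([1] : List (Perm (Fin N))).length + 1 ≤ M ^ 3 := by
    simp only [List.length_nil, List.length_singleton, Nat.sub_zero]
    calc _ ≤ M * (M + 1) + 2 := by
          have := Nat.mul_le_mul_left M (show gens.length + 1 ≤ M + 1 by omega)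
          omega
      _ = M ^ 2 + M + 2 := by ring
      _ ≤ M ^ 3 := by omega
  obtain ⟨H', hf, hred, hgen⟩ := call_filter hM hN H (by
    have h0 : ([] : List (Perm (Fin N))).length = 0 := rfl
    omega)
  have hsch : ∀ γ ∈ gen gens, ∃ r ∈ R, γ * r⁻¹ ∈ gen H :=
    fun γ hγ => exists_mul_inv_mem_gen h1 hJ hγ
  have hind : ∀ h : Perm (Fin N), ind A ∘ h = ind A ↔ ∀ i, h i ∈ A ↔ i ∈ A := by
    intro h
    rw [funext_iff]
    refine forall_congr' fun i => ?_
    by_cases h1 : h i ∈ A <;> by_cases h2 : i ∈ A <;> simp [ind, h1, h2]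
  have hstab : gen H ≤ { carrier := {h | h ∈ gen gens ∧ ind A ∘ h = ind A}
                         mul_mem' := fun {a b} ha hb => ⟨mul_mem ha.1 hb.1, by
                          rw [Perm.coe_mul, ← Function.comp_assoc, ha.2, hb.2]⟩
                         one_mem' := ⟨one_mem _, rfl⟩
                         inv_mem' := fun {a} ha => ⟨inv_mem ha.1, by
                          nth_rw 1 [← ha.2]
                          rw [Function.comp_assoc, ← Perm.coe_mul, mul_inv_cancel, Perm.coe_one,
                            Function.comp_id]⟩ : Subgroup (Perm (Fin N)) } :=
    gen_le.2 fun h hh => hH h hh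
  refine ⟨R, H', .of_wp (body := stabCode) rfl ?_, h1, hR, hnd, hgen ▸ hsch, hred, fun h => ?_⟩
  · simp [stabCode, wp]
    refine (call_one hM hN fun i => (g i : ℕ)).wp_call fun t1 ht1 => ?_
    simp
    refine (call_indMap hM hN A hA).wp_call fun t2 ht2 => ?_
    refine hc.wp_call fun t3 ht3 => ?_
    simp
    refine hf.wp_call fun t4 ht4 => ⟨rfl, ?_⟩
    have := Nat.mul_le_mul_left (M ^ 9) hn
    rw [← pow_add] at this
    norm_num at this ht3
    omega
  · rw [hgen, ← hind]
    refine ⟨fun hh => hstab hh, fun hh => ?_⟩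
    obtain ⟨r, hr, hhr⟩ := hsch h hh.1
    have h2 := (hstab hhr).2
    have h3 : ind A ∘ r = ind A ∘ (1 : Perm (Fin N)) := by
      have h4 : ind A ∘ (h * r⁻¹ : Perm (Fin N)) ∘ r = ind A ∘ r := by
        rw [← Function.comp_assoc, h2]
      rw [← Perm.coe_mul, inv_mul_cancel_right, hh.2] at h4
      rw [← h4, Perm.coe_one, Function.comp_id]
    have h5 : r = 1 := List.inj_on_of_nodup_map hnd hr h1 h3
    simpa [h5] using hhr

end

/-! ### Lexicographic minimization over cosets -/

theorem append_le_append_iff {l l' m m' : List ℕ} (h : l.length = l'.length) :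
    l ++ m ≤ l' ++ m' ↔ l < l' ∨ l = l' ∧ m ≤ m' := by
  induction l generalizing l' with
  | nil =>
    have : l' = [] := List.length_eq_zero_iff.1 h.symm
    subst this
    simp
  | cons a l ih =>
    cases l' with
    | nil => simp at h
    | cons a' l' =>
      have ih := ih (l' := l') (by simpa using h)
      simp only [le_iff_lt_or_eq] at ih ⊢
      simp only [List.cons_append, List.cons_lt_cons_iff, List.cons.injEq]
      tauto

section
variable {N : ℕ} (W : Fin N → Fin N) (val : Fin N → ℕ)

/-- The word of `σ` on a list `A` of points: the values of the map `σ⁻¹ W σ` on `A`. -/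
def word (σ : Perm (Fin N)) (A : List (Fin N)) : List ℕ :=
  A.map fun v => val (σ⁻¹ (W (σ v)))

/-- The coset `σ' Γ'` consists of the elements of `σ Γ` whose word on `A` is smallest. -/
structure Solves (Γ : Subgroup (Perm (Fin N))) (σ : Perm (Fin N)) (A : List (Fin N))
    (Γ' : Subgroup (Perm (Fin N))) (σ' : Perm (Fin N)) : Prop where
  mem : σ⁻¹ * σ' ∈ Γ
  min : ∀ γ ∈ Γ, word W val σ' A ≤ word W val (σ * γ) A
  stab : ∀ h, h ∈ Γ' ↔ h ∈ Γ ∧ word W val (σ' * h) A = word W val σ' A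

variable {W val}

/-- Minimizing the words on `A` and then, among the minimizers, the words on `B` minimizes the
words on `A ++ B`. -/
theorem Solves.append {Γ Γ₁ Γ₂ : Subgroup (Perm (Fin N))} {σ σ₁ σ₂ : Perm (Fin N)}
    {A B : List (Fin N)} (h₁ : Solves W val Γ σ A Γ₁ σ₁) (h₂ : Solves W val Γ₁ σ₁ B Γ₂ σ₂) :
    Solves W val Γ σ (A ++ B) Γ₂ σ₂ := by
  have hle : ∀ h ∈ Γ₁, h ∈ Γ := fun h hh => ((h₁.stab h).1 hh).1
  have hw : word W val σ₂ A = word W val σ₁ A := by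
    simpa using ((h₁.stab _).1 h₂.mem).2
  have happ : ∀ σ, word W val σ (A ++ B) = word W val σ A ++ word W val σ B :=
    fun σ => List.map_append
  have hlen : ∀ σ σ', (word W val σ A).length = (word W val σ' A).length := by simp [word]
  refine ⟨?_, fun γ hγ => ?_, fun h => ?_⟩
  · simpa [mul_assoc] using mul_mem h₁.mem (hle _ h₂.mem)
  · rw [happ, happ, append_le_append_iff (hlen _ _), hw]
    rcases (h₁.min γ hγ).lt_or_eq with hlt | heq
    · exact .inl hlt
    · refine .inr ⟨heq, ?_⟩
      have hmem : σ₁⁻¹ * (σ * γ) ∈ Γ₁ := by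
        refine (h₁.stab _).2 ⟨?_, by simpa using heq.symm⟩
        simpa [mul_assoc] using mul_mem (inv_mem h₁.mem) hγ
      simpa using h₂.min _ hmem
  · have key : h ∈ Γ₁ ↔ h ∈ Γ ∧ word W val (σ₂ * h) A = word W val σ₂ A := by
      have h3 := h₁.stab (σ₁⁻¹ * σ₂ * h)
      rw [Subgroup.mul_mem_cancel_left _ h₂.mem,
        Subgroup.mul_mem_cancel_left _ (hle _ h₂.mem)] at h3
      rw [h3, hw]
      simp [mul_assoc]
    rw [h₂.stab, key, happ, happ, and_assoc]
    exact and_congr_right fun _ =>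
      ⟨fun h => by rw [h.1, h.2], fun h => List.append_inj h (hlen _ _)⟩

theorem word_eq_iff (hval : Function.Injective val) {σ σ' : Perm (Fin N)} {A : List (Fin N)} :
    word W val σ A = word W val σ' A ↔ ∀ v ∈ A, σ⁻¹ (W (σ v)) = σ'⁻¹ (W (σ' v)) := by
  simp [word, hval.eq_iff]

variable (W)

/-- The subgroup of those elements of `Γ` that do not change the word of `σ` on an invariant
list `A`. -/
def wordStab (hval : Function.Injective val) (Γ : Subgroup (Perm (Fin N))) (σ : Perm (Fin N))
    (A : List (Fin N)) (hA : ∀ γ ∈ Γ, ∀ v ∈ A, γ v ∈ A) : Subgroup (Perm (Fin N)) where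
  carrier := {h | h ∈ Γ ∧ word W val (σ * h) A = word W val σ A}
  one_mem' := ⟨one_mem _, by simp⟩
  mul_mem' {a b} ha hb := by
    refine ⟨mul_mem ha.1 hb.1, (word_eq_iff hval).2 fun v hv => ?_⟩
    have h1 := (word_eq_iff hval).1 ha.2 (b v) (hA b hb.1 v hv)
    have h2 := (word_eq_iff hval).1 hb.2 v hv
    simp only [mul_inv_rev, Perm.mul_apply] at h1 h2 ⊢
    rw [h1, h2]
  inv_mem' {a} ha := by
    refine ⟨inv_mem ha.1, (word_eq_iff hval).2 fun v hv => ?_⟩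
    have h1 := (word_eq_iff hval).1 ha.2 (a⁻¹ v) (hA _ (inv_mem ha.1) v hv)
    simp only [mul_inv_rev, Perm.mul_apply, inv_inv] at h1 ⊢
    rw [← h1]
    simp

/-- The state `(Γ', τ)` of the minimization over a union of cosets `σ r⁻¹ H`, for `r` in a list
`done`: `τ` has the smallest word on the union, and the coset `τ Γ'` contains all the elements of
the union with this word and consists of elements of `σ Γ` with this word. -/
structure Joined (hval : Function.Injective val) (Γ H : Subgroup (Perm (Fin N)))
    (σ : Perm (Fin N)) (A : List (Fin N)) (hA : ∀ γ ∈ Γ, ∀ v ∈ A, γ v ∈ A)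
    (done : List (Perm (Fin N))) (Γ' : Subgroup (Perm (Fin N))) (τ : Perm (Fin N)) : Prop where
  mem : σ⁻¹ * τ ∈ Γ
  min : ∀ r ∈ done, ∀ h ∈ H, word W val τ A ≤ word W val (σ * r⁻¹ * h) A
  le : Γ' ≤ wordStab W hval Γ τ A hA
  mem_of_eq : ∀ r ∈ done, ∀ h ∈ H, word W val (σ * r⁻¹ * h) A = word W val τ A →
    τ⁻¹ * (σ * r⁻¹ * h) ∈ Γ'
  stab : ∀ h ∈ H, word W val (τ * h) A = word W val τ A → h ∈ Γ'

variable {W} {hval : Function.Injective val} {Γ H : Subgroup (Perm (Fin N))}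
  {σ τ σ₂ r : Perm (Fin N)} {A : List (Fin N)} {hA : ∀ γ ∈ Γ, ∀ v ∈ A, γ v ∈ A}
  {done : List (Perm (Fin N))} {Γ' H₂ : Subgroup (Perm (Fin N))}

/-- The state after the first coset. -/
theorem Joined.single (hH : H ≤ Γ) (hr : r ∈ Γ) (h : Solves W val H (σ * r⁻¹) A H₂ σ₂) :
    Joined W hval Γ H σ A hA [r] H₂ σ₂ := by
  refine ⟨?_, ?_, fun k hk => ?_, ?_, fun k hk he => (h.stab k).2 ⟨hk, he⟩⟩
  · simpa [mul_assoc] using mul_mem (inv_mem hr) (hH h.mem)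
  · simp only [List.mem_singleton, forall_eq]
    exact h.min
  · exact ⟨hH ((h.stab k).1 hk).1, ((h.stab k).1 hk).2⟩
  · simp only [List.mem_singleton, forall_eq]
    intro k hk he
    refine (h.stab _).2 ⟨?_, by simpa using he⟩
    simpa [mul_assoc] using mul_mem (inv_mem h.mem) hk

/-- The words on a new coset are all larger than the smallest one so far. -/
theorem Joined.keep (hj : Joined W hval Γ H σ A hA done Γ' τ)
    (h : Solves W val H (σ * r⁻¹) A H₂ σ₂) (hlt : word W val τ A < word W val σ₂ A) :
    Joined W hval Γ H σ A hA (done ++ [r]) Γ' τ := by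
  refine ⟨hj.mem, fun s hs k hk => ?_, hj.le, fun s hs k hk he => ?_, hj.stab⟩
  · rw [List.mem_append, List.mem_singleton] at hs
    rcases hs with hs | rfl
    · exact hj.min s hs k hk
    · exact hlt.le.trans (h.min k hk)
  · rw [List.mem_append, List.mem_singleton] at hs
    rcases hs with hs | rfl
    · exact hj.mem_of_eq s hs k hk he
    · exact absurd (he ▸ h.min k hk) (not_le.2 hlt)

/-- A new coset contains smaller words than all earlier ones. -/
theorem Joined.replace (hj : Joined W hval Γ H σ A hA done Γ' τ) (hH : H ≤ Γ) (hr : r ∈ Γ)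
    (h : Solves W val H (σ * r⁻¹) A H₂ σ₂) (hlt : word W val σ₂ A < word W val τ A) :
    Joined W hval Γ H σ A hA (done ++ [r]) H₂ σ₂ := by
  have h1 : Joined W hval Γ H σ A hA [r] H₂ σ₂ := .single hH hr h
  refine ⟨h1.mem, fun s hs k hk => ?_, h1.le, fun s hs k hk he => ?_, h1.stab⟩
  · rcases List.mem_append.1 hs with hs | hs
    · exact hlt.le.trans (hj.min s hs k hk)
    · exact h1.min s hs k hk
  · rcases List.mem_append.1 hs with hs | hs
    · exact absurd (he ▸ hj.min s hs k hk) (not_le.2 hlt)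
    · exact h1.mem_of_eq s hs k hk he

/-- In case of a tie the two minimizers differ by an element of the stabilizer of the word, and
the stabilizers in `H` of the two minimizers are the same group. -/
theorem Joined.tie (hj : Joined W hval Γ H σ A hA done Γ' τ) (hH : H ≤ Γ) (hr : r ∈ Γ)
    (h : Solves W val H (σ * r⁻¹) A H₂ σ₂) (heq : word W val τ A = word W val σ₂ A)
    {Γ'' : Subgroup (Perm (Fin N))} (hle : Γ'' ≤ wordStab W hval Γ τ A hA)
    (hge : Γ' ≤ Γ'') (hmem : τ⁻¹ * σ₂ ∈ Γ'') :
    Joined W hval Γ H σ A hA (done ++ [r]) Γ'' τ := by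
  have h1 : Joined W hval Γ H σ A hA [r] H₂ σ₂ := .single hH hr h
  refine ⟨hj.mem, fun s hs k hk => ?_, hle, fun s hs k hk he => ?_,
    fun k hk he => hge (hj.stab k hk he)⟩
  · rcases List.mem_append.1 hs with hs | hs
    · exact hj.min s hs k hk
    · exact heq ▸ h1.min s hs k hk
  · rcases List.mem_append.1 hs with hs | hs
    · exact hge (hj.mem_of_eq s hs k hk he)
    · have h2 := h1.mem_of_eq s hs k hk (he.trans heq)
      have h3 : σ₂⁻¹ * (σ * s⁻¹ * k) ∈ Γ'' := by
        have h4 := (h.stab _).1 h2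
        refine hge (hj.stab _ h4.1 ?_)
        have h5 : τ⁻¹ * σ₂ * (σ₂⁻¹ * (σ * s⁻¹ * k)) ∈ wordStab W hval Γ τ A hA := by
          refine ⟨mul_mem (hle hmem).1 (hH h4.1), ?_⟩
          simpa [mul_assoc] using he
        exact ((Subgroup.mul_mem_cancel_left _ (hle hmem)).1 h5).2
      simpa [mul_assoc] using mul_mem hmem h3

/-- Once the cosets cover `σ Γ`, the minimization over `σ Γ` is complete. -/
theorem Joined.solves (hj : Joined W hval Γ H σ A hA done Γ' τ)
    (hcov : ∀ γ ∈ Γ, ∃ r ∈ done, γ * r⁻¹ ∈ H) : Solves W val Γ σ A Γ' τ := by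
  have hcov' : ∀ γ ∈ Γ, ∃ r ∈ done, ∃ h ∈ H, γ = r⁻¹ * h := fun γ hγ => by
    obtain ⟨r, hr, h⟩ := hcov _ (inv_mem hγ)
    exact ⟨r, hr, r * γ, by simpa using inv_mem h, by simp⟩
  refine ⟨hj.mem, fun γ hγ => ?_, fun k => ⟨fun hk => hj.le hk, fun hk => ?_⟩⟩
  · obtain ⟨r, hr, h, hh, rfl⟩ := hcov' γ hγ
    simpa [mul_assoc] using hj.min r hr h hh
  · obtain ⟨r, hr, h, hh, he⟩ := hcov' _ (mul_mem hj.mem hk.1)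
    have he' : τ * k = σ * r⁻¹ * h := by
      rw [mul_assoc σ, ← he]
      simp [mul_assoc]
    have := hj.mem_of_eq r hr h hh (he' ▸ hk.2)
    rw [← he'] at this
    simpa using this

/-- The orbit of a subset of the invariant set `A` has at most `2 ^ A.length` members. -/
theorem length_le_two_pow {A B : List (Fin N)} (hA : ∀ γ ∈ Γ, ∀ v ∈ A, γ v ∈ A) (hB : B ⊆ A)
    (R : List (Perm (Fin N))) (hR : ∀ r ∈ R, r ∈ Γ)
    (hnd : (R.map fun r : Perm (Fin N) => ind B ∘ r).Nodup) : R.length ≤ 2 ^ A.length := by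
  have hnd' : (R.map fun r : Perm (Fin N) => A.toFinset.filter fun i => r i ∈ B).Nodup := by
    refine List.Nodup.map_on (fun r hr s hs he => ?_) hnd.of_map
    refine List.inj_on_of_nodup_map hnd hr hs (funext fun i => ?_)
    have key : ∀ r ∈ R, r i ∈ B ↔ i ∈ A.toFinset.filter fun i => r i ∈ B := by
      intro r hr
      simp only [Finset.mem_filter, List.mem_toFinset, iff_and_self]
      intro hi
      simpa using hA _ (inv_mem (hR r hr)) _ (hB hi)
    simp only [ind, Function.comp_apply, key r hr, key s hs, he]
  have hcard := List.toFinset_card_of_nodup hnd'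
  rw [List.length_map] at hcard
  rw [← hcard]
  calc _ ≤ A.toFinset.powerset.card := Finset.card_le_card fun s hs => by
        simp only [List.mem_toFinset, List.mem_map] at hs
        obtain ⟨r, -, rfl⟩ := hs
        simp
    _ ≤ _ := by
        rw [Finset.card_powerset]
        exact Nat.pow_le_pow_right (by norm_num) A.toFinset_card_le

theorem length_le_of_point {q : Fin N} (R : List (Perm (Fin N)))
    (hnd : (R.map fun r : Perm (Fin N) => ind [q] ∘ r).Nodup) : R.length ≤ N := by
  have hnd' : (R.map fun r : Perm (Fin N) => r⁻¹ q).Nodup := by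
    refine List.Nodup.map_on (fun r hr s hs he => ?_) hnd.of_map
    refine List.inj_on_of_nodup_map hnd hr hs (funext fun i => ?_)
    have key : ∀ r : Perm (Fin N), r i = q ↔ i = r⁻¹ q := fun r => by
      rw [eq_comm, Perm.eq_inv_iff_eq, eq_comm]
    simp [ind, key, he]
  simpa using hnd'.length_le_card

end

/-! ### Minimization on the machine -/

/-- The test that `bestCode` and `joinCode` make by means of `.pred`. -/
theorem cmpVal_eq_two {l l' : List ℕ} : cmpVal l l' - 1 = 0 ↔ ¬ l' < l := by
  unfold cmpVal
  split_ifs with h1 h2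
  · simp [h1]
  · simp [h2.le]
  · simp [lt_of_le_of_ne (not_lt.1 h2) (Ne.symm h1)]

section
variable {M : ℕ} (hM : 1000 ≤ M) {N : ℕ} (hN : N ≤ M)

/-- The list `f` is a copy of the rest of `l` in the first call; it is taken off two at a time in
order to find the middle. -/
theorem call_half (l f : List (Fin N)) (h : f.length ≤ l.length) :
    CallLe prog iHalf (encA l ⊹ encA f)
      (encA (l.take (f.length / 2)) ⊹ encA (l.drop (f.length / 2))) (50 * (f.length + 1)) := by
  induction hf : f.length using Nat.strong_induction_on generalizing l f with
  | _ n ih =>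
  refine .of_wp (body := halfCode) rfl ?_
  match f, l with
  | [], l =>
    subst hf
    simp [halfCode, wp, encA, encN, Data.ofList, Post]
  | [a], l =>
    subst hf
    simp [halfCode, wp, encA, encN, Data.ofList, Post]
  | a :: b :: f, [] => simp at h
  | a :: b :: f, c :: l =>
    have hih := ih f.length (by simp at hf; omega) l f (by simp at h; omega) rfl
    have hlen : (a :: b :: f).length / 2 = f.length / 2 + 1 := by
      simp only [List.length_cons]
      omega
    rw [← hf, hlen]
    simp [halfCode, wp, encA, encN, Data.ofList] at hih ⊢
    refine hih.wp_call fun t ht => ⟨rfl, ?_⟩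
    omega

variable (W : Fin N → Fin N) (val : Fin N → ℕ)
include hM hN

theorem call_word (σ : Perm (Fin N)) {A : List (Fin N)} (hA : A.length ≤ M) :
    CallLe prog iWord ((encP W ⊹ encF val) ⊹ encP σ ⊹ encA A) (encN (word W val σ A))
      (M ^ 7) := by
  have hpow := pow_facts hM
  refine .of_wp (body := wordCode) rfl ?_
  simp [wordCode, wp]
  refine (call_inv hM hN σ).wp_call fun t1 ht1 => ?_
  refine (call_mulF hM hN hN (fun i => (W i : ℕ)) σ).wp_call fun t2 ht2 => ?_
  refine (call_mulF hM hN hN (fun i => ((σ⁻¹ : Perm (Fin N)) i : ℕ)) (W ∘ σ)).wp_call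
    fun t3 ht3 => ?_
  refine (call_mulF hM hN hN val ((σ⁻¹ : Perm (Fin N)) ∘ W ∘ σ)).wp_call fun t4 ht4 => ?_
  refine (call_mulA hM hN _ hA).wp_call fun t5 ht5 => ⟨rfl, ?_⟩
  omega

theorem call_best (σ r τ : Perm (Fin N)) {A : List (Fin N)} (hA : A.length ≤ M) :
    CallLe prog iBest (((encP W ⊹ encF val) ⊹ encP σ ⊹ encA A) ⊹ encP r ⊹ encP τ)
      (encP (if word W val (σ * r) A < word W val τ A then σ * r else τ : Perm (Fin N)))
      (M ^ 8) := by
  have hpow := pow_facts hM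
  refine .of_wp (body := bestCode) rfl ?_
  simp [bestCode, wp]
  refine (call_mul hM hN σ r).wp_call fun t1 ht1 => ?_
  simp
  refine (call_word hM hN W val τ hA).wp_call fun t2 ht2 => ?_
  refine (call_word hM hN W val (σ * r) hA).wp_call fun t3 ht3 => ?_
  refine (call_cmp hM _ _ (by simpa [word] using hA)).wp_call fun t4 ht4 => ?_
  simp only [Data.toNat_num, cmpVal_eq_two]
  by_cases h : word W val (σ * r) A < word W val τ A
  · simp [h, Post]
    omega
  · simp [h, Post]
    omega

theorem call_bestFold (σ : Perm (Fin N)) (R : List (Perm (Fin N))) (hR : R.length ≤ M)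
    {A : List (Fin N)} (hA : A.length ≤ M) :
    ∃ r ∈ 1 :: R, CallLe prog iBestFold (((encP W ⊹ encF val) ⊹ encP σ ⊹ encA A) ⊹ encL R ⊹ encP σ)
      (encP (σ * r : Perm (Fin N))) (M ^ 10) ∧
      ∀ s ∈ R, word W val (σ * r) A ≤ word W val (σ * s) A := by
  obtain ⟨acc, hc, r, hr, rfl, hmin⟩ := CallLe.fold (p := prog) (self := iBestFold) (c := iBest)
    rfl (ctx := (encP W ⊹ encF val) ⊹ encP σ ⊹ encA A) (K := M ^ 8) (acc := encP σ)
    (fun g : Perm (Fin N) => encP g)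
    (fun done acc => ∃ r ∈ 1 :: done, acc = encP (σ * r : Perm (Fin N)) ∧
      ∀ s ∈ done, word W val (σ * r) A ≤ word W val (σ * s) A) R
    (by
      rintro done b rest - acc ⟨r, hr, rfl, hmin⟩
      refine ⟨_, call_best hM hN W val σ b (σ * r) hA, ?_⟩
      split_ifs with h
      · refine ⟨b, by simp, rfl, fun s hs => ?_⟩
        rw [List.mem_append, List.mem_singleton] at hs
        rcases hs with hs | rfl
        · exact h.le.trans (hmin s hs)
        · exact le_rfl
      · refine ⟨r, ?_, rfl, fun s hs => ?_⟩
        · rw [← List.cons_append]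
          exact List.mem_append_left _ hr
        · rw [List.mem_append, List.mem_singleton] at hs
          rcases hs with hs | rfl
          · exact hmin s hs
          · exact not_lt.1 h)
    ⟨1, by simp, by simp, by simp⟩
  exact ⟨r, hr, hc.mono (loop_le hM (a := 7) (b := 0) le_rfl (by simpa using hR)), hmin⟩

/-- On a fixed point `v` of the group, the word of `σ r` is the value of `r⁻¹ q`, where
`q = σ⁻¹ (W (σ v))`. It is therefore minimized by a representative of a point of the orbit of `q`,
and its stabilizer is the stabilizer of a point. -/
theorem call_point (gens : List (Perm (Fin N))) (hg : gens.length ≤ M) (σ : Perm (Fin N))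
    (v : Fin N) (hv : ∀ γ ∈ gen gens, γ v = v) :
    ∃ (gens' : List (Perm (Fin N))) (σ' : Perm (Fin N)),
      CallLe prog iPoint ((encP W ⊹ encF val) ⊹ encL gens ⊹ encP σ ⊹ encA [v])
        (encL gens' ⊹ encP σ') (M ^ 19) ∧ Reduced gens' ∧
      (Function.Injective val → Solves W val (gen gens) σ [v] (gen gens') σ') := by
  have hpow := pow_facts hM
  have h1M : [v].length ≤ M := by simp; omega
  have hB : ∀ q : Fin N, ∀ R : List (Perm (Fin N)), (∀ r ∈ R, r ∈ gen gens) →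
      (R.map fun r : Perm (Fin N) => ind [q] ∘ r).Nodup → R.length ≤ M :=
    fun q R _ h => (length_le_of_point R h).trans hN
  obtain ⟨R, H, hc, h1, hR, hnd, hcov, -, hstab⟩ :=
    call_stab hM hN gens hg [σ⁻¹ (W (σ v))] (by simp; omega) σ (hB _)
  obtain ⟨r, hr, hbest, hmin⟩ := call_bestFold hM hN W val σ R (hB _ R hR hnd) h1M
  have hr : r ∈ R := by
    rcases List.mem_cons.1 hr with rfl | hr
    exacts [h1, hr]
  have hrg := hR r hr
  obtain ⟨R', H', hc', -, -, -, -, hred, hstab'⟩ := call_stab hM hN gens hg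
    [(σ * r)⁻¹ (W ((σ * r) v))] (by simp; omega) (σ * r) (hB _)
  refine ⟨H', σ * r, .of_wp (body := pointCode) rfl ?_, hred, fun hval => ⟨?_, ?_, ?_⟩⟩
  · simp [pointCode, wp, -mul_inv_rev]
    refine (call_inv hM hN σ).wp_call fun t1 ht1 => ?_
    refine (call_mulPA hM hN σ h1M).wp_call fun t2 ht2 => ?_
    refine (call_mulPA hM hN W (A := [σ v]) h1M).wp_call fun t3 ht3 => ?_
    refine (call_mulPA hM hN (σ⁻¹ : Perm (Fin N)) (A := [W (σ v)]) h1M).wp_call fun t4 ht4 => ?_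
    refine hc.wp_call fun t5 ht5 => ?_
    simp [-mul_inv_rev]
    refine hbest.wp_call fun t6 ht6 => ?_
    simp [-mul_inv_rev]
    refine (call_inv hM hN (σ * r)).wp_call fun t7 ht7 => ?_
    refine (call_mulPA hM hN (σ * r : Perm (Fin N)) h1M).wp_call fun t8 ht8 => ?_
    refine (call_mulPA hM hN W (A := [(σ * r) v]) h1M).wp_call fun t9 ht9 => ?_
    refine (call_mulPA hM hN ((σ * r)⁻¹ : Perm (Fin N)) (A := [W ((σ * r) v)]) h1M).wp_call
      fun t10 ht10 => ?_
    refine hc'.wp_call fun t11 ht11 => ⟨rfl, ?_⟩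
    omega
  · simpa using hrg
  · intro γ hγ
    obtain ⟨s, hs, h⟩ := hcov γ hγ
    refine (hmin s hs).trans_eq ((word_eq_iff hval).2 ?_)
    have h2 := ((hstab _).1 h).2 (σ⁻¹ (W (σ v)))
    simp only [List.mem_singleton, iff_true, Perm.mul_apply] at h2
    simp only [List.mem_singleton, forall_eq, mul_inv_rev, Perm.mul_apply, hv s (hR s hs),
      hv γ hγ]
    rw [eq_comm, Perm.inv_eq_iff_eq, h2]
  · intro h
    rw [hstab']
    refine and_congr_right fun hh => ?_
    rw [word_eq_iff hval]
    simp only [List.mem_singleton, forall_eq]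
    rw [mul_inv_rev (σ * r), Perm.mul_apply h⁻¹, Perm.mul_apply (σ * r), hv h hh,
      Perm.inv_eq_iff_eq]
    generalize (σ * r)⁻¹ (W ((σ * r) v)) = q
    constructor
    · intro hq
      exact ((hq q).2 rfl).symm
    · intro hq i
      constructor
      · intro hi
        exact h.injective (hi.trans hq)
      · rintro rfl
        exact hq.symm

end

/-! ### The recursion -/

/-- The solution of the recurrence for the running time: a list of length `a` leads to `r ≤ 2 ^ a`
cosets and, for each of them, to two lists of half the length. As `3 (a / 2) ≥ a` for `a ≥ 2`, the
base `4096 = 16 ^ 3` gives `4096 ^ (a / 2) ≥ 16 ^ a`, which outweighs `2 ^ a` and the constants. -/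
theorem mini_time {a a₁ a₂ r P Q : ℕ} (ha : 2 ≤ a) (h₁ : a₁ = a / 2) (h₂ : a₁ + a₂ = a)
    (hr : r ≤ 2 ^ a) (hP : Q ≤ P) :
    (4096 ^ a₁ * P + 4096 ^ a₂ * P + Q) * (r + 1) + Q ≤ 4096 ^ a * P := by
  have hx : 4096 ^ a₁ ≤ 4096 ^ a₂ := Nat.pow_le_pow_right (by norm_num) (by omega)
  have hy : 1 ≤ 4096 ^ a₂ := Nat.one_le_pow _ _ (by norm_num)
  have h4 : 4 ≤ 2 ^ a := (show 4 = 2 ^ 2 by norm_num) ▸ Nat.pow_le_pow_right (by norm_num) ha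
  have hxa : 7 * 2 ^ a ≤ 4096 ^ a₁ := by
    have h5 : (4096 : ℕ) ^ a₁ = 16 ^ (3 * a₁) := by rw [pow_mul]; norm_num
    have h6 : (16 : ℕ) ^ a ≤ 16 ^ (3 * a₁) := Nat.pow_le_pow_right (by norm_num) (by omega)
    have h7 : (16 : ℕ) ^ a = 8 ^ a * 2 ^ a := by rw [← mul_pow]; norm_num
    have h8 : 8 ^ 2 ≤ 8 ^ a := Nat.pow_le_pow_right (by norm_num) ha
    rw [h5]
    refine le_trans ?_ h6
    rw [h7]
    exact Nat.mul_le_mul_right _ (by omega)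
  have h9 : Q ≤ 4096 ^ a₂ * P := hP.trans (Nat.le_mul_of_pos_left _ hy)
  calc _ ≤ (3 * (4096 ^ a₂ * P)) * (2 * 2 ^ a) + 4096 ^ a₂ * P :=
        Nat.add_le_add (Nat.mul_le_mul (by
          have := Nat.mul_le_mul_right P hx
          omega) (by omega)) h9
    _ ≤ (7 * 2 ^ a) * (4096 ^ a₂ * P) := by nlinarith
    _ ≤ 4096 ^ a₁ * (4096 ^ a₂ * P) := Nat.mul_le_mul_right _ hxa
    _ = _ := by rw [← mul_assoc, ← pow_add, h₂]

section
variable {M : ℕ} (hM : 1000 ≤ M) {N : ℕ} (hN : N ≤ M)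
variable (W : Fin N → Fin N) (val : Fin N → ℕ)
include hM hN

/-- The code of the state of `iJoinFold`; `none` is the state before the first coset. -/
def encState {N : ℕ} : Option (List (Perm (Fin N)) × Perm (Fin N)) → Data
  | none => .num 0
  | some (g, τ) => encL g ⊹ encP τ

/-- One step of `iJoinFold`, given the solution `(H₂, σ₂)` for the new coset. -/
def joinStep (A : List (Fin N)) (H₂ : List (Perm (Fin N))) (σ₂ : Perm (Fin N)) :
    Option (List (Perm (Fin N)) × Perm (Fin N)) → List (Perm (Fin N)) × Perm (Fin N)
  | none => (H₂, σ₂)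
  | some (g, τ) =>
    if word W val τ A = word W val σ₂ A then (τ⁻¹ * σ₂ :: g, τ)
    else if word W val τ A < word W val σ₂ A then (g, τ) else (H₂, σ₂)

theorem call_join (H H₁ H₂ : List (Perm (Fin N))) (σ r σ₁ σ₂ : Perm (Fin N))
    {A A₁ A₂ : List (Fin N)} (hA : A.length ≤ M) {T₁ T₂ : ℕ}
    (h₁ : CallLe prog iMini ((encP W ⊹ encF val) ⊹ encL H ⊹ encP (σ * r⁻¹ : Perm (Fin N)) ⊹
      encA A₁) (encL H₁ ⊹ encP σ₁) T₁)
    (h₂ : CallLe prog iMini ((encP W ⊹ encF val) ⊹ encL H₁ ⊹ encP σ₁ ⊹ encA A₂)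
      (encL H₂ ⊹ encP σ₂) T₂) (acc : Option (List (Perm (Fin N)) × Perm (Fin N))) :
    CallLe prog iJoin
      (((encP W ⊹ encF val) ⊹ encL H ⊹ encP σ ⊹ encA A ⊹ encA A₁ ⊹ encA A₂) ⊹ encP r ⊹
        encState acc)
      (encState (some (joinStep W val A H₂ σ₂ acc))) (T₁ + T₂ + M ^ 8) := by
  have hpow := pow_facts hM
  refine .of_wp (body := joinCode) rfl ?_
  simp [joinCode, wp]
  refine (call_inv hM hN r).wp_call fun t1 ht1 => ?_
  refine (call_mul hM hN σ r⁻¹).wp_call fun t2 ht2 => ?_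
  refine h₁.wp_call fun t3 ht3 => ?_
  simp
  refine h₂.wp_call fun t4 ht4 => ?_
  match acc with
  | none =>
    simp [encState, joinStep, Post]
    omega
  | some (g, τ) =>
    simp [encState]
    refine (call_word hM hN W val τ hA).wp_call fun t5 ht5 => ?_
    refine (call_word hM hN W val σ₂ hA).wp_call fun t6 ht6 => ?_
    refine (call_cmp hM _ _ (by simpa [word] using hA)).wp_call fun t7 ht7 => ?_
    rcases lt_trichotomy (word W val τ A) (word W val σ₂ A) with h | h | h
    · simp [cmpVal, joinStep, h, h.ne, Post]
      omega
    · simp [cmpVal, joinStep, h]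
      refine (call_inv hM hN τ).wp_call fun t8 ht8 => ?_
      refine (call_mul hM hN τ⁻¹ σ₂).wp_call fun t9 ht9 => ⟨rfl, ?_⟩
      omega
    · simp [cmpVal, joinStep, h.ne', h.not_gt, Post]
      omega

/-- The specification of `iMini` for the list `A`. -/
def MiniSpec (M : ℕ) (A : List (Fin N)) : Prop :=
  ∀ (gens : List (Perm (Fin N))) (σ : Perm (Fin N)), gens.length ≤ M →
    (∀ γ ∈ gen gens, ∀ v ∈ A, γ v ∈ A) →
    ∃ (gens' : List (Perm (Fin N))) (σ' : Perm (Fin N)),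
      CallLe prog iMini ((encP W ⊹ encF val) ⊹ encL gens ⊹ encP σ ⊹ encA A)
        (encL gens' ⊹ encP σ') (4096 ^ A.length * M ^ 20) ∧ Reduced gens' ∧
      Solves W val (gen gens) σ A (gen gens') σ'

/-- On each coset of `H` the words on `A` are minimized by minimizing those on `A₁` and then those
on `A₂`; the solutions are joined one by one. -/
theorem call_joinFold (hval : Function.Injective val) (hNM : N * N + 1 ≤ M)
    (gens H : List (Perm (Fin N))) (hH : H.length ≤ M) (hHle : gen H ≤ gen gens)
    (σ : Perm (Fin N)) {A A₁ A₂ : List (Fin N)} (hA : A.length ≤ M) (hAA : A₁ ++ A₂ = A)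
    (hinv : ∀ γ ∈ gen gens, ∀ v ∈ A, γ v ∈ A)
    (hinv₁ : ∀ γ ∈ gen H, ∀ v ∈ A₁, γ v ∈ A₁) (hinv₂ : ∀ γ ∈ gen H, ∀ v ∈ A₂, γ v ∈ A₂)
    (hs₁ : MiniSpec W val M A₁) (hs₂ : MiniSpec W val M A₂)
    (R : List (Perm (Fin N))) (hR : ∀ r ∈ R, r ∈ gen gens) (hR0 : R ≠ []) :
    ∃ (g : List (Perm (Fin N))) (τ : Perm (Fin N)),
      CallLe prog iJoinFold
        (((encP W ⊹ encF val) ⊹ encL H ⊹ encP σ ⊹ encA A ⊹ encA A₁ ⊹ encA A₂) ⊹ encL R ⊹ .num 0)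
        (encL g ⊹ encP τ)
        ((4096 ^ A₁.length * M ^ 20 + 4096 ^ A₂.length * M ^ 20 + M ^ 8 + 40) * (R.length + 1)) ∧
      g.length ≤ N * N + 1 + R.length ∧
      Joined W hval (gen gens) (gen H) σ A hinv R (gen g) τ := by
  obtain ⟨acc, hc, h⟩ := CallLe.fold (p := prog) (self := iJoinFold) (c := iJoin)
    rfl (ctx := (encP W ⊹ encF val) ⊹ encL H ⊹ encP σ ⊹ encA A ⊹ encA A₁ ⊹ encA A₂)
    (K := 4096 ^ A₁.length * M ^ 20 + 4096 ^ A₂.length * M ^ 20 + M ^ 8) (acc := .num 0)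
    (fun g : Perm (Fin N) => encP g)
    (fun done acc => done = [] ∧ acc = encState (N := N) none ∨
      ∃ (g : List (Perm (Fin N))) (τ : Perm (Fin N)), acc = encState (some (g, τ)) ∧
        g.length ≤ N * N + 1 + done.length ∧
        Joined W hval (gen gens) (gen H) σ A hinv done (gen g) τ) R
    (by
      rintro done r rest hd acc hacc
      have hr : r ∈ gen gens := hR r (by simp [hd])
      obtain ⟨H₁, σ₁, hc₁, hred₁, hsol₁⟩ := hs₁ H (σ * r⁻¹) hH hinv₁
      have hle₁ : gen H₁ ≤ gen H := fun h hh => ((hsol₁.stab h).1 hh).1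
      obtain ⟨H₂, σ₂, hc₂, hred₂, hsol₂⟩ := hs₂ H₁ σ₁ (hred₁.length_le.trans hNM)
        fun γ hγ => hinv₂ γ (hle₁ hγ)
      have hsol := hAA ▸ hsol₁.append hsol₂
      have hlen₂ := hred₂.length_le
      rcases hacc with ⟨rfl, rfl⟩ | ⟨g, τ, rfl, hlen, hj⟩
      · refine ⟨_, call_join hM hN W val H H₁ H₂ σ r σ₁ σ₂ hA hc₁ hc₂ none, .inr
          ⟨H₂, σ₂, rfl, by omega, ?_⟩⟩
        exact .single hHle hr hsol
      · have hcall := call_join hM hN W val H H₁ H₂ σ r σ₁ σ₂ hA hc₁ hc₂ (some (g, τ))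
        rcases lt_trichotomy (word W val τ A) (word W val σ₂ A) with h1 | h1 | h1
        · rw [joinStep, if_neg h1.ne, if_pos h1] at hcall
          exact ⟨_, hcall, .inr ⟨g, τ, rfl, by simp; omega, hj.keep hsol h1⟩⟩
        · rw [joinStep, if_pos h1] at hcall
          refine ⟨_, hcall, .inr ⟨_, τ, rfl, by simp; omega, hj.tie hHle hr hsol h1
            (gen_cons_le.2 ⟨⟨?_, ?_⟩, hj.le⟩) (gen_mono (List.subset_cons_self _ _))
            (mem_gen List.mem_cons_self)⟩⟩
          · have h3 := mul_mem (inv_mem hj.mem) (mul_mem (inv_mem hr) (hHle hsol.mem))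
            have h4 : σ⁻¹ * τ * (τ⁻¹ * σ₂) = r⁻¹ * ((σ * r⁻¹)⁻¹ * σ₂) := by simp [mul_assoc]
            rw [← h4] at h3
            simpa [mul_assoc] using h3
          · simpa using h1.symm
        · rw [joinStep, if_neg h1.ne', if_neg h1.not_gt] at hcall
          exact ⟨_, hcall, .inr ⟨H₂, σ₂, rfl, by simp; omega, hj.replace hHle hr hsol h1⟩⟩)
    (.inl ⟨rfl, rfl⟩)
  rcases h with ⟨h, -⟩ | ⟨g, τ, rfl, hlen, hj⟩
  · exact absurd h hR0
  · exact ⟨g, τ, hc, hlen, hj⟩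

/-- Recursion by halving: the first half of `A` is invariant under its setwise stabilizer `H`, and
so is the second half, because `A` itself is invariant. -/
theorem call_mini (hval : Function.Injective val) (hNM : N * N + 1 ≤ M) (n : ℕ) :
    ∀ A : List (Fin N), A.length = n + 1 → A.Nodup → 2 ^ (n + 1) ≤ M → MiniSpec W val M A := by
  have hpow := pow_facts hM
  induction n using Nat.strong_induction_on with
  | _ n ih =>
  intro A hAn hnd h2 gens σ hg hinv
  have hA : A.length ≤ M := by
    have : n + 1 < 2 ^ (n + 1) := Nat.lt_two_pow_self
    omega
  match n, A with
  | 0, [v] =>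
    obtain ⟨gens', σ', hc, hred, hsol⟩ := call_point hM hN W val gens hg σ v
      (by simpa using hinv)
    refine ⟨gens', σ', .of_wp (body := miniCode) rfl ?_, hred, hsol hval⟩
    simp [miniCode, wp, encA, encN, Data.ofList] at hc ⊢
    refine hc.wp_call fun t ht => ⟨rfl, ?_⟩
    omega
  | n + 1, u :: v :: A' =>
    generalize hAdef : u :: v :: A' = A at *
    set A₁ := A.take (A.length / 2) with hA₁
    set A₂ := A.drop (A.length / 2) with hA₂
    have hAA : A₁ ++ A₂ = A := List.take_append_drop _ _
    have hl₁ : A₁.length = A.length / 2 := by simp [hA₁]; omega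
    have hl₂ : A₁.length + A₂.length = A.length := by rw [← List.length_append, hAA]
    have hnd' := List.nodup_append.1 (hAA ▸ hnd)
    have hsub : A₁ ⊆ A := hAA ▸ List.subset_append_left _ _
    have hpow2 : ∀ m ≤ n + 1, 2 ^ (m + 1) ≤ M := fun m hm =>
      (Nat.pow_le_pow_right (by norm_num) (by omega)).trans h2
    have hs₁ := ih (A₁.length - 1) (by omega) A₁ (by omega) hnd'.1 (hpow2 _ (by omega))
    have hs₂ := ih (A₂.length - 1) (by omega) A₂ (by omega) hnd'.2.1 (hpow2 _ (by omega))
    have hRlen := length_le_two_pow (B := A₁) hinv hsub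
    rw [hAn] at hRlen
    obtain ⟨R, H, hc, h1, hR, hndR, hcov, hred, hstab⟩ := call_stab hM hN gens hg A₁ (by omega) σ
      fun R hR hnd => (hRlen R hR hnd).trans h2
    have hHle : gen H ≤ gen gens := fun h hh => ((hstab h).1 hh).1
    have hRlen := hRlen R hR hndR
    have hinv₁ : ∀ γ ∈ gen H, ∀ v ∈ A₁, γ v ∈ A₁ := fun γ hγ v hv =>
      (((hstab γ).1 hγ).2 v).2 hv
    have hinv₂ : ∀ γ ∈ gen H, ∀ v ∈ A₂, γ v ∈ A₂ := by
      intro γ hγ v hv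
      have hmem := hinv γ (hHle hγ) v (hAA ▸ List.mem_append_right _ hv)
      rw [← hAA, List.mem_append] at hmem
      refine hmem.resolve_left fun h => ?_
      exact hnd'.2.2 v ((((hstab γ).1 hγ).2 v).1 h) v hv rfl
    obtain ⟨g, τ, hcj, hglen, hj⟩ := call_joinFold hM hN W val hval hNM gens H
      (hred.length_le.trans hNM) hHle σ hA hAA hinv hinv₁ hinv₂ hs₁ hs₂ R hR
      (List.ne_nil_of_mem h1)
    obtain ⟨gens', hcf, hred', hgen⟩ := call_filter hM hN g (by omega)
    refine ⟨gens', τ, .of_wp (body := miniCode) rfl ?_, hred', hgen ▸ hj.solves hcov⟩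
    have hsplit : CallLe prog iSplit ((encP W ⊹ encF val) ⊹ encL gens ⊹ encP σ ⊹ encA A)
        (encL gens' ⊹ encP τ)
        ((4096 ^ A₁.length * M ^ 20 + 4096 ^ A₂.length * M ^ 20 + M ^ 8 + 40) * (R.length + 1) +
          M ^ 19 - 20) := by
      refine .of_wp (body := splitCode) rfl ?_
      simp [splitCode, wp]
      refine (call_half A A le_rfl).wp_call fun t1 ht1 => ?_
      simp
      refine hc.wp_call fun t2 ht2 => ?_
      simp
      refine hcj.wp_call fun t3 ht3 => ?_
      simp
      refine hcf.wp_call fun t4 ht4 => ⟨rfl, ?_⟩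
      omega
    have htime := mini_time (a := A.length) (r := R.length) (P := M ^ 20) (Q := M ^ 19)
      (by omega) hl₁ hl₂ (by rw [hAn]; exact hRlen) (by omega)
    have hmono : (4096 ^ A₁.length * M ^ 20 + 4096 ^ A₂.length * M ^ 20 + M ^ 8 + 40) *
        (R.length + 1) ≤ (4096 ^ A₁.length * M ^ 20 + 4096 ^ A₂.length * M ^ 20 + M ^ 19) *
        (R.length + 1) := Nat.mul_le_mul_right _ (by omega)
    subst hAdef
    simp [miniCode, wp, encA, encN, Data.ofList] at hsplit ⊢
    refine hsplit.wp_call fun t ht => ⟨rfl, ?_⟩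
    simp only [List.length_cons] at htime hmono
    omega

end

/-! ### The minimization orbit by orbit -/

section
variable {M : ℕ} (hM : 1000 ≤ M) {N : ℕ} (hN : N ≤ M)

open Classical in
/-- The points of a list that lie in the orbit of `v`, in reverse order. -/
noncomputable def block (Γ : Subgroup (Perm (Fin N))) (points : List (Fin N)) (v : Fin N) :
    List (Fin N) :=
  (points.filter fun u => ∃ γ ∈ Γ, γ u = v).reverse

theorem mem_block {Γ : Subgroup (Perm (Fin N))} {points : List (Fin N)} {u v : Fin N} :
    u ∈ block Γ points v ↔ u ∈ points ∧ ∃ γ ∈ Γ, γ u = v := by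
  simp [block]

include hM hN

open Classical in
/-- Whether a point is mapped to `v` by a representative. -/
theorem call_hitFold (u v : Fin N) (R : List (Perm (Fin N))) (hR : R.length ≤ M) :
    CallLe prog iHitFold ((.num u ⊹ .num v) ⊹ encL R ⊹ .num 0)
      (.num (decide (∃ r ∈ R, r u = v)).toNat) (M ^ 5) := by
  have hpow := pow_facts hM
  obtain ⟨acc, hc, rfl⟩ := CallLe.fold (p := prog) (self := iHitFold) (c := iHit) rfl
    (ctx := .num u ⊹ .num v) (K := M ^ 3) (acc := .num 0) (fun g : Perm (Fin N) => encP g)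
    (fun done acc => acc = .num (decide (∃ r ∈ done, r u = v)).toNat) R
    (by
      rintro done r rest - acc rfl
      have hnth := call_nth hM (List.ofFn fun i => (r i : ℕ)) (i := u) (by omega)
      rw [show (List.ofFn fun i => (r i : ℕ)).getD u 0 = r u by simp] at hnth
      refine ⟨_, .of_wp (body := hitCode) rfl ?_, rfl⟩
      simp [hitCode, wp]
      refine hnth.wp_call fun t1 ht1 => ?_
      refine (call_mem hM v (r u) _).wp_call fun t2 ht2 => ⟨?_, by omega⟩
      congr 2
      rw [Bool.or_comm, ← Bool.decide_or]
      simp [Fin.ext_iff]) (by simp)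
  exact hc.mono (loop_le hM (a := 2) (b := 0) le_rfl (by simpa using hR))

open Classical in
theorem call_winFold (R : List (Perm (Fin N))) (hR : R.length ≤ M) (v : Fin N)
    (points : List (Fin N)) (hp : points.length ≤ M) :
    CallLe prog iWinFold ((encL R ⊹ .num v) ⊹ encA points ⊹ .num 0)
      (encA (points.filter fun u => ∃ r ∈ R, r u = v).reverse) (M ^ 8) := by
  have hpow := pow_facts hM
  obtain ⟨acc, hc, rfl⟩ := CallLe.fold (p := prog) (self := iWinFold) (c := iWin) rfl
    (ctx := encL R ⊹ .num v) (K := M ^ 6) (acc := .num 0) (fun u : Fin N => .num u)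
    (fun done acc => acc = encA (done.filter fun u => ∃ r ∈ R, r u = v).reverse) points
    (by
      rintro done u rest - acc rfl
      refine ⟨_, .of_wp (body := winCode) rfl ?_, rfl⟩
      simp [winCode, wp]
      refine (call_hitFold hM hN u v R hR).wp_call fun t1 ht1 => ?_
      by_cases h : ∃ r ∈ R, r u = v
      · simp [h, Post, encA_cons]
        omega
      · simp [h, Post]
        omega) rfl
  have hc := hc.mono (loop_le hM (a := 5) (b := 0) le_rfl (by simpa using hp))
  simpa [encA, encN, Function.comp_def] using hc

variable (W : Fin N → Fin N) (val : Fin N → ℕ)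

/-- The words on an invariant list of points are minimized orbit by orbit, so that the exponential
factor depends only on the size `k` of the largest orbit. An orbit is treated once for each of its
points; the repetitions do not matter. -/
theorem call_blockFold (hval : Function.Injective val) (hNM : N * N + 1 ≤ M) {k : ℕ}
    (hk : 2 ^ k ≤ M) (gens : List (Perm (Fin N))) (hg : Reduced gens) (points : List (Fin N))
    (hnd : points.Nodup) (hp : ∀ γ ∈ gen gens, ∀ v ∈ points, γ v ∈ points)
    (hblock : ∀ v ∈ points, (block (gen gens) points v).length ≤ k) :
    ∃ (gens' : List (Perm (Fin N))) (σ' : Perm (Fin N)),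
      CallLe prog iBlockFold (((encP W ⊹ encF val) ⊹ encL gens ⊹ encA points) ⊹ encA points ⊹
        encL gens ⊹ encP (1 : Perm (Fin N))) (encL gens' ⊹ encP σ') (4096 ^ k * M ^ 23) ∧
      Reduced gens' ∧
      Solves W val (gen gens) 1 (points.flatMap (block (gen gens) points)) (gen gens') σ' := by
  have hpow := pow_facts hM
  have hgM : gens.length ≤ M := hg.length_le.trans hNM
  have hpN : points.length ≤ N := by simpa using hnd.length_le_card
  obtain ⟨acc, hc, g, τ, rfl, hred, hsol⟩ := CallLe.fold (p := prog) (self := iBlockFold)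
    (c := iBlock) rfl
    (ctx := (encP W ⊹ encF val) ⊹ encL gens ⊹ encA points)
    (K := 4096 ^ k * M ^ 20 + M ^ 19) (acc := encL gens ⊹ encP (1 : Perm (Fin N)))
    (fun u : Fin N => .num u)
    (fun done acc => ∃ (g : List (Perm (Fin N))) (τ : Perm (Fin N)), acc = encL g ⊹ encP τ ∧
      Reduced g ∧ Solves W val (gen gens) 1 (done.flatMap (block (gen gens) points)) (gen g) τ)
    points
    (by
      rintro done v rest hd acc ⟨g, τ, rfl, hred, hsol⟩
      have hv : v ∈ points := by simp [hd]
      have hle : gen g ≤ gen gens := fun h hh => ((hsol.stab h).1 hh).1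
      obtain ⟨R, H, hstab, h1, hR, hndR, hcov, -, hH⟩ := call_stab hM hN gens hgM [v]
        (by simp; omega) τ fun R _ h => (length_le_of_point R h).trans hN
      have hRM := (length_le_of_point R hndR).trans hN
      have hwin : (points.filter fun u => ∃ r ∈ R, r u = v).reverse =
          block (gen gens) points v := by
        unfold block
        congr 1
        refine List.filter_congr fun u _ => ?_
        rw [decide_eq_decide]
        constructor
        · rintro ⟨r, hr, h⟩
          exact ⟨r, hR r hr, h⟩
        · rintro ⟨γ, hγ, h⟩
          obtain ⟨r, hr, h'⟩ := hcov γ hγ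
          refine ⟨r, hr, ?_⟩
          have := ((hH _).1 h').2 (r u)
          simpa [h] using this
      have hne : (block (gen gens) points v).length ≠ 0 := by
        rw [Ne, List.length_eq_zero_iff]
        exact List.ne_nil_of_mem (mem_block.2 ⟨hv, 1, one_mem _, rfl⟩)
      have hbk := hblock v hv
      obtain ⟨m, hm⟩ := Nat.exists_eq_succ_of_ne_zero hne
      obtain ⟨g', τ', hmini, hred', hsol'⟩ := call_mini hM hN W val hval hNM m
        (block (gen gens) points v) hm (List.nodup_reverse.2 (hnd.filter _))
        ((Nat.pow_le_pow_right (by norm_num) (by omega)).trans hk) g τ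
        (hred.length_le.trans hNM) (by
          intro γ hγ u hu
          obtain ⟨hu, δ, hδ, h⟩ := mem_block.1 hu
          exact mem_block.2 ⟨hp γ (hle hγ) u hu, δ * γ⁻¹, mul_mem hδ (inv_mem (hle hγ)),
            by simpa using h⟩)
      refine ⟨_, .of_wp (body := blockCode) rfl ?_, g', τ', rfl, hred', ?_⟩
      · simp [blockCode, wp]
        refine CallLe.wp_call (by simpa [encA, encN, Data.ofList] using hstab) fun t1 ht1 => ?_
        simp
        refine (call_winFold hM hN R hRM v points (hpN.trans hN)).wp_call fun t2 ht2 => ?_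
        rw [hwin]
        refine hmini.wp_call fun t3 ht3 => ⟨rfl, ?_⟩
        have h5 : 4096 ^ (block (gen gens) points v).length * M ^ 20 ≤ 4096 ^ k * M ^ 20 :=
          Nat.mul_le_mul_right _ (Nat.pow_le_pow_right (by norm_num) hbk)
        omega
      · rw [List.flatMap_append, List.flatMap_singleton]
        exact hsol.append hsol')
    ⟨gens, 1, rfl, hg, by simp, by simp [word], by simp [word]⟩
  refine ⟨g, τ, ?_, hred, hsol⟩
  have h5 : 1 ≤ 4096 ^ k := Nat.one_le_pow _ _ (by norm_num)
  have hc := hc.mono (T' := 4096 ^ k * M ^ 23) (by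
    calc _ ≤ (2 * (4096 ^ k * M ^ 20)) * (2 * M) := by
          refine Nat.mul_le_mul ?_ (by omega)
          have := Nat.mul_le_mul_right (M ^ 20) h5
          omega
      _ = 4096 ^ k * (4 * M ^ 21) := by ring
      _ ≤ 4096 ^ k * M ^ 23 := Nat.mul_le_mul_left _ (by omega))
  simpa [encA, encN, Function.comp_def] using hc

end

/-! ### The canonical labeling function -/

/-- The labels `i` and `j` are in the same orbit of the group of a labeling coset `Y`. -/
def LabelRel {V : Type u} (Y : Set (V → ℕ)) (i j : ℕ) : Prop :=
  ∃ l ∈ Y, ∃ l' ∈ Y, ∃ v, l v = i ∧ l' v = j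

open Classical in
/-- For each label `1, …, n` in turn, the labels in its orbit. In this sequence the first
occurrences of the members of an orbit are contiguous. -/
noncomputable def positions {V : Type u} (n : ℕ) (Y : Set (V → ℕ)) : List ℕ :=
  (List.range' 1 n).flatMap fun i => ((List.range' 1 n).filter fun j => LabelRel Y j i).reverse

/-- The label of `x⁻¹ v`, where `i` is the label of `v`; the supremum is over one element. -/
noncomputable def entry {V : Type u} (l : V → ℕ) (x : Perm V) (i : ℕ) : ℕ :=
  sSup {m | ∃ u, l (x u) = i ∧ m = l u}

/-- The inverse of the permutation of the labels induced by `x`, as a sequence of values. -/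
noncomputable def labelWord {V : Type u} (n : ℕ) (Y : Set (V → ℕ)) (l : V → ℕ) (x : Perm V) :
    List ℕ :=
  (positions n Y).map (entry l x)

/-- The labelings in `Y` under which some element of `X` becomes a lexicographically smallest
sequence. -/
noncomputable def canon : LabelingFunction.{u} := fun V _ X Y =>
  {l ∈ Y | ∃ x ∈ X, ∀ l' ∈ Y, ∀ x' ∈ X,
    labelWord (Nat.card V) Y l x ≤ labelWord (Nat.card V) Y l' x'}

section
variable {V : Type u}

theorem IsLabeling.injective {l : V → ℕ} (h : IsLabeling l) : Function.Injective l :=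
  Set.injOn_univ.1 h.injOn

theorem IsLabeling.comp {l : V → ℕ} (h : IsLabeling l) (δ : Perm V) : IsLabeling (l ∘ δ) :=
  Set.BijOn.comp h (Set.bijOn_univ.2 δ.bijective)

theorem entry_apply {l : V → ℕ} (h : Function.Injective l) (x : Perm V) (u : V) :
    entry l x (l (x u)) = l u := by
  have : {m | ∃ u', l (x u') = l (x u) ∧ m = l u'} = {l u} := by
    ext m
    constructor
    · rintro ⟨u', hu', rfl⟩
      rw [x.injective (h hu')]
      rfl
    · rintro rfl
      exact ⟨u, rfl, rfl⟩
  rw [entry, this, csSup_singleton]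

theorem labelRel_map {V' : Type u} (φ : V ≃ V') (Y : Set (V → ℕ)) (i j : ℕ) :
    LabelRel (mapLabelings φ Y) i j ↔ LabelRel Y i j := by
  constructor
  · rintro ⟨_, ⟨l, hl, rfl⟩, _, ⟨l', hl', rfl⟩, v, h⟩
    exact ⟨l, hl, l', hl', φ.symm v, h⟩
  · rintro ⟨l, hl, l', hl', v, h⟩
    exact ⟨_, ⟨l, hl, rfl⟩, _, ⟨l', hl', rfl⟩, φ v, by simpa using h⟩

theorem entry_map {V' : Type u} (φ : V ≃ V') (l : V → ℕ) (x : Perm V) (i : ℕ) :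
    entry (l ∘ φ.symm) (φ.permCongr x) i = entry l x i := by
  unfold entry
  congr 1
  ext m
  constructor
  · rintro ⟨u, h, rfl⟩
    exact ⟨φ.symm u, by simpa using h, rfl⟩
  · rintro ⟨u, h, rfl⟩
    exact ⟨φ u, by simpa using h, by simp⟩

theorem labelWord_map {V' : Type u} (φ : V ≃ V') (n : ℕ) (Y : Set (V → ℕ)) (l : V → ℕ)
    (x : Perm V) :
    labelWord n (mapLabelings φ Y) (l ∘ φ.symm) (φ.permCongr x) = labelWord n Y l x := by
  have hp : positions n (mapLabelings φ Y) = positions n Y := by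
    have : LabelRel (mapLabelings φ Y) = LabelRel Y :=
      funext fun i => funext fun j => propext (labelRel_map φ Y i j)
    unfold positions
    rw [this]
  rw [labelWord, hp]
  exact List.map_congr_left fun i _ => entry_map φ l x i

/-- `canon` is defined in terms of labels only, hence equivariant. -/
theorem canon_map [Finite V] {V' : Type u} [Finite V'] (φ : V ≃ V') (X : Set (Perm V))
    (Y : Set (V → ℕ)) :
    canon V' (mapPerms φ X) (mapLabelings φ Y) = mapLabelings φ (canon V X Y) := by
  ext m
  constructor
  · rintro ⟨⟨l, hl, rfl⟩, _, ⟨x, hx, rfl⟩, h⟩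
    refine ⟨l, ⟨hl, x, hx, fun l' hl' x' hx' => ?_⟩, rfl⟩
    have := h _ ⟨l', hl', rfl⟩ _ ⟨x', hx', rfl⟩
    rwa [labelWord_map, labelWord_map, ← Nat.card_congr φ] at this
  · rintro ⟨l, ⟨hl, x, hx, h⟩, rfl⟩
    refine ⟨⟨l, hl, rfl⟩, _, ⟨x, hx, rfl⟩, ?_⟩
    rintro _ ⟨l', hl', rfl⟩ _ ⟨x', hx', rfl⟩
    rw [labelWord_map, labelWord_map, ← Nat.card_congr φ]
    exact h l' hl' x' hx'

theorem pullLabelings_mapLabelings {V' : Type u} (φ : V ≃ V') (Y : Set (V → ℕ)) :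
    pullLabelings φ (mapLabelings φ Y) = Y := by
  simp [pullLabelings, mapLabelings, Set.image_image, Function.comp_assoc]

variable {G Δ : Subgroup (Perm V)} {f : Perm V} {ρ : V → ℕ}

theorem conj_mem_iff (hΔ : Δ = normIn Δ (G : Set (Perm V))) {δ : Perm V} (hδ : δ ∈ Δ)
    (g : Perm V) : δ * g * δ⁻¹ ∈ G ↔ g ∈ G := by
  rw [hΔ] at hδ
  exact ((Subgroup.mem_normalizer_iff.1 hδ.2) g).symm

/-- An element of `Δ` that conjugates one element of the coset to another one normalizes the
coset. -/
theorem mem_normIn_groupCoset (hΔ : Δ = normIn Δ (G : Set (Perm V))) {δ x x' : Perm V}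
    (hδ : δ ∈ Δ) (hx : x ∈ groupCoset G f) (hx' : x' ∈ groupCoset G f)
    (h : δ * x * δ⁻¹ = x') : δ ∈ normIn Δ (groupCoset G f) := by
  have key : ∀ {y z : Perm V}, y ∈ groupCoset G f → (z ∈ groupCoset G f ↔ y⁻¹ * z ∈ G) := by
    rintro _ z ⟨g, hg, rfl⟩
    constructor
    · rintro ⟨g', hg', rfl⟩
      simpa [mul_assoc] using mul_mem (inv_mem hg) hg'
    · intro hz
      exact ⟨_, mul_mem hg hz, by simp [mul_assoc]⟩
  refine ⟨hδ, Subgroup.mem_set_normalizer_iff.2 fun y => ?_⟩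
  rw [key hx, key hx', ← conj_mem_iff hΔ hδ, ← h]
  simp [mul_assoc]

theorem mem_positions [Finite V] {Y : Set (V → ℕ)} {l : V → ℕ} (hl : IsLabeling l) (hY : l ∈ Y)
    (v : V) : l v ∈ positions (Nat.card V) Y := by
  have hv := hl.mapsTo (Set.mem_univ v)
  have hv' : l v ∈ List.range' 1 (Nat.card V) := by
    rw [Set.mem_Icc] at hv
    rw [List.mem_range'_1]
    omega
  simp only [positions, List.mem_flatMap, List.mem_reverse, List.mem_filter, decide_eq_true_eq]
  exact ⟨l v, hv', hv', l, hY, l, hY, v, rfl, rfl⟩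

/-- Two pairs of a labeling and a permutation with the same word differ by an element of `Δ` that
conjugates one permutation to the other, and such an element normalizes the coset. -/
theorem solvesShift_canon : SolvesShift canon.{u} := by
  intro V _ G Δ f ρ hρ hΔ
  refine ⟨fun V' _ φ => by rw [canon_map, pullLabelings_mapLabelings], ?_⟩
  set X := groupCoset G f with hX
  set Y := labelingCoset Δ ρ with hY
  have hYlab : ∀ l ∈ Y, IsLabeling l := by
    rintro _ ⟨δ, -, rfl⟩
    exact hρ.comp δ
  have hYfin : Y.Finite := by
    have : Y ⊆ Set.range fun δ : Perm V => ρ ∘ δ := by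
      rintro _ ⟨δ, -, rfl⟩
      exact ⟨δ, rfl⟩
    exact (Set.finite_range _).subset this
  have hne : (Y ×ˢ X).Nonempty :=
    ⟨(ρ, f), ⟨1, one_mem _, rfl⟩, ⟨1, one_mem _, by simp⟩⟩
  obtain ⟨⟨π, x⟩, ⟨hπ, hx⟩, hmin⟩ := Set.exists_min_image (Y ×ˢ X)
    (fun p => labelWord (Nat.card V) Y p.1 p.2) (hYfin.prod (Set.toFinite X)) hne
  refine ⟨π, hYlab π hπ, Set.ext fun l => ⟨?_, ?_⟩⟩
  · rintro ⟨hl, x', hx', hmin'⟩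
    have heq : labelWord (Nat.card V) Y l x' = labelWord (Nat.card V) Y π x :=
      le_antisymm (hmin' π hπ x hx) (hmin (l, x') ⟨hl, hx'⟩)
    have hinjl := (hYlab l hl).injective
    have hinjπ := (hYlab π hπ).injective
    obtain ⟨δ₁, h₁, rfl⟩ := hl
    obtain ⟨δ₂, h₂, rfl⟩ := hπ
    -- The equality of the words says that `δ₂⁻¹ δ₁` conjugates `x'` to `x`.
    have hconj : ∀ u, x (δ₂⁻¹ (δ₁ u)) = δ₂⁻¹ (δ₁ (x' u)) := by
      intro u
      have hpos : ρ (δ₁ (x' u)) ∈ positions (Nat.card V) Y :=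
        mem_positions (Y := Y) (l := ρ ∘ δ₁) (hρ.comp δ₁) ⟨δ₁, h₁, rfl⟩ (x' u)
      have h3 := List.map_inj_left.1 heq _ hpos
      have h4 := entry_apply hinjl x' u
      have h5 := entry_apply hinjπ x (x⁻¹ (δ₂⁻¹ (δ₁ (x' u))))
      simp only [Function.comp_apply] at h3 h4 h5
      have h6 : x (x⁻¹ (δ₂⁻¹ (δ₁ (x' u)))) = δ₂⁻¹ (δ₁ (x' u)) := Equiv.apply_symm_apply x _
      have h7 : ∀ w, δ₂ (δ₂⁻¹ w) = w := fun w => Equiv.apply_symm_apply δ₂ w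
      rw [h6, h7] at h5
      rw [h4, h5] at h3
      have h8 := hρ.injective h3
      rw [h8]
      simp
    refine ⟨δ₂⁻¹ * δ₁, mem_normIn_groupCoset hΔ (mul_mem (inv_mem h₂) h₁) hx' hx ?_, ?_⟩
    · rw [mul_inv_eq_iff_eq_mul]
      ext u
      exact (hconj u).symm
    · ext u
      simp
  · rintro ⟨δ, hδ, rfl⟩
    have hmemY : π ∘ δ ∈ Y := by
      obtain ⟨δ₂, h₂, rfl⟩ := hπ
      exact ⟨δ₂ * δ, mul_mem h₂ hδ.1, rfl⟩
    have hx' : δ⁻¹ * x * δ ∈ X := by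
      have := (Subgroup.mem_set_normalizer_iff.1 (inv_mem hδ.2) x).1 hx
      simpa using this
    have heq : labelWord (Nat.card V) Y (π ∘ δ) (δ⁻¹ * x * δ) = labelWord (Nat.card V) Y π x := by
      refine List.map_congr_left fun i hi => ?_
      obtain ⟨v, rfl⟩ : ∃ v, π v = i := by
        simp only [positions, List.mem_flatMap, List.mem_reverse, List.mem_filter,
          List.mem_range'_1] at hi
        obtain ⟨_, _, hi, -⟩ := hi
        obtain ⟨v, -, hv⟩ := (hYlab π hπ).surjOn (show i ∈ Set.Icc 1 (Nat.card V) from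
          ⟨hi.1, by omega⟩)
        exact ⟨v, hv⟩
      have h1 := entry_apply (hYlab _ hmemY).injective (δ⁻¹ * x * δ) (δ⁻¹ (x⁻¹ v))
      have h2 := entry_apply (hYlab _ hπ).injective x (x⁻¹ v)
      simp at h1 h2
      rw [h1, h2]
    exact ⟨hmemY, _, hx', fun l' hl' x' hx'' => heq ▸ hmin (l', x') ⟨hl', hx''⟩⟩

end

/-! ### Two copies of the ground set -/

section
variable {V : Type u} {n : ℕ} (e : V ≃ Fin n)

/-- A point of the first copy of `V`. -/
def ptD (v : V) : Fin (n + n) := Fin.castAdd n (e v)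

/-- A point of the second copy of `V`. -/
def ptC (v : V) : Fin (n + n) := Fin.natAdd n (e v)

theorem pt_cases (i : Fin (n + n)) : (∃ v, i = ptD e v) ∨ ∃ v, i = ptC e v := by
  induction i using Fin.addCases with
  | left i => exact .inl ⟨e.symm i, by simp [ptD]⟩
  | right i => exact .inr ⟨e.symm i, by simp [ptC]⟩

theorem ptD_injective : Function.Injective (ptD e) := fun _ _ h =>
  e.injective (Fin.castAdd_injective n n h)

theorem ptC_injective : Function.Injective (ptC e) := fun _ _ h =>
  e.injective (Fin.natAdd_injective n n h)

/-- A pair of permutations of `V` acting on the two copies of `V`. -/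
def emb : Perm V × Perm V →* Perm (Fin (n + n)) where
  toFun p := finSumFinEquiv.permCongr (Equiv.sumCongr (e.permCongr p.1) (e.permCongr p.2))
  map_one' := by
    ext i
    rcases pt_cases e i with ⟨v, rfl⟩ | ⟨v, rfl⟩ <;>
      simp [ptD, ptC, -Fin.natAdd_eq_addNat]
  map_mul' p q := by
    ext i
    rcases pt_cases e i with ⟨v, rfl⟩ | ⟨v, rfl⟩ <;>
      simp [ptD, ptC, -Fin.natAdd_eq_addNat]

theorem emb_ptD (p : Perm V × Perm V) (v : V) : emb e p (ptD e v) = ptD e (p.1 v) := by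
  simp [emb, ptD]

theorem emb_ptC (p : Perm V × Perm V) (v : V) : emb e p (ptC e v) = ptC e (p.2 v) := by
  simp [emb, ptC, -Fin.natAdd_eq_addNat]

theorem emb_inv_ptC (p : Perm V × Perm V) (v : V) :
    (emb e p)⁻¹ (ptC e v) = ptC e (p.2⁻¹ v) := by
  rw [← map_inv, emb_ptC]
  rfl

theorem emb_coe (p : Perm V × Perm V) : (emb e p : Fin (n + n) → Fin (n + n)) =
    Fin.append (fun i => Fin.castAdd n (e.permCongr p.1 i))
      (fun i => Fin.natAdd n (e.permCongr p.2 i)) := by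
  ext i
  induction i using Fin.addCases <;> simp [emb, -Fin.natAdd_eq_addNat]

theorem emb_injective : Function.Injective (emb e) := by
  intro p q h
  refine Prod.ext (Equiv.ext fun v => ?_) (Equiv.ext fun v => ?_)
  · exact ptD_injective e (by rw [← emb_ptD, ← emb_ptD, h])
  · exact ptC_injective e (by rw [← emb_ptC, ← emb_ptC, h])

/-- Generators of the group of the pairs `(b, a)` with `b ∈ Δ` and `a ∈ b G`, where `S` generates
`G` and `T` generates `Δ`. -/
def embGens (S T : List (Perm V)) : List (Perm (Fin (n + n))) :=
  (S.map fun g => emb e (1, g)) ++ T.map fun δ => emb e (δ, δ)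

/-- The pairs `(b, a)` with `b ∈ Δ` and `b⁻¹ a ∈ G` form a group because `Δ` normalizes `G`. -/
theorem mem_gen_embGens {S T : List (Perm V)}
    (hΔ : gen T = normIn (gen T) (gen S : Set (Perm V))) {b a : Perm V} :
    emb e (b, a) ∈ gen (embGens e S T) ↔ b ∈ gen T ∧ b⁻¹ * a ∈ gen S := by
  constructor
  · let Γ : Subgroup (Perm V × Perm V) :=
      { carrier := {p | p.1 ∈ gen T ∧ p.1⁻¹ * p.2 ∈ gen S}
        one_mem' := by simp
        mul_mem' := fun {p q} hp hq => by
          refine ⟨mul_mem hp.1 hq.1, ?_⟩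
          have h1 := (conj_mem_iff hΔ (inv_mem hq.1) _).2 hp.2
          simpa [mul_assoc] using mul_mem h1 hq.2
        inv_mem' := fun {p} hp => by
          refine ⟨inv_mem hp.1, ?_⟩
          have h1 := (conj_mem_iff hΔ hp.1 _).2 (inv_mem hp.2)
          simpa [mul_assoc] using h1 }
    have hle : gen (embGens e S T) ≤ Γ.map (emb e) := by
      rw [gen_le]
      intro g hg
      rcases List.mem_append.1 hg with hg | hg
      · obtain ⟨s, hs, rfl⟩ := List.mem_map.1 hg
        exact ⟨_, ⟨one_mem _, by simpa using mem_gen hs⟩, rfl⟩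
      · obtain ⟨s, hs, rfl⟩ := List.mem_map.1 hg
        exact ⟨_, ⟨mem_gen hs, by simp⟩, rfl⟩
    intro h
    obtain ⟨p, hp, hpe⟩ := hle h
    rw [emb_injective e hpe] at hp
    exact hp
  · rintro ⟨hb, ha⟩
    have h1 : gen T ≤ (gen (embGens e S T)).comap
        ((emb e).comp ((MonoidHom.id (Perm V)).prod (MonoidHom.id (Perm V)))) := by
      rw [gen_le]
      exact fun s hs => mem_gen (List.mem_append_right _ (List.mem_map.2 ⟨s, hs, rfl⟩))
    have h2 : gen S ≤ (gen (embGens e S T)).comap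
        ((emb e).comp (MonoidHom.inr (Perm V) (Perm V))) := by
      rw [gen_le]
      exact fun s hs => mem_gen (List.mem_append_left _ (List.mem_map.2 ⟨s, hs, rfl⟩))
    have h3 : emb e ((b, b) * (1, b⁻¹ * a)) ∈ gen (embGens e S T) := by
      rw [map_mul]
      exact mul_mem (h1 hb) (h2 ha)
    simpa using h3

theorem exists_emb_of_mem {S T : List (Perm V)} {γ : Perm (Fin (n + n))}
    (h : γ ∈ gen (embGens e S T)) : ∃ p, γ = emb e p := by
  have hle : gen (embGens e S T) ≤ (emb e).range := by
    rw [gen_le]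
    intro g hg
    rcases List.mem_append.1 hg with hg | hg
    · obtain ⟨s, -, rfl⟩ := List.mem_map.1 hg
      exact ⟨_, rfl⟩
    · obtain ⟨s, -, rfl⟩ := List.mem_map.1 hg
      exact ⟨_, rfl⟩
  obtain ⟨p, hp⟩ := hle h
  exact ⟨p, hp.symm⟩

/-- The map that is to be conjugated: `f⁻¹`, from the first copy to the second. Its values on the
second copy are irrelevant. -/
def embW (f : Perm V) : Fin (n + n) → Fin (n + n) :=
  Fin.append (fun i => Fin.natAdd n ((e.permCongr f)⁻¹ i)) (Fin.natAdd n)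

theorem embW_ptD (f : Perm V) (v : V) : embW e f (ptD e v) = ptC e (f⁻¹ v) := by
  simp only [embW, ptD, ptC, Fin.append_left]
  congr 1
  rw [Perm.inv_eq_iff_eq]
  simp

/-- The values of the points: the labels, shifted by `n` on the first copy. -/
def embVal (ρ : V → ℕ) : Fin (n + n) → ℕ :=
  Fin.append (fun i => n + ρ (e.symm i)) (fun i => ρ (e.symm i))

theorem embVal_ptC (ρ : V → ℕ) (v : V) : embVal e ρ (ptC e v) = ρ v := by
  simp [embVal, ptC, -Fin.natAdd_eq_addNat]

theorem embVal_ptD (ρ : V → ℕ) (v : V) : embVal e ρ (ptD e v) = n + ρ v := by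
  simp [embVal, ptD]

/-- The shift by `n` keeps the values on the two copies apart. -/
theorem embVal_injective {ρ : V → ℕ} (hinj : Function.Injective ρ)
    (hρ : ∀ v, 1 ≤ ρ v ∧ ρ v ≤ n) : Function.Injective (embVal e ρ) := by
  intro i j h
  rcases pt_cases e i with ⟨u, rfl⟩ | ⟨u, rfl⟩ <;> rcases pt_cases e j with ⟨v, rfl⟩ | ⟨v, rfl⟩ <;>
    simp only [embVal_ptC, embVal_ptD] at h
  · rw [hinj (Nat.add_left_cancel h)]
  · have := hρ u; have := hρ v; omega
  · have := hρ u; have := hρ v; omega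
  · rw [hinj h]

/-- The points of the first copy in the order of their labels. -/
def embPoints (r : V ≃ Fin n) : List (Fin (n + n)) := List.ofFn fun i => ptD e (r.symm i)

theorem mem_embPoints (r : V ≃ Fin n) (i : Fin (n + n)) :
    i ∈ embPoints e r ↔ ∃ v, i = ptD e v := by
  simp only [embPoints, List.mem_ofFn]
  constructor
  · rintro ⟨j, rfl⟩
    exact ⟨_, rfl⟩
  · rintro ⟨v, rfl⟩
    exact ⟨r v, by simp⟩

theorem nodup_embPoints (r : V ≃ Fin n) : (embPoints e r).Nodup :=
  List.nodup_ofFn.2 ((ptD_injective e).comp r.symm.injective)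

/-- Conjugating `embW e f` by the pair `(b, a)` amounts to replacing `f⁻¹` by `a⁻¹ f⁻¹ b`. -/
theorem word_emb (f : Perm V) (ρ : V → ℕ) (b a : Perm V) (A : List V) :
    word (embW e f) (embVal e ρ) (emb e (b, a)) (A.map (ptD e)) =
      A.map fun v => ρ (a⁻¹ (f⁻¹ (b v))) := by
  simp only [word, List.map_map]
  refine List.map_congr_left fun v _ => ?_
  simp only [Function.comp_apply, emb_ptD, embW_ptD, emb_inv_ptC, embVal_ptC]

end

/-! ### Correctness of the reduction -/

section
variable {V : Type u} {n : ℕ} (e r : V ≃ Fin n)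

/-- All elements of `V` in the order of their labels. -/
def labelOrder (r : V ≃ Fin n) : List V := List.ofFn r.symm

theorem embPoints_eq : embPoints e r = (labelOrder r).map (ptD e) := by
  simp [embPoints, labelOrder, List.map_ofFn, Function.comp_def]

theorem map_labelOrder {ρ : V → ℕ} (hr : ∀ v, ρ v = r v + 1) :
    (labelOrder r).map ρ = List.range' 1 n := by
  apply List.ext_getElem (by simp [labelOrder])
  intro i h1 h2
  simp [labelOrder, hr]
  omega

open Classical in
/-- The sequence of points on which the words are minimized, as elements of `V`. -/
noncomputable def orbitOrder (Δ : Subgroup (Perm V)) (r : V ≃ Fin n) : List V :=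
  (labelOrder r).flatMap fun v => ((labelOrder r).filter fun u => ∃ δ ∈ Δ, δ u = v).reverse

variable {S T : List (Perm V)} (hΔ : gen T = normIn (gen T) (gen S : Set (Perm V)))
include hΔ

theorem orbit_ptD {u v : V} :
    (∃ γ ∈ gen (embGens e S T), γ (ptD e u) = ptD e v) ↔ ∃ δ ∈ gen T, δ u = v := by
  constructor
  · rintro ⟨γ, hγ, h⟩
    obtain ⟨⟨b, a⟩, rfl⟩ := exists_emb_of_mem e hγ
    rw [emb_ptD] at h
    exact ⟨b, ((mem_gen_embGens e hΔ).1 hγ).1, ptD_injective e h⟩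
  · rintro ⟨δ, hδ, h⟩
    refine ⟨emb e (δ, δ), (mem_gen_embGens e hΔ).2 ⟨hδ, by simp⟩, ?_⟩
    rw [emb_ptD]
    exact congrArg _ h

theorem block_ptD (v : V) [DecidablePred fun u => ∃ δ ∈ gen T, δ u = v] :
    block (gen (embGens e S T)) (embPoints e r) (ptD e v) =
      (((labelOrder r).filter fun u => ∃ δ ∈ gen T, δ u = v).reverse).map (ptD e) := by
  rw [block, embPoints_eq, List.filter_map, List.map_reverse]
  congr 2
  refine List.filter_congr fun u _ => ?_
  simp only [Function.comp_apply, decide_eq_decide]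
  exact orbit_ptD e hΔ

theorem flatMap_block : (embPoints e r).flatMap (block (gen (embGens e S T)) (embPoints e r)) =
    (orbitOrder (gen T) r).map (ptD e) := by
  classical
  conv_lhs => arg 2; rw [embPoints_eq]
  rw [List.flatMap_map, orbitOrder, List.map_flatMap]
  refine List.flatMap_congr fun v _ => ?_
  rw [block_ptD e r hΔ]

omit hΔ in
/-- The labels of the points on which the words are minimized depend on the labeling coset only. -/
theorem positions_eq {ρ : V → ℕ} (hr : ∀ v, ρ v = r v + 1) (Δ : Subgroup (Perm V)) :
    positions n (labelingCoset Δ ρ) = (orbitOrder Δ r).map ρ := by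
  have hinj : Function.Injective ρ := fun u v h => r.injective (Fin.ext (by
    rw [hr, hr] at h
    omega))
  rw [positions, ← map_labelOrder r hr, List.flatMap_map, orbitOrder, List.map_flatMap]
  refine List.flatMap_congr fun v _ => ?_
  rw [List.filter_map, List.map_reverse]
  congr 2
  refine List.filter_congr fun u _ => ?_
  simp only [Function.comp_apply, decide_eq_decide]
  constructor
  · rintro ⟨_, ⟨δ, hδ, rfl⟩, _, ⟨δ', hδ', rfl⟩, w, h, h'⟩
    refine ⟨δ' * δ⁻¹, mul_mem hδ' (inv_mem hδ), ?_⟩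
    rw [← hinj h, ← hinj h']
    simp
  · rintro ⟨δ, hδ, rfl⟩
    exact ⟨ρ, ⟨1, one_mem _, rfl⟩, ρ ∘ δ, ⟨δ, hδ, rfl⟩, u, rfl, rfl⟩

/-- A coset of pairs that minimize the words on two copies of `V` yields the canonical labeling
coset: the pair `(b, a)` stands for the labeling `ρ b⁻¹` and the permutation `f a b⁻¹`. -/
theorem canon_eq [Finite V] (e r : V ≃ Fin (Nat.card V)) {ρ : V → ℕ} (hr : ∀ v, ρ v = r v + 1)
    (f : Perm V) (ps : List (Perm V × Perm V)) (b₀ a₀ : Perm V)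
    (hsol : Solves (embW e f) (embVal e ρ) (gen (embGens e S T)) 1
      ((embPoints e r).flatMap (block (gen (embGens e S T)) (embPoints e r)))
      (gen (ps.map (emb e))) (emb e (b₀, a₀))) :
    canon V (groupCoset (gen S) f) (labelingCoset (gen T) ρ) =
      labelingCoset (gen (ps.map fun p => b₀ * p.1 * b₀⁻¹)) (ρ ∘ ⇑(b₀⁻¹)) := by
  have hinj : Function.Injective ρ := fun u v h => r.injective (Fin.ext (by
    rw [hr, hr] at h
    omega))
  rw [flatMap_block e r hΔ] at hsol
  set L := orbitOrder (gen T) r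
  have hword : ∀ b a : Perm V, labelWord (Nat.card V) (labelingCoset (gen T) ρ) (ρ ∘ ⇑(b⁻¹))
      (f * (a * b⁻¹)) = word (embW e f) (embVal e ρ) (emb e (b, a)) (L.map (ptD e)) := by
    intro b a
    rw [word_emb, labelWord, positions_eq r hr, List.map_map]
    refine List.map_congr_left fun v _ => ?_
    have h := entry_apply (hinj.comp (b⁻¹).injective) (f * (a * b⁻¹)) (b (a⁻¹ (f⁻¹ (b v))))
    simpa using h
  -- The pairs of a labeling in the labeling coset and an element of the group coset correspond
  -- to the elements of the group on two copies of `V`.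
  have hto : ∀ b a : Perm V, emb e (b, a) ∈ gen (embGens e S T) →
      ρ ∘ ⇑(b⁻¹) ∈ labelingCoset (gen T) ρ ∧ f * (a * b⁻¹) ∈ groupCoset (gen S) f := by
    intro b a h
    obtain ⟨hb, ha⟩ := (mem_gen_embGens e hΔ).1 h
    refine ⟨⟨b⁻¹, inv_mem hb, rfl⟩, _, ?_, rfl⟩
    have := (conj_mem_iff hΔ hb _).2 ha
    simpa using this
  have hfrom : ∀ l ∈ labelingCoset (gen T) ρ, ∀ x ∈ groupCoset (gen S) f, ∃ b a : Perm V,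
      emb e (b, a) ∈ gen (embGens e S T) ∧ l = ρ ∘ ⇑(b⁻¹) ∧ x = f * (a * b⁻¹) := by
    rintro _ ⟨δ, hδ, rfl⟩ _ ⟨g, hg, rfl⟩
    refine ⟨δ⁻¹, g * δ⁻¹, (mem_gen_embGens e hΔ).2 ⟨inv_mem hδ, ?_⟩, by simp, by simp⟩
    have := (conj_mem_iff hΔ hδ _).2 hg
    simpa [mul_assoc] using this
  have hmem₀ : emb e (b₀, a₀) ∈ gen (embGens e S T) := by simpa using hsol.mem
  have hgen : gen (ps.map fun p => b₀ * p.1 * b₀⁻¹) =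
      (Subgroup.closure {p | p ∈ ps}).map
        ((MulAut.conj b₀).toMonoidHom.comp (MonoidHom.fst (Perm V) (Perm V))) := by
    rw [MonoidHom.map_closure, gen]
    congr 1
    ext g
    simp
  have hgen' : gen (ps.map (emb e)) = (Subgroup.closure {p | p ∈ ps}).map (emb e) := by
    rw [MonoidHom.map_closure, gen]
    congr 1
    ext g
    simp
  ext l
  constructor
  · rintro ⟨hl, x, hx, hmin⟩
    obtain ⟨b, a, hba, rfl, rfl⟩ := hfrom l hl x hx
    have h1 : word (embW e f) (embVal e ρ) (emb e (b, a)) (L.map (ptD e)) =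
        word (embW e f) (embVal e ρ) (emb e (b₀, a₀)) (L.map (ptD e)) := by
      apply le_antisymm
      · obtain ⟨hl₀, hx₀⟩ := hto b₀ a₀ hmem₀
        have := hmin _ hl₀ _ hx₀
        rwa [hword, hword] at this
      · simpa using hsol.min _ hba
    have h2 : (emb e (b₀, a₀))⁻¹ * emb e (b, a) ∈ gen (ps.map (emb e)) :=
      (hsol.stab _).2 ⟨mul_mem (inv_mem hmem₀) hba, by simpa using h1⟩
    rw [hgen'] at h2
    obtain ⟨p, hp, hpe⟩ := h2
    rw [eq_inv_mul_iff_mul_eq, ← map_mul] at hpe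
    have hpe := congrArg Prod.fst (emb_injective e hpe)
    simp only [Prod.fst_mul] at hpe
    refine ⟨(MulAut.conj b₀) p.1⁻¹, ?_, ?_⟩
    · rw [hgen]
      exact ⟨p⁻¹, inv_mem hp, rfl⟩
    · rw [← hpe]
      ext u
      simp
  · rintro ⟨δ, hδ, rfl⟩
    rw [hgen] at hδ
    obtain ⟨p, hp, rfl⟩ := hδ
    have h1 : emb e p⁻¹ ∈ gen (ps.map (emb e)) := by
      rw [hgen']
      exact ⟨_, inv_mem hp, rfl⟩
    obtain ⟨h2, h3⟩ := (hsol.stab _).1 h1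
    have h4 := mul_mem hmem₀ h2
    rw [← map_mul] at h3 h4
    generalize hq : (b₀, a₀) * p⁻¹ = q at h3 h4
    obtain ⟨b₁, a₁⟩ := q
    have hb₁ : b₁ = b₀ * p.1⁻¹ := (congrArg Prod.fst hq).symm
    obtain ⟨hl, hx⟩ := hto _ _ h4
    have he : (ρ ∘ ⇑(b₀⁻¹)) ∘ ⇑(((MulAut.conj b₀).toMonoidHom.comp
        (MonoidHom.fst (Perm V) (Perm V))) p) = ρ ∘ ⇑(b₁⁻¹) := by
      ext u
      simp [hb₁]
    rw [he]
    refine ⟨hl, _, hx, fun l' hl' x' hx' => ?_⟩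
    obtain ⟨b, a, hba, rfl, rfl⟩ := hfrom l' hl' x' hx'
    rw [hword, hword, h3]
    simpa using hsol.min _ hba

end

/-! ### The reduction on the machine -/

section
variable {M : ℕ} (hM : 1000 ≤ M)

theorem encF_append {m m' : ℕ} (a : Fin m → ℕ) (b : Fin m' → ℕ) :
    encF (Fin.append a b) = encN (List.ofFn a ++ List.ofFn b) := by
  rw [encF, List.ofFn_fin_append]

include hM

theorem call_compF {N m m' : ℕ} (hN : N ≤ M) (hm : m ≤ M) (l : Fin N → ℕ) (g : Fin m → Fin N)
    (h : Fin m' → ℕ) :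
    CallLe prog iComp (encF l ⊹ encP g ⊹ encF h) (encF (Fin.append (l ∘ g) h)) (M ^ 4) := by
  have := call_comp hM (List.ofFn l) (List.ofFn fun i => (g i : ℕ)) (List.ofFn h)
    (by simp [List.mem_ofFn]; intro i; omega) (by simpa)
  rw [map_getD_ofFn] at this
  rwa [encF_append]

theorem call_rangeF {m : ℕ} (hm : m ≤ M) (g : Fin m → ℕ) (a : ℕ) :
    CallLe prog iRange (.num a ⊹ encF g) (encF fun i : Fin m => a + (i : ℕ)) (M ^ 2) := by
  have := call_range hM .num (List.ofFn g) (by simpa) a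
  have e : List.range' a (List.ofFn g).length = List.ofFn fun i : Fin m => a + (i : ℕ) := by
    apply List.ext_getElem <;> simp
  rwa [e] at this

variable {V : Type u} {n : ℕ} (e : V ≃ Fin n) (hn : n + n ≤ M)
include hn

/-- `fun i => n + i` is the inclusion of the second copy of `V`. -/
theorem call_embD (δ : Perm V) :
    CallLe prog iEmbD ((encP (1 : Perm (Fin n)) ⊹ encF fun i : Fin n => n + (i : ℕ)) ⊹
      encP (e.permCongr δ)) (encP (emb e (δ, δ))) (M ^ 6) := by
  have hpow := pow_facts hM
  refine .of_wp (body := embDCode) rfl ?_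
  simp [embDCode, wp, -permCongr_apply]
  refine (call_mulF hM (by omega) (by omega) _ (e.permCongr δ)).wp_call fun t1 ht1 => ?_
  refine (call_compF hM (N := n) (by omega) (by omega) _ (1 : Perm (Fin n)) _).wp_call
    fun t2 ht2 => ⟨?_, by omega⟩
  rw [encP, emb_coe]
  congr 1
  ext i
  induction i using Fin.addCases <;> simp [-Fin.natAdd_eq_addNat]

theorem call_embG (g : Perm V) :
    CallLe prog iEmbG ((encP (1 : Perm (Fin n)) ⊹ encF fun i : Fin n => n + (i : ℕ)) ⊹
      encP (e.permCongr g)) (encP (emb e (1, g))) (M ^ 6) := by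
  have hpow := pow_facts hM
  refine .of_wp (body := embGCode) rfl ?_
  simp [embGCode, wp, -permCongr_apply]
  refine (call_mulF hM (by omega) (by omega) _ (e.permCongr g)).wp_call fun t1 ht1 => ?_
  refine (call_compF hM (N := n) (by omega) (by omega) _ (1 : Perm (Fin n)) _).wp_call
    fun t2 ht2 => ⟨?_, by omega⟩
  rw [encP, emb_coe]
  congr 1
  ext i
  induction i using Fin.addCases <;> simp [-Fin.natAdd_eq_addNat]

theorem call_embDMap (T : List (Perm V)) (hT : T.length ≤ M) :
    CallLe prog iEmbDMap ((encP (1 : Perm (Fin n)) ⊹ encF fun i : Fin n => n + (i : ℕ)) ⊹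
      encL (T.map e.permCongr) ⊹ .num 0) (encL (T.map fun δ => emb e (δ, δ))) (M ^ 8) := by
  have h := CallLe.map (p := prog) (self := iEmbDMap) (c := iEmbD)
    (ctx := encP (1 : Perm (Fin n)) ⊹ encF fun i : Fin n => n + (i : ℕ)) rfl
    (fun δ : Perm V => encP (e.permCongr δ)) (fun δ : Perm V => encP (emb e (δ, δ))) T []
    fun b _ => call_embD hM e hn b
  have h := h.mono (loop_le hM (a := 5) (b := 0) le_rfl (by simpa using hT))
  simpa [encL, Function.comp_def, Data.ofList] using h

theorem call_embGMap (S T : List (Perm V)) (hS : S.length ≤ M) :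
    CallLe prog iEmbGMap ((encP (1 : Perm (Fin n)) ⊹ encF fun i : Fin n => n + (i : ℕ)) ⊹
      encL (S.map e.permCongr) ⊹ encL (T.map fun δ => emb e (δ, δ))) (encL (embGens e S T))
      (M ^ 8) := by
  have h := CallLe.map (p := prog) (self := iEmbGMap) (c := iEmbG)
    (ctx := encP (1 : Perm (Fin n)) ⊹ encF fun i : Fin n => n + (i : ℕ)) rfl
    (fun g : Perm V => encP (e.permCongr g)) (fun g : Perm V => encP (emb e (1, g))) S
    (T.map fun δ => encP (emb e (δ, δ))) fun b _ => call_embG hM e hn b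
  have h := h.mono (loop_le hM (a := 5) (b := 0) le_rfl (by simpa using hS))
  simpa [encL, embGens, Function.comp_def] using h

omit hM hn in
theorem emb_castAdd (p : Perm V × Perm V) :
    (encF fun i : Fin n => (emb e p (Fin.castAdd n i) : ℕ)) = encP (e.permCongr p.1) := by
  simp [encP, emb_coe]

theorem call_out (q p : Perm V × Perm V) :
    CallLe prog iOut ((encP (emb e q) ⊹ encP (1 : Perm (Fin n))) ⊹ encP (emb e p))
      (encP (e.permCongr (q.1 * p.1 * q.1⁻¹))) (M ^ 7) := by
  have hpow := pow_facts hM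
  have hy : encF ((fun i => ((emb e q * (emb e p * (emb e q)⁻¹)) i : ℕ)) ∘ Fin.castAdd n) =
      encP (e.permCongr (q.1 * p.1 * q.1⁻¹)) := by
    rw [← map_inv, ← map_mul, ← map_mul, mul_assoc]
    exact emb_castAdd e (q * (p * q⁻¹))
  rw [← hy]
  refine .of_wp (body := outCode) rfl ?_
  simp only [outCode, wp, List.getD_cons_zero, Data.fst_pair, Data.snd_pair]
  refine (call_inv hM hn (emb e q)).wp_call fun t1 ht1 => ?_
  refine (call_mul hM hn (emb e p) _).wp_call fun t2 ht2 => ?_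
  refine (call_mul hM hn (emb e q) _).wp_call fun t3 ht3 => ?_
  exact (call_mulF hM hn (m := n) (by omega) _ (Fin.castAdd n)).wp_call
    fun t4 ht4 => ⟨rfl, by omega⟩

theorem call_outMap (q : Perm V × Perm V) (ps : List (Perm V × Perm V)) (hps : ps.length ≤ M) :
    CallLe prog iOutMap ((encP (emb e q) ⊹ encP (1 : Perm (Fin n))) ⊹ encL (ps.map (emb e)) ⊹
      .num 0) (encL ((ps.map fun p => q.1 * p.1 * q.1⁻¹).map e.permCongr)) (M ^ 9) := by
  have h := CallLe.map (p := prog) (self := iOutMap) (c := iOut)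
    (ctx := encP (emb e q) ⊹ encP (1 : Perm (Fin n))) rfl
    (fun p : Perm V × Perm V => encP (emb e p))
    (fun p : Perm V × Perm V => encP (e.permCongr (q.1 * p.1 * q.1⁻¹))) ps []
    fun b _ => call_out hM e hn q b
  have h := h.mono (loop_le hM (a := 6) (b := 0) le_rfl (by simpa using hps))
  simpa only [encL, Function.comp_def, Data.ofList, List.map_map, List.append_nil] using h

/-- The machine lists the points of the first copy in the order of their labels. -/
theorem call_points (r : V ≃ Fin n) {ρ : V → ℕ} (hr : ∀ v, ρ v = r v + 1) :
    CallLe prog iPosMap (encF (ρ ∘ e.symm) ⊹ (encF fun i : Fin n => 1 + (i : ℕ)) ⊹ .num 0)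
      (encA (embPoints e r)) (M ^ 5) := by
  have h := call_posMap hM (List.ofFn (ρ ∘ e.symm)) (List.ofFn fun i : Fin n => 1 + (i : ℕ))
    (by simp; omega) (by simp; omega)
  have hA : (List.ofFn fun i : Fin n => 1 + (i : ℕ)).map
      ((List.ofFn (ρ ∘ e.symm)).idxOf ·) = (embPoints e r).map Fin.val := by
    apply List.ext_getElem (by simp [embPoints])
    intro i h1 h2
    simp only [List.length_map, List.length_ofFn] at h1
    have hnd : (List.ofFn (ρ ∘ e.symm)).Nodup := List.nodup_ofFn.2 fun a b hab =>
      e.symm.injective (r.injective (Fin.ext (by simpa [hr] using hab)))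
    have := hnd.idxOf_getElem (e (r.symm ⟨i, h1⟩)) (by simp)
    simpa [hr, embPoints, ptD, add_comm] using this
  rwa [hA] at h

omit hn in
theorem call_embVal (ρ : V → ℕ) (hρ : ∀ v, ρ v ≤ n) (hn1 : n + 1 ≤ M) :
    CallLe prog iComp ((encF fun i : Fin (n + 1) => n + (i : ℕ)) ⊹ encF (ρ ∘ e.symm) ⊹
      encF (ρ ∘ e.symm)) (encF (embVal e ρ)) (M ^ 4) :=
  call_compF hM hn1 (by omega) (fun i : Fin (n + 1) => n + (i : ℕ))
    (fun i => (⟨ρ (e.symm i), Nat.lt_succ_of_le (hρ _)⟩ : Fin (n + 1))) _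

theorem call_embW (f : Perm V) :
    CallLe prog iComp ((encF fun i : Fin n => n + (i : ℕ)) ⊹ encP ((e.permCongr f)⁻¹ : Perm _) ⊹
      encF fun i : Fin n => n + (i : ℕ)) (encP (embW e f)) (M ^ 4) := by
  have h := call_compF hM (N := n) (by omega) (by omega) (fun i : Fin n => n + (i : ℕ))
    ((e.permCongr f)⁻¹ : Perm _) fun i : Fin n => n + (i : ℕ)
  convert h using 1
  rw [encP]
  congr 1
  ext i
  induction i using Fin.addCases <;> simp [embW, -Fin.natAdd_eq_addNat]

end

/-! ### The algorithm -/

section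
variable {M : ℕ} (hM : 1000 ≤ M) {V : Type u} {n : ℕ} (e r : V ≃ Fin n)

include hM in
open Classical in
/-- The main function computes a coset of minimizing pairs `(b, a)` and returns its projection to
the first component, in the form that `canon_eq` describes. -/
theorem call_main {S T : List (Perm V)} (hΔ : gen T = normIn (gen T) (gen S : Set (Perm V)))
    (f : Perm V) {ρ : V → ℕ} (hr : ∀ v, ρ v = r v + 1) (hS : S.length ≤ M) (hT : T.length ≤ M)
    (hNM : (n + n) * (n + n) + 1 ≤ M) (hn1 : n + 1 ≤ M) {k : ℕ} (hk : 2 ^ k ≤ M)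
    (horb : ∀ v, ((labelOrder r).filter fun u => ∃ δ ∈ gen T, δ u = v).length ≤ k) :
    ∃ (ps : List (Perm V × Perm V)) (b₀ a₀ : Perm V), ps.length ≤ M ∧
      CallLe prog iMain (.num n ⊹ encL (S.map e.permCongr) ⊹ encP (e.permCongr f) ⊹
        encL (T.map e.permCongr) ⊹ encF (ρ ∘ e.symm) ⊹ .num 0)
        (encL ((ps.map fun p => b₀ * p.1 * b₀⁻¹).map e.permCongr) ⊹
          encF ((ρ ∘ ⇑(b₀⁻¹)) ∘ e.symm)) (4096 ^ k * M ^ 24) ∧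
      Solves (embW e f) (embVal e ρ) (gen (embGens e S T)) 1
        ((embPoints e r).flatMap (block (gen (embGens e S T)) (embPoints e r)))
        (gen (ps.map (emb e))) (emb e (b₀, a₀)) := by
  have hpow := pow_facts hM
  have hn : n + n ≤ M := by nlinarith
  have hinj : Function.Injective ρ := fun u v h => r.injective (Fin.ext (by
    rw [hr, hr] at h
    omega))
  have hρ : ∀ v, 1 ≤ ρ v ∧ ρ v ≤ n := fun v => by rw [hr]; omega
  obtain ⟨gens, hgens, hred, hgen⟩ := call_filter hM hn (embGens e S T) (by
    simp only [embGens, List.length_append, List.length_map]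
    omega)
  obtain ⟨gens', σ', hfold, hred', hsol⟩ := call_blockFold hM hn (embW e f) (embVal e ρ)
    (embVal_injective e hinj hρ) hNM hk gens hred (embPoints e r) (nodup_embPoints e r)
    (fun γ hγ i hi => by
      rw [mem_embPoints] at hi ⊢
      obtain ⟨v, rfl⟩ := hi
      obtain ⟨p, rfl⟩ := exists_emb_of_mem e (hgen ▸ hγ)
      exact ⟨_, emb_ptD e p v⟩)
    (fun i hi => by
      obtain ⟨v, rfl⟩ := (mem_embPoints e r i).1 hi
      rw [hgen, block_ptD e r hΔ]
      simpa using horb v)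
  rw [hgen] at hsol
  have hmem : ∀ γ ∈ gens', ∃ p, emb e p = γ := fun γ hγ => by
    obtain ⟨p, hp⟩ := exists_emb_of_mem e ((hsol.stab γ).1 (mem_gen hγ)).1
    exact ⟨p, hp.symm⟩
  obtain ⟨ps, rfl⟩ : ∃ ps : List (Perm V × Perm V), gens' = ps.map (emb e) := by
    choose! F hF using hmem
    exact ⟨gens'.map F, by
      rw [List.map_map]
      exact (List.map_congr_left fun γ hγ => hF γ hγ).trans (List.map_id _) |>.symm⟩
  obtain ⟨⟨b₀, a₀⟩, rfl⟩ := exists_emb_of_mem e (S := S) (T := T) (by simpa using hsol.mem)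
  have hps : ps.length ≤ M := by simpa using hred'.length_le.trans hNM
  refine ⟨ps, b₀, a₀, hps, .of_wp (body := mainCode) rfl ?_, hsol⟩
  have hcons : encF (Fin.cons 0 (ρ ∘ e.symm) : Fin (n + 1) → ℕ) = .num 0 ⊹ encF (ρ ∘ e.symm) := by
    simp [encF, encN, List.ofFn_succ, Data.ofList]
    rfl
  have hrange := call_rangeF hM (m := n + 1) hn1 (Fin.cons 0 (ρ ∘ e.symm)) n
  rw [hcons] at hrange
  -- The restriction to the first copy is a composition with `Fin.castAdd`, whose code is that of
  -- the identity.
  have hinv : (encF fun i : Fin n => (((emb e (b₀, a₀))⁻¹ (Fin.castAdd n i) : Fin (n + n)) : ℕ)) =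
      encP (e.permCongr b₀⁻¹) := by
    rw [← map_inv]
    exact emb_castAdd e _
  have hcastinv := call_mulF hM hn (m := n) (by omega)
    (fun i => (((emb e (b₀, a₀))⁻¹ i : Fin (n + n)) : ℕ)) (Fin.castAdd n)
  rw [Function.comp_def, hinv] at hcastinv
  have hX : M ^ 23 ≤ 4096 ^ k * M ^ 23 := Nat.le_mul_of_pos_left _ (by positivity)
  have hX' : 1000 * (4096 ^ k * M ^ 23) ≤ 4096 ^ k * M ^ 24 := by
    rw [mul_left_comm]
    exact Nat.mul_le_mul_left _ (le_pow_succ hM 23)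
  simp only [mainCode, wp, List.getD_cons_zero, List.getD_cons_succ, Data.fst_pair, Data.snd_pair]
  refine (call_one hM (by omega) (ρ ∘ e.symm)).wp_call fun t1 ht1 => ?_
  refine (call_rangeF hM (by omega) (ρ ∘ e.symm) n).wp_call fun t2 ht2 => ?_
  refine hrange.wp_call fun t3 ht3 => ?_
  refine (call_embVal hM e ρ (fun v => (hρ v).2) hn1).wp_call fun t4 ht4 => ?_
  refine (call_embDMap hM e hn T hT).wp_call fun t5 ht5 => ?_
  refine (call_embGMap hM e hn S T hS).wp_call fun t6 ht6 => ?_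
  refine hgens.wp_call fun t7 ht7 => ?_
  refine (call_inv hM (by omega) (e.permCongr f)).wp_call fun t8 ht8 => ?_
  refine (call_embW hM e hn f).wp_call fun t9 ht9 => ?_
  refine (call_rangeF hM (by omega) (ρ ∘ e.symm) 1).wp_call fun t10 ht10 => ?_
  refine (call_points hM e hn r hr).wp_call fun t11 ht11 => ?_
  refine (call_rangeF hM (by omega) (ρ ∘ e.symm) 1).wp_call fun t12 ht12 => ?_
  refine (call_points hM e hn r hr).wp_call fun t13 ht13 => ?_
  refine (call_one hM hn (embVal e ρ)).wp_call fun t14 ht14 => ?_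
  refine hfold.wp_call fun t15 ht15 => ?_
  refine (call_outMap hM e hn (b₀, a₀) ps hps).wp_call fun t16 ht16 => ?_
  refine (call_inv hM hn (emb e (b₀, a₀))).wp_call fun t17 ht17 => ?_
  refine hcastinv.wp_call fun t18 ht18 => ?_
  refine (call_mulF hM (N := n) (by omega) (by omega) (ρ ∘ e.symm)
    (e.permCongr b₀⁻¹)).wp_call fun t19 ht19 => ⟨?_, ?_⟩
  · congr 2
    ext i
    simp
  · omega

end

/-! ### Encodings and the running time -/

theorem encodeMap_eq {V : Type u} (e : V ≃ Fin (Nat.card V)) (l : V → ℕ) :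
    encodeMap e l = encF (l ∘ e.symm) := by
  simp [encodeMap, encF, encN, List.map_ofFn, Function.comp_def]

theorem encodePerm_eq {V : Type u} (e : V ≃ Fin (Nat.card V)) (g : Perm V) :
    encodePerm e g = encP (e.permCongr g) := by
  rw [encodePerm, encodeMap_eq]
  rfl

theorem encodePerms_eq {V : Type u} (e : V ≃ Fin (Nat.card V)) (S : List (Perm V)) :
    encodePerms e S = encL (S.map e.permCongr) := by
  rw [encodePerms, encL, List.map_map]
  exact congrArg _ (List.map_congr_left fun g _ => encodePerm_eq e g)

theorem size_ofList_le (l : List Data) (B : ℕ) (h : ∀ a ∈ l, a.size ≤ B) :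
    (Data.ofList l).size ≤ (B + 1) * l.length + 1 := by
  induction l with
  | nil => simp [Data.ofList, Data.size]
  | cons a l ih =>
    have h1 := h a List.mem_cons_self
    have h2 := ih fun b hb => h b (List.mem_cons_of_mem _ hb)
    simp only [Data.ofList, Data.size, List.length_cons, mul_add] at *
    omega

theorem size_encF_le {n : ℕ} (g : Fin n → ℕ) (hg : ∀ i, g i ≤ n) :
    (encF g).size ≤ (n + 2) * n + 1 := by
  have := size_ofList_le ((List.ofFn g).map .num) (n + 1) (by
    intro a ha
    obtain ⟨m, hm, rfl⟩ := List.mem_map.1 ha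
    obtain ⟨i, rfl⟩ := List.mem_ofFn.1 hm
    simpa [Data.size] using hg i)
  simpa [encF, encN] using this

theorem size_encL_le {n : ℕ} (L : List (Perm (Fin n))) :
    (encL L).size ≤ ((n + 2) * n + 2) * L.length + 1 := by
  have := size_ofList_le (L.map fun g : Perm (Fin n) => encP g) ((n + 2) * n + 1) (by
    intro a ha
    obtain ⟨g, -, rfl⟩ := List.mem_map.1 ha
    exact size_encF_le _ fun i => (g i).2.le)
  simpa [encL] using this

open Classical in
theorem length_filter_le_maxOrbit {V : Type u} [Finite V] (Δ : Subgroup (Perm V))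
    {n : ℕ} (r : V ≃ Fin n) (v : V) :
    ((labelOrder r).filter fun u => ∃ δ ∈ Δ, δ u = v).length ≤ maxOrbit Δ := by
  have hnd : ((labelOrder r).filter fun u => ∃ δ ∈ Δ, δ u = v).Nodup :=
    (List.nodup_ofFn.2 r.symm.injective).filter _
  rw [← List.toFinset_card_of_nodup hnd, ← Set.ncard_coe_finset]
  refine (Set.ncard_le_ncard (t := MulAction.orbit Δ v) ?_ (Set.toFinite _)).trans
    (le_ciSup (f := fun v => (MulAction.orbit Δ v).ncard) (Set.finite_range _).bddAbove v)
  intro u hu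
  simp only [List.coe_toFinset, List.mem_filter, decide_eq_true_eq, Set.mem_ofPred_eq] at hu
  obtain ⟨-, δ, hδ, rfl⟩ := hu
  exact ⟨⟨δ⁻¹, inv_mem hδ⟩, by simp [Subgroup.smul_def]⟩

theorem IsLabeling.exists_equiv {V : Type u} [Finite V] {ρ : V → ℕ} (hρ : IsLabeling ρ) :
    ∃ r : V ≃ Fin (Nat.card V), ∀ v, ρ v = r v + 1 := by
  have hmem : ∀ v, 1 ≤ ρ v ∧ ρ v ≤ Nat.card V := fun v => hρ.mapsTo (Set.mem_univ v)
  have hbij : Function.Bijective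
      fun v => (⟨ρ v - 1, by have := hmem v; omega⟩ : Fin (Nat.card V)) := by
    constructor
    · intro u v h
      have h := congrArg Fin.val h
      have := hmem u
      have := hmem v
      exact hρ.injective (by simp only at h; omega)
    · intro i
      obtain ⟨v, -, hv⟩ := hρ.surjOn (show (i : ℕ) + 1 ∈ Set.Icc 1 (Nat.card V) by simp)
      exact ⟨v, Fin.ext (by simp [hv])⟩
  exact ⟨Equiv.ofBijective _ hbij, fun v => by simp [Nat.sub_add_cancel (hmem v).1]⟩

/-- The base `4096 = 2 ^ 12` and the factor `2 ^ k` in the 25th power give the exponent `37 k`. -/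
theorem exists_time_le : ∃ C : ℕ, ∀ k s : ℕ,
    4096 ^ k * (1000 * 2 ^ k * (s + 1) ^ 2) ^ 25 ≤ C * 2 ^ (C * k) * (s + 1) ^ C := by
  have h : ∀ b c k x : ℕ, (b ^ 12) ^ k * (c * b ^ k * x ^ 2) ^ 25 =
      c ^ 25 * b ^ (37 * k) * x ^ 50 := by
    intro b c k x
    ring
  obtain ⟨C, hC, hC'⟩ : ∃ C : ℕ, 50 ≤ C ∧ 1000 ^ 25 ≤ C := ⟨1000 ^ 25, by norm_num, le_rfl⟩
  refine ⟨C, fun k s => ?_⟩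
  rw [show 4096 = 2 ^ 12 by norm_num, h 2 1000]
  have h1 : 37 * k ≤ C * k := Nat.mul_le_mul_right _ (by omega)
  exact Nat.mul_le_mul (Nat.mul_le_mul hC' (Nat.pow_le_pow_right (by norm_num) h1))
    (Nat.pow_le_pow_right (by omega) hC)

/-- The generators in the output are a reduced list, so the time for writing the output is bounded
as well. -/
theorem exists_computesIn {M k : ℕ} (hM : 1000 ≤ M) {V : Type u} [Finite V]
    (e : V ≃ Fin (Nat.card V)) (S : List (Perm V)) (f : Perm V) (T : List (Perm V)) {ρ : V → ℕ}
    (hρ : IsLabeling ρ) (hΔ : gen T = normIn (gen T) (gen S : Set (Perm V)))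
    (hs : 4 * (Nat.card V + S.length + T.length + 1) ^ 2 ≤ M) (hk : 2 ^ k ≤ M)
    (horb : maxOrbit (gen T) ≤ k) :
    ∃ y, Represents e y (canon V (groupCoset (gen S) f) (labelingCoset (gen T) ρ)) ∧
      ComputesIn prog (encodeInput e S f T ρ) y (4096 ^ k * M ^ 25) := by
  obtain ⟨r, hr⟩ := hρ.exists_equiv
  generalize hn : Nat.card V + S.length + T.length = s at hs
  have hns : Nat.card V * Nat.card V ≤ s * s := Nat.mul_le_mul (by omega) (by omega)
  have hss : (s + 1) ^ 2 = s * s + 2 * s + 1 := by ring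
  have hNM : (Nat.card V + Nat.card V) * (Nat.card V + Nat.card V) + 1 ≤ M := by
    rw [show (Nat.card V + Nat.card V) * (Nat.card V + Nat.card V) =
      4 * (Nat.card V * Nat.card V) by ring]
    omega
  have h3 : (Nat.card V + 2) * Nat.card V + 2 ≤ M := by
    rw [add_mul]
    omega
  obtain ⟨ps, b₀, a₀, hps, ⟨t, ht, body, hb, hrun⟩, hsol⟩ := call_main hM e r hΔ f hr (by omega)
    (by omega) hNM (by omega) hk fun v => (length_filter_le_maxOrbit (gen T) r v).trans horb
  have hπ : IsLabeling (ρ ∘ ⇑(b₀⁻¹)) := hρ.comp _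
  have hcanon := canon_eq hΔ e r hr f ps b₀ a₀ hsol
  have hrep : Represents e
      (encodePerms e (ps.map fun p => b₀ * p.1 * b₀⁻¹) ⊹ encodeMap e (ρ ∘ ⇑(b₀⁻¹)))
      (canon V (groupCoset (gen S) f) (labelingCoset (gen T) ρ)) := by
    rw [hcanon]
    exact ⟨_, _, hπ, rfl, rfl⟩
  refine ⟨_, hrep, ?_⟩
  rw [encodePerms_eq, encodeMap_eq, encodeInput, encodePerms_eq, encodePerms_eq, encodePerm_eq,
    encodeMap_eq]
  refine ⟨_, .call (.var _ _) hb hrun, ?_⟩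
  have h1 := size_encL_le ((ps.map fun p => b₀ * p.1 * b₀⁻¹).map e.permCongr)
  have h2 := size_encF_le ((ρ ∘ ⇑(b₀⁻¹)) ∘ e.symm) fun i => (hπ.mapsTo (Set.mem_univ _)).2
  simp only [List.length_map] at h1
  have h4 := Nat.mul_le_mul h3 hps
  have hpow := pow_facts hM
  have hX : M ^ 24 ≤ 4096 ^ k * M ^ 24 := Nat.le_mul_of_pos_left _ (by positivity)
  have hX' : 1000 * (4096 ^ k * M ^ 24) ≤ 4096 ^ k * M ^ 25 := by
    rw [mul_left_comm]
    exact Nat.mul_le_mul_left _ (le_pow_succ hM 24)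
  rw [← sq] at h4
  simp only [Data.size]
  omega

end PermCanon

theorem mainTheorem3 :
    ∃ CL : PermCanon.LabelingFunction.{u}, PermCanon.SolvesShift CL ∧
      ∃ (p : PermCanon.Program) (C : ℕ),
        ∀ (V : Type u) [Finite V] (e : V ≃ Fin (Nat.card V))
          (S : List (Equiv.Perm V)) (f : Equiv.Perm V) (T : List (Equiv.Perm V)) (ρ : V → ℕ),
          PermCanon.IsLabeling ρ →
          PermCanon.gen T =
            PermCanon.normIn (PermCanon.gen T) (PermCanon.gen S : Set (Equiv.Perm V)) →
          ∃ y : PermCanon.Data,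
            PermCanon.Represents e y
              (CL V (PermCanon.groupCoset (PermCanon.gen S) f)
                (PermCanon.labelingCoset (PermCanon.gen T) ρ)) ∧
            PermCanon.ComputesIn p (PermCanon.encodeInput e S f T ρ) y
              (C * 2 ^ (C * PermCanon.maxOrbit (PermCanon.gen T)) *
                (Nat.card V + S.length + T.length + 1) ^ C) := by
  obtain ⟨C, hC⟩ := PermCanon.exists_time_le
  refine ⟨PermCanon.canon, PermCanon.solvesShift_canon, PermCanon.prog, C, ?_⟩
  intro V _ e S f T ρ hρ hΔ
  have h1 : 1 ≤ 2 ^ PermCanon.maxOrbit (PermCanon.gen T) := Nat.one_le_two_pow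
  have h2 : 1 ≤ (Nat.card V + S.length + T.length + 1) ^ 2 := Nat.one_le_pow _ _ (by omega)
  -- `M` has to bound the power of two, the square of the number of points of the two copies of
  -- `V`, and the numbers of generators.
  obtain ⟨y, hy, t, hrun, ht⟩ := PermCanon.exists_computesIn
    (M := 1000 * 2 ^ PermCanon.maxOrbit (PermCanon.gen T) *
      (Nat.card V + S.length + T.length + 1) ^ 2) (by nlinarith) e S f T hρ hΔ (by nlinarith)
    (by nlinarith) le_rfl
  exact ⟨y, hy, t, hrun, ht.trans (hC _ _)⟩
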